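/- Let $k\in\{\mathbb R,\mathbb C\}$, let $\mathrm{Ban}$ be the category of Banach spaces over $k$ and continuous linear maps, let $G$ be a group, and let $G\text{-}\mathrm{Ban}$ be the category of isometric representations of $G$ on Banach spaces and $G$-equivariant continuous linear maps. Both are quasi-abelian: short exact sequences are the kernel–cokernel pairs, admissible epics are the surjective morphisms, and an object is projective if it has the lifting property against admissible epics. For $M\in G\text{-}\mathrm{Ban}$ let $M_G=M/\overline{\operatorname{span}}\{m-gm : m\in M,\ g\in G\}$. Let $\mathcal C_r(\mathrm{Ban})=\mathrm D_r^{\le 0}\cap \mathrm D_r^{\ge 0}\subset \mathrm D(\mathrm{Ban})$ be the heart of the right $t$-structure, where $\mathrm D_r^{\le 0}$ and $\mathrm D_r^{\ge 0}$ are the essential images of the truncations $\tau_r^{\le 0}A=(\cdots\to A^{-1}\to A^0\to \operatorname{Im} d^0\to 0)$ and $\tau_r^{\ge 0}A=(0\to\operatorname{Coker} d^{-1}\to A^1\to A^2\to\cdots)$; write $(E\to 0)\in\mathcal C_r(\mathrm{Ban})$ for a Banach space $E$ placed in degree $0$, and $H_r^n=(\operatorname{Coker} d^{n-1}\to \operatorname{Im}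 d^n)$ for the associated cohomology. The $\ell^1$-homology functors are $\mathcal H^{\ell^1}_n(G,M)=H_r^{-n}(\mathbf L^-(-)_G(M))=H_r^{-n}((P_\bullet)_G)$, where $P_\bullet\twoheadrightarrow M$ is a projective resolution in $G\text{-}\mathrm{Ban}$ (these exist). A $\delta$-functor is a family of functors $T_n:G\text{-}\mathrm{Ban}\to\mathcal C_r(\mathrm{Ban})$, $n\in\mathbb Z$, together with, for each short exact sequence $M'\rightarrowtail M\twoheadrightarrow M''$, morphisms $\delta_{n+1}:T_{n+1}(M'')\to T_n(M')$ depending naturally on the sequence, such that $$\cdots\xrightarrow{\delta_{n+1}} T_n(M')\to T_n(M)\to T_n(M'')\xrightarrow{\delta_n}T_{n-1}(M')\to\cdots$$ is exact. A morphism of $\delta$-functors is a family of natural transformations commuting with the $\delta_n$. **Theorem.** Consider $\delta$-functors $(T_n,\delta_n)_{n\in\mathbb Z}$ with $T_n=0$ for $n<0$ having the following properties: 1. (Normalization) $T_0(M)=(M_G\to 0)$ for all $M\in G\text{-}\mathrm{Ban}$; that is, $T_0$ is equipped with a natural isomorphism to $M\mapsto(M_G\to 0)$. 2. (Vanishing)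 $T_n(P)=0$ for all projective $P\in G\text{-}\mathrm{Ban}$ and all $n>0$. Then: (a) There is such a $\delta$-functor, whose underlying functors are the $\ell^1$-homology functors $\mathcal H^{\ell^1}_n(G,-)$. (b) It is unique up to unique isomorphism: for any two such $\delta$-functors $T,T'$ there is exactly one isomorphism of $\delta$-functors $T\cong T'$ compatible with the identifications $T_0(M)\cong(M_G\to 0)\cong T'_0(M)$. (c) Every such $T$, in particular $\ell^1$-homology, is a universal homological $\delta$-functor: for every $\delta$-functor $T'$, each natural transformation $T'_0\to T_0$ extends uniquely to a morphism of $\delta$-functors $T'\to T$. -/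

import Mathlib

open CategoryTheory Limits

universe u

noncomputable section

/-! ### The category of Banach spaces -/

/-- A Banach space over `𝕜` (`ℝ` or `ℂ`). -/
structure Ban (𝕜 : Type) [RCLike 𝕜] where
  carrier : Type u
  [normedAddCommGroup : NormedAddCommGroup carrier]
  [normedSpace : NormedSpace 𝕜 carrier]
  [completeSpace : CompleteSpace carrier]

namespace Ban

variable {𝕜 : Type} [RCLike 𝕜]

instance : CoeSort (Ban.{u} 𝕜) (Type u) := ⟨Ban.carrier⟩

attribute [instance] normedAddCommGroup normedSpace completeSpace

/-- The Banach space with given underlying type. -/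
abbrev of (𝕜 : Type) [RCLike 𝕜] (E : Type u) [NormedAddCommGroup E] [NormedSpace 𝕜 E]
    [CompleteSpace E] : Ban.{u} 𝕜 := ⟨E⟩

/-- Morphisms of Banach spaces are the continuous linear maps. -/
@[ext]
structure Hom (E F : Ban.{u} 𝕜) where
  hom : E →L[𝕜] F

instance : Category (Ban.{u} 𝕜) where
  Hom E F := Hom E F
  id E := ⟨ContinuousLinearMap.id 𝕜 E⟩
  comp f g := ⟨g.hom.comp f.hom⟩

/-- The continuous linear map underlying a morphism. -/
abbrev hom {E F : Ban.{u} 𝕜} (f : E ⟶ F) : E →L[𝕜] F := Hom.hom f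

/-- The morphism given by a continuous linear map. -/
abbrev ofHom {E F : Ban.{u} 𝕜} (f : E →L[𝕜] F) : E ⟶ F := Hom.mk f

@[ext]
theorem hom_ext {E F : Ban.{u} 𝕜} {f g : E ⟶ F} (h : ∀ x, hom f x = hom g x) : f = g :=
  Hom.ext (ContinuousLinearMap.ext h)

@[simp] theorem hom_ofHom {E F : Ban.{u} 𝕜} (f : E →L[𝕜] F) : hom (ofHom f) = f := rfl
@[simp] theorem id_apply {E : Ban.{u} 𝕜} (x : E) : hom (𝟙 E) x = x := rfl
@[simp] theorem comp_apply {E F H : Ban.{u} 𝕜} (f : E ⟶ F) (g : F ⟶ H) (x : E) :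
    hom (f ≫ g) x = hom g (hom f x) := rfl

/-- Morphisms `E ⟶ F` are the same as continuous linear maps. -/
def homEquiv (E F : Ban.{u} 𝕜) : (E ⟶ F) ≃ (E →L[𝕜] F) where
  toFun f := hom f
  invFun f := ofHom f

instance (E F : Ban.{u} 𝕜) : AddCommGroup (E ⟶ F) := (homEquiv E F).addCommGroup

@[simp] theorem add_apply {E F : Ban.{u} 𝕜} (f g : E ⟶ F) (x : E) :
    hom (f + g) x = hom f x + hom g x := rfl

instance : Preadditive (Ban.{u} 𝕜) where
  add_comp := by intros; ext; simp
  comp_add := by intros; ext; simp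

@[simp] theorem zero_apply {E F : Ban.{u} 𝕜} (x : E) : hom (0 : E ⟶ F) x = 0 := rfl

theorem isZero_of_subsingleton (E : Ban.{u} 𝕜) [Subsingleton E] : IsZero E := by
  rw [IsZero.iff_id_eq_zero]
  ext x
  exact Subsingleton.elim _ _

instance : HasZeroObject (Ban.{u} 𝕜) :=
  ⟨⟨of 𝕜 PUnit.{u + 1}, isZero_of_subsingleton _⟩⟩

instance : HasBinaryBiproducts (Ban.{u} 𝕜) where
  has_binary_biproduct E F := HasBinaryBiproduct.mk
    { bicone :=
        { pt := of 𝕜 (E × F)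
          fst := ofHom (ContinuousLinearMap.fst 𝕜 E F)
          snd := ofHom (ContinuousLinearMap.snd 𝕜 E F)
          inl := ofHom (ContinuousLinearMap.inl 𝕜 E F)
          inr := ofHom (ContinuousLinearMap.inr 𝕜 E F) }
      isBilimit := isBinaryBilimitOfTotal _ (hom_ext fun x =>
        Prod.ext (add_zero x.1) (zero_add x.2)) }

variable (𝕜) in
/-- The underlying vector space of a Banach space. -/
def toModuleCat : Ban.{u} 𝕜 ⥤ ModuleCat.{u} 𝕜 where
  obj E := ModuleCat.of 𝕜 E
  map f := ModuleCat.ofHom (hom f).toLinearMap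

instance : (toModuleCat.{u} 𝕜).Additive where

/-! #### Cokernels and images in `Ban` -/

section

variable {E F : Ban.{u} 𝕜} (f : E ⟶ F)

/-- The closure of the range of `f`. -/
abbrev closedRange : Submodule 𝕜 F := (LinearMap.range (hom f).toLinearMap).topologicalClosure

instance : IsClosed (closedRange f : Set F) := Submodule.isClosed_topologicalClosure _

theorem apply_mem_closedRange (x : E) : hom f x ∈ closedRange f :=
  Submodule.le_topologicalClosure _ ⟨x, rfl⟩

/-- The cokernel `F ⧸ closure (range f)` in `Ban`. -/
abbrev coker : Ban.{u} 𝕜 := of 𝕜 (F ⧸ closedRange f)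

/-- The image in the sense of quasi-abelian categories (the kernel of `F ⟶ coker f`),
that is, the closure of the range. -/
abbrev im : Ban.{u} 𝕜 := of 𝕜 (closedRange f)

theorem closedRange_le_ker {H : Ban.{u} 𝕜} (g : F ⟶ H) (h : f ≫ g = 0) :
    closedRange f ≤ LinearMap.ker (hom g).toLinearMap :=
  Submodule.topologicalClosure_minimal _
    (by rintro _ ⟨x, rfl⟩; exact congrArg (fun k => hom k x) h)
    (hom g).isClosed_ker

theorem mapsTo_closedRange {E' F' : Ban.{u} 𝕜} (f' : E' ⟶ F') (a : E ⟶ E') (b : F ⟶ F')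
    (h : a ≫ f' = f ≫ b) (x : F) (hx : x ∈ closedRange f) : hom b x ∈ closedRange f' := by
  have : closedRange f ≤ (closedRange f').comap (hom b).toLinearMap := by
    refine Submodule.topologicalClosure_minimal _ ?_
      ((Submodule.isClosed_topologicalClosure _).preimage (hom b).continuous)
    rintro _ ⟨y, rfl⟩
    have hy : hom b (hom f y) = hom f' (hom a y) := (congrArg (fun k => hom k y) h).symm
    change hom b (hom f y) ∈ closedRange f'
    rw [hy]
    exact apply_mem_closedRange f' _
  exact this hx

/-- Functoriality of the cokernel. -/
def cokerMap {E' F' : Ban.{u} 𝕜} (f' : E' ⟶ F') (a : E ⟶ E') (b : F ⟶ F')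
    (h : a ≫ f' = f ≫ b) : coker f ⟶ coker f' :=
  ofHom ((closedRange f).liftQL ((closedRange f').mkQL.comp (hom b)) (fun x hx => by
    have := mapsTo_closedRange f f' a b h x hx
    simpa using this))

/-- Functoriality of the image. -/
def imMap {E' F' : Ban.{u} 𝕜} (f' : E' ⟶ F') (a : E ⟶ E') (b : F ⟶ F')
    (h : a ≫ f' = f ≫ b) : im f ⟶ im f' :=
  ofHom (((hom b).comp (closedRange f).subtypeL).codRestrict (closedRange f')
    (fun x => mapsTo_closedRange f f' a b h x x.2))

/-- For composable morphisms `f`, `g` with `f ≫ g = 0`, the morphism `coker f ⟶ im g` induced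
by `g`. -/
def cokerToIm {H : Ban.{u} 𝕜} (g : F ⟶ H) (h : f ≫ g = 0) : coker f ⟶ im g :=
  ofHom ((closedRange f).liftQL
    ((hom g).codRestrict (closedRange g) (apply_mem_closedRange g))
    (fun x hx => by
      have := closedRange_le_ker f g h hx
      exact Subtype.ext this))

@[simp]
theorem cokerMap_id (h : 𝟙 E ≫ f = f ≫ 𝟙 F) : cokerMap f f (𝟙 E) (𝟙 F) h = 𝟙 _ := by
  ext x
  obtain ⟨x, rfl⟩ := Submodule.Quotient.mk_surjective _ x
  rfl

@[simp]
theorem imMap_id (h : 𝟙 E ≫ f = f ≫ 𝟙 F) : imMap f f (𝟙 E) (𝟙 F) h = 𝟙 _ := rfl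

theorem cokerMap_comp {E' F' E'' F'' : Ban.{u} 𝕜} (f' : E' ⟶ F') (f'' : E'' ⟶ F'')
    (a : E ⟶ E') (b : F ⟶ F') (a' : E' ⟶ E'') (b' : F' ⟶ F'') (h : a ≫ f' = f ≫ b)
    (h' : a' ≫ f'' = f' ≫ b') (h'' : (a ≫ a') ≫ f'' = f ≫ b ≫ b') :
    cokerMap f f'' (a ≫ a') (b ≫ b') h'' = cokerMap f f' a b h ≫ cokerMap f' f'' a' b' h' := by
  ext x
  obtain ⟨x, rfl⟩ := Submodule.Quotient.mk_surjective _ x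
  rfl

theorem imMap_comp {E' F' E'' F'' : Ban.{u} 𝕜} (f' : E' ⟶ F') (f'' : E'' ⟶ F'')
    (a : E ⟶ E') (b : F ⟶ F') (a' : E' ⟶ E'') (b' : F' ⟶ F'') (h : a ≫ f' = f ≫ b)
    (h' : a' ≫ f'' = f' ≫ b') (h'' : (a ≫ a') ≫ f'' = f ≫ b ≫ b') :
    imMap f f'' (a ≫ a') (b ≫ b') h'' = imMap f f' a b h ≫ imMap f' f'' a' b' h' := rfl

theorem cokerMap_comp_cokerToIm {H E' F' H' : Ban.{u} 𝕜} (g : F ⟶ H) (w : f ≫ g = 0)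
    (f' : E' ⟶ F') (g' : F' ⟶ H') (w' : f' ≫ g' = 0)
    (a : E ⟶ E') (b : F ⟶ F') (c : H ⟶ H') (h : a ≫ f' = f ≫ b) (h' : b ≫ g' = g ≫ c) :
    cokerMap f f' a b h ≫ cokerToIm f' g' w' = cokerToIm f g w ≫ imMap g g' b c h' := by
  ext x
  obtain ⟨x, rfl⟩ := Submodule.Quotient.mk_surjective _ x
  exact congrArg (fun k => hom k x) h'

theorem epi_of_denseRange (hf : DenseRange (hom f)) : Epi f where
  left_cancellation g h w := by
    ext x
    exact congrFun (hf.equalizer (hom g).continuous (hom h).continuous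
      (funext fun y => congrArg (fun k => hom k y) w)) x

theorem epi_cokerToIm {H : Ban.{u} 𝕜} (g : F ⟶ H) (h : f ≫ g = 0) : Epi (cokerToIm f g h) := by
  apply epi_of_denseRange
  rintro ⟨y, hy⟩
  rw [closure_subtype]
  refine closure_mono ?_ hy
  rintro _ ⟨x, rfl⟩
  exact ⟨⟨hom g x, apply_mem_closedRange g x⟩, ⟨(closedRange f).mkQL x, rfl⟩, rfl⟩

end

theorem epi_double_d {E F : Ban.{u} 𝕜} (f : E ⟶ F) (hf : Epi f) :
    Epi ((HomologicalComplex.double f (show (ComplexShape.up ℤ).Rel 0 1 from rfl)).d 0 1) := by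
  rw [HomologicalComplex.double_d _ _ (by simp)]
  infer_instance

end Ban

/-! ### The derived category of `Ban` and the right heart -/

section Derived

variable (𝕜 : Type) [RCLike 𝕜]

/-- The acyclic complexes of Banach spaces, as a triangulated subcategory of the homotopy category:
the complexes whose underlying complex of vector spaces has vanishing cohomology
(see `Ban.acyclic_iff`). By the open mapping theorem these are the complexes which are exact for
the quasi-abelian structure of `Ban`, i.e. which are spliced from kernel-cokernel pairs. -/
def Ban.acyclic : ObjectProperty (HomotopyCategory (Ban.{u} 𝕜) (ComplexShape.up ℤ)) :=
  ((Ban.toModuleCat.{u} 𝕜).mapHomotopyCategory (ComplexShape.up ℤ) ⋙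
    HomotopyCategory.homologyFunctor (ModuleCat.{u} 𝕜) (ComplexShape.up ℤ) 0).homologicalKernel

instance : (Ban.acyclic.{u} 𝕜).IsTriangulated := by
  dsimp only [Ban.acyclic]; infer_instance

theorem Ban.acyclic_iff (K : CochainComplex (Ban.{u} 𝕜) ℤ) :
    Ban.acyclic 𝕜 ((HomotopyCategory.quotient _ _).obj K) ↔
      ∀ (n : ℤ) (x : K.X n), Ban.hom (K.d n (n + 1)) x = 0 →
        ∃ y : K.X (n - 1), Ban.hom (K.d (n - 1) n) y = x := by
  have h₁ : Ban.acyclic 𝕜 ((HomotopyCategory.quotient _ _).obj K) ↔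
      HomotopyCategory.subcategoryAcyclic (ModuleCat.{u} 𝕜)
        (((Ban.toModuleCat.{u} 𝕜).mapHomotopyCategory (ComplexShape.up ℤ)).obj
          ((HomotopyCategory.quotient _ _).obj K)) := by
    dsimp only [Ban.acyclic, HomotopyCategory.subcategoryAcyclic, Functor.homologicalKernel]
    refine forall_congr' fun n => Iso.isZero_iff ?_
    exact (HomotopyCategory.homologyFunctor (ModuleCat.{u} 𝕜) (ComplexShape.up ℤ) 0).mapIso
      ((((Ban.toModuleCat.{u} 𝕜).mapHomotopyCategory (ComplexShape.up ℤ)).commShiftIso n).app _)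
  rw [h₁]
  refine (HomotopyCategory.quotient_obj_mem_subcategoryAcyclic_iff_exactAt
    (((Ban.toModuleCat.{u} 𝕜).mapHomologicalComplex (ComplexShape.up ℤ)).obj K)).trans ?_
  refine forall_congr' fun n => ?_
  rw [HomologicalComplex.exactAt_iff' _ (n - 1) n (n + 1) (by simp) (by simp),
    ShortComplex.moduleCat_exact_iff]
  rfl

/-- The derived category `D(Ban)`: the Verdier quotient of the homotopy category of (unbounded)
complexes by the acyclic complexes. -/
abbrev DBan : Type (u + 1) := (Ban.acyclic.{u} 𝕜).trW.Localization

/-- The localization functor from complexes to the derived category. -/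
def DBan.Q : CochainComplex (Ban.{u} 𝕜) ℤ ⥤ DBan.{u} 𝕜 :=
  HomotopyCategory.quotient _ _ ⋙ (Ban.acyclic.{u} 𝕜).trW.Q


/-- The objects of `D^{≤ 0}_r`, the essential image of the right truncation functor
`τ_r^{≤ 0} A = (⋯ ⟶ A⁻¹ ⟶ A⁰ ⟶ im d⁰ ⟶ 0 ⟶ ⋯)`. The complexes of this form are those
which vanish in degrees `> 1` and whose differential from degree `0` to degree `1` is an epimorphism
(i.e. has dense range). -/
def DBan.rightLE : ObjectProperty (DBan.{u} 𝕜) := fun X =>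
  ∃ K : CochainComplex (Ban.{u} 𝕜) ℤ,
    (∀ i : ℤ, 1 < i → IsZero (K.X i)) ∧ Epi (K.d 0 1) ∧ Nonempty (X ≅ (DBan.Q 𝕜).obj K)

/-- The objects of `D^{≥ 0}_r`, the essential image of the right truncation functor
`τ_r^{≥ 0} A = (⋯ ⟶ 0 ⟶ coker d⁻¹ ⟶ A¹ ⟶ A² ⟶ ⋯)`. The complexes of this form are those
which vanish in negative degrees. -/
def DBan.rightGE : ObjectProperty (DBan.{u} 𝕜) := fun X =>
  ∃ K : CochainComplex (Ban.{u} 𝕜) ℤ,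
    (∀ i : ℤ, i < 0 → IsZero (K.X i)) ∧ Nonempty (X ≅ (DBan.Q 𝕜).obj K)

/-- The right heart `C_r(Ban) = D^{≤ 0}_r ∩ D^{≥ 0}_r`, a full subcategory of `D(Ban)`. -/
abbrev RightHeart : Type (u + 1) := (DBan.rightLE.{u} 𝕜 ⊓ DBan.rightGE.{u} 𝕜).FullSubcategory

/-- The inclusion functor `ι_r : Ban ⥤ C_r(Ban)`, `E ↦ (E ⟶ 0)`, with `E` in degree `0`. -/
def RightHeart.ι : Ban.{u} 𝕜 ⥤ RightHeart.{u} 𝕜 :=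
  ObjectProperty.lift _ (HomologicalComplex.single (Ban.{u} 𝕜) (ComplexShape.up ℤ) 0 ⋙ DBan.Q 𝕜)
    (fun E =>
      ⟨⟨_, fun i hi => HomologicalComplex.isZero_single_obj_X _ _ _ _ (by lia),
        ⟨fun _ _ _ =>
          (HomologicalComplex.isZero_single_obj_X _ _ _ _ (by lia)).eq_of_src _ _⟩,
        ⟨Iso.refl _⟩⟩,
      ⟨_, fun i hi => HomologicalComplex.isZero_single_obj_X _ _ _ _ (by lia), ⟨Iso.refl _⟩⟩⟩)

variable {𝕜} in
/-- The complex `coker dⁿ⁻¹ ⟶ im dⁿ`, with the cokernel placed in degree `0` and the image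
in degree `1`. Up to the shift, this is `τ_r^{≤ n} τ_r^{≥ n} K`. -/
def Ban.rightCohomologyComplex (n : ℤ) :
    CochainComplex (Ban.{u} 𝕜) ℤ ⥤ CochainComplex (Ban.{u} 𝕜) ℤ where
  obj K := HomologicalComplex.double
    (Ban.cokerToIm (K.d (n - 1) n) (K.d n (n + 1)) (K.d_comp_d _ _ _))
    (show (ComplexShape.up ℤ).Rel 0 1 from rfl)
  map {K L} f := HomologicalComplex.mkHomFromDouble _ (by simp)
    (Ban.cokerMap (K.d (n - 1) n) (L.d (n - 1) n) (f.f (n - 1)) (f.f n) (f.comm _ _) ≫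
      (HomologicalComplex.doubleXIso₀ _ _).inv)
    (Ban.imMap (K.d n (n + 1)) (L.d n (n + 1)) (f.f n) (f.f (n + 1)) (f.comm _ _) ≫
      (HomologicalComplex.doubleXIso₁ _ _ (by simp)).inv)
    (by
      rw [HomologicalComplex.double_d _ _ (by simp)]
      simp only [Category.assoc, Iso.inv_hom_id_assoc]
      rw [← Category.assoc, ← Category.assoc]
      congr 1
      exact Ban.cokerMap_comp_cokerToIm _ _ _ _ _ _ _ _ _ _ _)
    (fun k hk => by
      rw [HomologicalComplex.double_d_eq_zero₀ _ _ _ _ (by simp), comp_zero])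
  map_id K := by
    ext : 1
    · simp [Ban.cokerMap_id]
    · simp [Ban.imMap_id]
  map_comp f g := by
    ext : 1
    · simp [Ban.cokerMap_comp _ _ _ _ _ _ _ (f.comm _ _) (g.comm _ _)]
    · simp [Ban.imMap_comp _ _ _ _ _ _ _ (f.comm _ _) (g.comm _ _)]

/-- The cohomological functor `H^n_r` with values in the right heart, on complexes. -/
def RightHeart.cohomology (n : ℤ) : CochainComplex (Ban.{u} 𝕜) ℤ ⥤ RightHeart.{u} 𝕜 :=
  ObjectProperty.lift _ (Ban.rightCohomologyComplex n ⋙ DBan.Q 𝕜)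
    (fun K =>
      ⟨⟨(Ban.rightCohomologyComplex n).obj K,
        fun i hi => HomologicalComplex.isZero_double_X _ (by simp) _ (by lia) (by lia), by
          exact Ban.epi_double_d _ (Ban.epi_cokerToIm _ _ _),
        ⟨Iso.refl _⟩⟩,
      ⟨(Ban.rightCohomologyComplex n).obj K,
        fun i hi => HomologicalComplex.isZero_double_X _ (by simp) _ (by lia) (by lia),
        ⟨Iso.refl _⟩⟩⟩)

end Derived

/-! ### Banach `G`-modules -/

/-- A Banach `G`-module: an isometric representation of `G` on a Banach space. -/
structure GBan (𝕜 : Type) [RCLike 𝕜] (G : Type u) [Group G] where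
  space : Ban.{u} 𝕜
  ρ : G →* (space ≃ₗᵢ[𝕜] space)

namespace GBan

variable {𝕜 : Type} [RCLike 𝕜] {G : Type u} [Group G]

instance : CoeSort (GBan 𝕜 G) (Type u) := ⟨fun M => M.space⟩

/-- Morphisms of Banach `G`-modules are the `G`-equivariant continuous linear maps. -/
@[ext]
structure Hom (M N : GBan 𝕜 G) where
  hom : M.space ⟶ N.space
  equivariant : ∀ (g : G) (x : M), Ban.hom hom (M.ρ g x) = N.ρ g (Ban.hom hom x)

instance : Category (GBan 𝕜 G) where
  Hom M N := Hom M N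
  id M := ⟨𝟙 _, fun _ _ => rfl⟩
  comp f g := ⟨f.hom ≫ g.hom, fun a x => by simp [f.equivariant, g.equivariant]⟩

/-- The continuous linear map underlying a morphism. -/
abbrev hom {M N : GBan 𝕜 G} (f : M ⟶ N) : M →L[𝕜] N := Ban.hom (Hom.hom f)

@[ext]
theorem hom_ext {M N : GBan 𝕜 G} {f g : M ⟶ N} (h : ∀ x, hom f x = hom g x) : f = g :=
  Hom.ext (Ban.hom_ext h)

@[simp] theorem id_apply {M : GBan 𝕜 G} (x : M) : hom (𝟙 M) x = x := rfl
@[simp] theorem comp_apply {M N P : GBan 𝕜 G} (f : M ⟶ N) (g : N ⟶ P) (x : M) :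
    hom (f ≫ g) x = hom g (hom f x) := rfl

theorem hom_equivariant {M N : GBan 𝕜 G} (f : M ⟶ N) (g : G) (x : M) :
    hom f (M.ρ g x) = N.ρ g (hom f x) := Hom.equivariant f g x

/-- The group of `G`-equivariant continuous linear maps. -/
def equivariantMaps (M N : GBan 𝕜 G) : AddSubgroup (M →L[𝕜] N) where
  carrier := {f | ∀ (g : G) (x : M), f (M.ρ g x) = N.ρ g (f x)}
  add_mem' hf hg a x := by simp [hf a x, hg a x]
  zero_mem' a x := by simp
  neg_mem' hf a x := by simp [hf a x]

/-- Morphisms `M ⟶ N` are the same as equivariant continuous linear maps. -/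
def homEquiv (M N : GBan 𝕜 G) : (M ⟶ N) ≃ equivariantMaps M N where
  toFun f := ⟨hom f, hom_equivariant f⟩
  invFun f := ⟨Ban.ofHom f.1, f.2⟩

instance (M N : GBan 𝕜 G) : AddCommGroup (M ⟶ N) := (homEquiv M N).addCommGroup

@[simp] theorem add_apply {M N : GBan 𝕜 G} (f g : M ⟶ N) (x : M) :
    hom (f + g) x = hom f x + hom g x := rfl

instance : Preadditive (GBan 𝕜 G) where
  add_comp := by intros; ext; simp
  comp_add := by intros; ext; simp

@[simp] theorem zero_apply {M N : GBan 𝕜 G} (x : M) : hom (0 : M ⟶ N) x = 0 := rfl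

/-- The closed linear span of the vectors `m - g m`. -/
abbrev augmentation (M : GBan 𝕜 G) : Submodule 𝕜 M :=
  (Submodule.span 𝕜 {x : M | ∃ (m : M) (g : G), x = m - M.ρ g m}).topologicalClosure

instance (M : GBan 𝕜 G) : IsClosed (augmentation M : Set M) :=
  Submodule.isClosed_topologicalClosure _

theorem hom_mem_augmentation {M N : GBan 𝕜 G} (f : M ⟶ N) (x : M) (hx : x ∈ augmentation M) :
    hom f x ∈ augmentation N := by
  have : augmentation M ≤ (augmentation N).comap (hom f).toLinearMap := by
    refine Submodule.topologicalClosure_minimal _ (Submodule.span_le.2 ?_)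
      ((Submodule.isClosed_topologicalClosure _).preimage (hom f).continuous)
    rintro _ ⟨m, g, rfl⟩
    refine Submodule.le_topologicalClosure _ (Submodule.subset_span ⟨hom f m, g, ?_⟩)
    change hom f (m - M.ρ g m) = _
    rw [map_sub, hom_equivariant]
  exact this hx

variable (𝕜 G) in
/-- The coinvariants functor `M ↦ M_G`. -/
def coinvariants : GBan 𝕜 G ⥤ Ban.{u} 𝕜 where
  obj M := Ban.of 𝕜 (M ⧸ augmentation M)
  map {M N} f := Ban.ofHom ((augmentation M).liftQL ((augmentation N).mkQL.comp (hom f))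
    (fun x hx => by
      have := hom_mem_augmentation f x hx
      simpa using this))
  map_id M := by
    ext x
    obtain ⟨x, rfl⟩ := Submodule.Quotient.mk_surjective _ x
    rfl
  map_comp f g := by
    ext x
    obtain ⟨x, rfl⟩ := Submodule.Quotient.mk_surjective _ x
    rfl

instance : (coinvariants 𝕜 G).Additive where
  map_add {M N f g} := by
    ext x
    obtain ⟨x, rfl⟩ := Submodule.Quotient.mk_surjective _ x
    rfl

/-- The short exact sequences `M' ↣ M ↠ M''` of Banach `G`-modules. By the open mapping theorem
these are the kernel-cokernel pairs of the quasi-abelian category of Banach `G`-modules. -/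
structure ShortExact (S : ShortComplex (GBan 𝕜 G)) : Prop where
  injective : Function.Injective (hom S.f)
  exact : ∀ x : S.X₂, hom S.g x = 0 → ∃ y : S.X₁, hom S.f y = x
  surjective : Function.Surjective (hom S.g)

/-- Projective objects with respect to the quasi-abelian structure, i.e. those having the lifting
property against admissible epics (cokernels), which are the surjective morphisms. -/
def IsProjective (P : GBan 𝕜 G) : Prop :=
  ∀ ⦃M N : GBan 𝕜 G⦄ (p : M ⟶ N), Function.Surjective (hom p) →
    ∀ f : P ⟶ N, ∃ f' : P ⟶ M, f' ≫ p = f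

/-- A projective resolution `⋯ ⟶ P₁ ⟶ P₀ ↠ M`. -/
structure ProjectiveResolution (M : GBan 𝕜 G) where
  P : ChainComplex (GBan 𝕜 G) ℕ
  projective : ∀ n, IsProjective (P.X n)
  ε : P.X 0 ⟶ M
  d_comp_ε : P.d 1 0 ≫ ε = 0
  surjective : Function.Surjective (hom ε)
  exact_zero : ∀ x : P.X 0, hom ε x = 0 → ∃ y : P.X 1, hom (P.d 1 0) y = x
  exact_succ : ∀ (n : ℕ) (x : P.X (n + 1)), hom (P.d (n + 1) n) x = 0 →
    ∃ y : P.X (n + 2), hom (P.d (n + 2) (n + 1)) y = x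

variable (𝕜 G) in
/-- The functor which applies the coinvariants to a chain complex and regards the result
as a cochain complex in nonpositive degrees. On a projective resolution of `M`, its value is
`L⁻(-)_G (M)`. -/
def coinvariantsComplex : ChainComplex (GBan 𝕜 G) ℕ ⥤ CochainComplex (Ban.{u} 𝕜) ℤ :=
  (coinvariants 𝕜 G).mapHomologicalComplex (ComplexShape.down ℕ) ⋙
    ComplexShape.embeddingDownNat.extendFunctor (Ban.{u} 𝕜)

end GBan

/-! ### Homological `δ`-functors -/

/-- A homological `δ`-functor from Banach `G`-modules to the right heart: a family of functors
`H n`, `n ∈ ℤ`, with connecting morphisms for the short exact sequences, natural in the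
sequence, such that the long sequence is exact. -/
structure DeltaFunctor (𝕜 : Type) [RCLike 𝕜] (G : Type u) [Group G] where
  H : ℤ → GBan 𝕜 G ⥤ RightHeart.{u} 𝕜
  δ : ∀ (S : ShortComplex (GBan 𝕜 G)), GBan.ShortExact S → ∀ n : ℤ,
    (H (n + 1)).obj S.X₃ ⟶ (H n).obj S.X₁
  δ_naturality : ∀ {S T : ShortComplex (GBan 𝕜 G)} (hS : GBan.ShortExact S)
    (hT : GBan.ShortExact T) (φ : S ⟶ T) (n : ℤ),
    δ S hS n ≫ (H n).map φ.τ₁ = (H (n + 1)).map φ.τ₃ ≫ δ T hT n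
  exact₁ : ∀ (S : ShortComplex (GBan 𝕜 G)) (hS : GBan.ShortExact S) (n : ℤ),
    ∃ w : δ S hS n ≫ (H n).map S.f = 0, (ShortComplex.mk _ _ w).Exact
  exact₂ : ∀ (S : ShortComplex (GBan 𝕜 G)) (_ : GBan.ShortExact S) (n : ℤ),
    ∃ w : (H n).map S.f ≫ (H n).map S.g = 0, (ShortComplex.mk _ _ w).Exact
  exact₃ : ∀ (S : ShortComplex (GBan 𝕜 G)) (hS : GBan.ShortExact S) (n : ℤ),
    ∃ w : (H (n + 1)).map S.g ≫ δ S hS n = 0, (ShortComplex.mk _ _ w).Exact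

namespace DeltaFunctor

variable {𝕜 : Type} [RCLike 𝕜] {G : Type u} [Group G]

/-- Morphisms of `δ`-functors: natural transformations commuting with the connecting morphisms. -/
@[ext]
structure Hom (T T' : DeltaFunctor 𝕜 G) where
  app : ∀ n : ℤ, T.H n ⟶ T'.H n
  comm : ∀ (S : ShortComplex (GBan 𝕜 G)) (hS : GBan.ShortExact S) (n : ℤ),
    T.δ S hS n ≫ (app n).app S.X₁ = (app (n + 1)).app S.X₃ ≫ T'.δ S hS n

instance : Category (DeltaFunctor 𝕜 G) where
  Hom T T' := Hom T T'
  id T := ⟨fun _ => 𝟙 _, fun _ _ _ => by simp⟩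
  comp f g := ⟨fun n => f.app n ≫ g.app n, fun S hS n => by
    simp only [NatTrans.comp_app, Category.assoc]
    rw [← g.comm, ← Category.assoc, f.comm, Category.assoc]⟩

/-- The component in degree `n` of a morphism of `δ`-functors. -/
abbrev app {T T' : DeltaFunctor 𝕜 G} (f : T ⟶ T') (n : ℤ) : T.H n ⟶ T'.H n := Hom.app f n

/-- A homological `δ`-functor `T` is universal if for every `δ`-functor `T'`, every
natural transformation `T'₀ ⟶ T₀` extends uniquely to a morphism of `δ`-functors. -/
def IsUniversal (T : DeltaFunctor 𝕜 G) : Prop :=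
  ∀ (T' : DeltaFunctor 𝕜 G) (φ : T'.H 0 ⟶ T.H 0), ∃! f : T' ⟶ T, app f 0 = φ

/-- The functors `T.H n` are the `ℓ¹`-homology functors
`M ↦ H^{-n}_r (L⁻(-)_G (M))`: for every projective resolution `P` of `M`, `T.H n` is computed on
`M` by `H^{-n}_r` of the coinvariants of `P`, and it is computed on a morphism `f` by any
lift of `f` to projective resolutions (and projective resolutions exist). -/
def IsL1Homology (T : DeltaFunctor 𝕜 G) : Prop :=
  (∀ M : GBan 𝕜 G, Nonempty (GBan.ProjectiveResolution M)) ∧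
  ∃ θ : ∀ (n : ℤ) (M : GBan 𝕜 G) (R : GBan.ProjectiveResolution M),
      (T.H n).obj M ≅
        (RightHeart.cohomology 𝕜 (-n)).obj ((GBan.coinvariantsComplex 𝕜 G).obj R.P),
    ∀ (n : ℤ) {M M' : GBan 𝕜 G} (f : M ⟶ M') (R : GBan.ProjectiveResolution M)
      (R' : GBan.ProjectiveResolution M') (φ : R.P ⟶ R'.P), φ.f 0 ≫ R'.ε = R.ε ≫ f →
      (T.H n).map f ≫ (θ n M' R').hom =
        (θ n M R).hom ≫
          (RightHeart.cohomology 𝕜 (-n)).map ((GBan.coinvariantsComplex 𝕜 G).map φ)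

end DeltaFunctor

/-- The characterizing properties of `ℓ¹`-homology: a homological `δ`-functor `T` with
`Tₙ = 0` for `n < 0`, together with an identification `T₀(M) = (M_G ⟶ 0)` (natural in `M`),
vanishing on projectives in positive degrees. -/
structure NormalizedDeltaFunctor (𝕜 : Type) [RCLike 𝕜] (G : Type u) [Group G] extends
    DeltaFunctor 𝕜 G where
  isZero_of_neg : ∀ (n : ℤ), n < 0 → ∀ M : GBan 𝕜 G, IsZero ((H n).obj M)
  normalization : H 0 ≅ GBan.coinvariants 𝕜 G ⋙ RightHeart.ι 𝕜
  isZero_of_projective : ∀ (n : ℤ), 0 < n → ∀ P : GBan 𝕜 G, GBan.IsProjective P →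
    IsZero ((H n).obj P)

end

noncomputable section

/-! ### Acyclic complexes and isomorphisms in `D(Ban)` -/

section DerivedBasics

open Pretriangulated

variable {𝕜 : Type} [RCLike 𝕜]

/-! The homological algebra is the classical one, once a few analytic points are settled, most of
them by the open mapping theorem.

The target has to be abelian, so that complexes in it have long exact homology sequences. The heart
of a t-structure is abelian, and the critical axiom is that maps from `D^{≤ 0}_r` to `D^{≥ 1}_r`
vanish (`DBan.Q_hom_eq_zero`). A map in `D(Ban)` is a roof, and the middle complex of the roof can
be replaced by its right truncation, because its cycles in degree 1 are limits of boundaries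
(`Ban.mem_closedRange_of_quasiIso`). After this replacement the chain map is zero.

In the right heart, `RightHeart.ι` turns short exact sequences of Banach spaces into short exact
sequences and dense-range maps into epimorphisms (`RightHeart.dbl_shortExact`). Quotients by closed
ranges therefore become cokernels, and the right cohomology of a complex is the ordinary homology of
its image in the heart (`RightHeart.cohomologyIso`).

There are enough projectives, namely the modules `ℓ¹(G × X)` (`GBan.isProjective_free`). The
coinvariants of a projective resolution of `M` have cokernel `M_G` in degree 0
(`GBan.coinvariants_exact`), which gives the normalization. A short exact sequence has a resolution
by split short exact sequences of projectives. Coinvariants preserve the splittings, so the homology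
sequence in the heart gives the connecting morphisms. They are natural because morphisms of short
exact sequences lift to such resolutions (`GBan.exists_lift_of_splitting`).

Universality is dimension shifting. On the sequence formed by a free cover of `M` and its kernel,
the connecting map of a normalized `T` is a monomorphism in degrees `n ≥ 0`, since `T` vanishes on
the cover in degree `n + 1`. A transformation in degree `n` thus has exactly one compatible
extension to degree `n + 1` (`NormalizedDeltaFunctor.exists_succ`). Uniqueness up to unique
isomorphism follows formally. -/

theorem Ban.acyclic_eq_inverseImage :
    Ban.acyclic.{u} 𝕜 = (HomotopyCategory.subcategoryAcyclic (ModuleCat.{u} 𝕜)).inverseImage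
      ((Ban.toModuleCat.{u} 𝕜).mapHomotopyCategory (ComplexShape.up ℤ)) := by
  ext X
  dsimp only [Ban.acyclic, HomotopyCategory.subcategoryAcyclic, Functor.homologicalKernel]
  refine forall_congr' fun n => Iso.isZero_iff ?_
  exact (HomotopyCategory.homologyFunctor (ModuleCat.{u} 𝕜) (ComplexShape.up ℤ) 0).mapIso
    ((((Ban.toModuleCat.{u} 𝕜).mapHomotopyCategory (ComplexShape.up ℤ)).commShiftIso n).app _)

instance : (Ban.acyclic.{u} 𝕜).IsClosedUnderIsomorphisms := by
  rw [Ban.acyclic_eq_inverseImage]; infer_instance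

theorem Ban.trW_quotient_map_iff {K L : CochainComplex (Ban.{u} 𝕜) ℤ} (φ : K ⟶ L) :
    (Ban.acyclic.{u} 𝕜).trW ((HomotopyCategory.quotient _ _).map φ) ↔
      QuasiIso (((Ban.toModuleCat.{u} 𝕜).mapHomologicalComplex (ComplexShape.up ℤ)).map φ) := by
  rw [Ban.acyclic_eq_inverseImage, ObjectProperty.inverseImage_trW_iff,
    ← HomotopyCategory.quasiIso_eq_trW_subcategoryAcyclic]
  exact HomotopyCategory.quotient_map_mem_quasiIso_iff
    (((Ban.toModuleCat.{u} 𝕜).mapHomologicalComplex (ComplexShape.up ℤ)).map φ)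

instance : (DBan.Q.{u} 𝕜).CommShift ℤ :=
  inferInstanceAs ((HomotopyCategory.quotient (Ban.{u} 𝕜) (ComplexShape.up ℤ) ⋙
    (Ban.acyclic.{u} 𝕜).trW.Q).CommShift ℤ)

instance : (DBan.Q.{u} 𝕜).Additive := by dsimp only [DBan.Q]; infer_instance

theorem DBan.isIso_Q_map {K L : CochainComplex (Ban.{u} 𝕜) ℤ} (φ : K ⟶ L)
    (h : (Ban.acyclic.{u} 𝕜).trW ((HomotopyCategory.quotient _ _).map φ)) :
    IsIso ((DBan.Q 𝕜).map φ) :=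
  Localization.inverts (Ban.acyclic.{u} 𝕜).trW.Q _ _ h

/-- The cone of the zero endomorphism of an acyclic `K` is an extension of `K⟦1⟧` by `K`, hence
acyclic. So the zero endomorphism becomes invertible. -/
theorem DBan.isZero_Q_obj (K : CochainComplex (Ban.{u} 𝕜) ℤ)
    (h : Ban.acyclic 𝕜 ((HomotopyCategory.quotient _ _).obj K)) :
    IsZero ((DBan.Q 𝕜).obj K) := by
  have : (Ban.acyclic.{u} 𝕜).trW ((HomotopyCategory.quotient _ _).map (0 : K ⟶ K)) := by
    refine ⟨_, _, _, HomotopyCategory.mappingCone_triangleh_distinguished (0 : K ⟶ K), ?_⟩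
    exact (Ban.acyclic 𝕜).ext_of_isTriangulatedClosed₂ _
      (rot_of_distTriang _ (HomotopyCategory.mappingCone_triangleh_distinguished (0 : K ⟶ K)))
      h ((Ban.acyclic 𝕜).le_shift (1 : ℤ) _ h)
  have := DBan.isIso_Q_map _ this
  rw [Functor.map_zero] at this
  rw [IsZero.iff_id_eq_zero, ← cancel_epi (0 : (DBan.Q 𝕜).obj K ⟶ (DBan.Q 𝕜).obj K)]
  simp

theorem DBan.exists_distTriang_mappingCone {K L : CochainComplex (Ban.{u} 𝕜) ℤ} (φ : K ⟶ L) :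
    ∃ δ, Triangle.mk ((DBan.Q 𝕜).map φ) ((DBan.Q 𝕜).map (CochainComplex.mappingCone.inr φ)) δ ∈
      distTriang (DBan.{u} 𝕜) :=
  ⟨_, (Ban.acyclic.{u} 𝕜).trW.Q.map_distinguished _
    (HomotopyCategory.mappingCone_triangleh_distinguished φ)⟩

/-- A short complex of complexes of Banach spaces which is a short exact sequence in each degree. -/
structure Ban.DegreewiseExact (S : ShortComplex (CochainComplex (Ban.{u} 𝕜) ℤ)) : Prop where
  injective : ∀ n, Function.Injective (Ban.hom (S.f.f n))
  exact : ∀ n (x : S.X₂.X n), Ban.hom (S.g.f n) x = 0 → ∃ y, Ban.hom (S.f.f n) y = x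
  surjective : ∀ n, Function.Surjective (Ban.hom (S.g.f n))

theorem Ban.DegreewiseExact.shortExact {S : ShortComplex (CochainComplex (Ban.{u} 𝕜) ℤ)}
    (hS : Ban.DegreewiseExact S) :
    (S.map ((Ban.toModuleCat.{u} 𝕜).mapHomologicalComplex (ComplexShape.up ℤ))).ShortExact := by
  refine HomologicalComplex.shortExact_of_degreewise_shortExact _ fun n => ?_
  refine ShortComplex.ShortExact.mk' ?_ ?_ ?_
  · rw [ShortComplex.moduleCat_exact_iff]
    exact hS.exact n
  · exact (ModuleCat.mono_iff_injective _).2 (hS.injective n)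
  · exact (ModuleCat.epi_iff_surjective _).2 (hS.surjective n)

/-- The morphism from the mapping cone of `f` given by a morphism `g` such that `f ≫ g = 0`. -/
def Ban.coneDesc {K L M : CochainComplex (Ban.{u} 𝕜) ℤ} (f : K ⟶ L) (g : L ⟶ M) (w : f ≫ g = 0) :
    CochainComplex.mappingCone f ⟶ M :=
  CochainComplex.mappingCone.desc f 0 g (by simp [w])

theorem Ban.inr_coneDesc {K L M : CochainComplex (Ban.{u} 𝕜) ℤ} (f : K ⟶ L) (g : L ⟶ M)
    (w : f ≫ g = 0) : CochainComplex.mappingCone.inr f ≫ Ban.coneDesc f g w = g := by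
  simp [Ban.coneDesc]

open CochainComplex.mappingCone in
-- Additive functors preserve mapping cones, and this matches the maps out of them. It lets a map
-- out of a cone of Banach complexes be tested on underlying vector spaces.
theorem mapHomologicalComplexXIso_hom_desc_f {C D : Type*} [Category* C] [Category* D]
    [Preadditive C] [Preadditive D] [HasBinaryBiproducts C] [HasBinaryBiproducts D]
    (F : C ⥤ D) [F.Additive] {K L M : CochainComplex C ℤ} (f : K ⟶ L) (g : L ⟶ M) (h h') (n : ℤ) :
    (mapHomologicalComplexXIso f F n).hom ≫
      (desc ((F.mapHomologicalComplex (.up ℤ)).map f) 0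
        ((F.mapHomologicalComplex (.up ℤ)).map g) h).f n =
      F.map ((desc f 0 g h').f n) := by
  rw [desc_f _ _ _ _ n (n + 1) rfl, desc_f _ _ _ _ n (n + 1) rfl,
    CochainComplex.HomComplex.Cochain.zero_v, CochainComplex.HomComplex.Cochain.zero_v,
    comp_zero, comp_zero, zero_add, zero_add, F.map_comp, mapHomologicalComplexXIso,
    mapHomologicalComplexXIso'_hom]
  have key {X Y Z W T : D} (a : X ⟶ Y) (i : Y ⟶ Z) (b : X ⟶ W) (j : W ⟶ Z) (s : Z ⟶ W) (t : W ⟶ T)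
      (h₁ : i ≫ s = 0) (h₂ : j ≫ s = 𝟙 _) : (a ≫ i + b ≫ j) ≫ s ≫ t = b ≫ t := by
    simp [reassoc_of% h₁, reassoc_of% h₂]
  exact key _ _ _ _ _ _ (inl_v_snd_v _ _ _ _) (inr_f_snd_v _ _)

/-- The map from the cone of `S.f` to `S.X₃` is a quasi-isomorphism of complexes of vector spaces,
hence invertible in `D(Ban)`. The cone triangle is transported along it. -/
theorem Ban.DegreewiseExact.exists_distTriang {S : ShortComplex (CochainComplex (Ban.{u} 𝕜) ℤ)}
    (hS : Ban.DegreewiseExact S) :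
    ∃ δ, Triangle.mk ((DBan.Q 𝕜).map S.f) ((DBan.Q 𝕜).map S.g) δ ∈ distTriang (DBan.{u} 𝕜) := by
  have h : IsIso ((DBan.Q 𝕜).map (Ban.coneDesc S.f S.g S.zero)) := by
    apply DBan.isIso_Q_map
    rw [Ban.trW_quotient_map_iff]
    let F := (Ban.toModuleCat.{u} 𝕜).mapHomologicalComplex (ComplexShape.up ℤ)
    have w : F.map S.f ≫ F.map S.g = 0 := by rw [← F.map_comp, S.zero, F.map_zero]
    have h₁ : QuasiIso (CochainComplex.mappingCone.desc (F.map S.f) 0 (F.map S.g) (by simp [w])) :=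
      CochainComplex.mappingCone.quasiIso_descShortComplex
        (S := ShortComplex.mk (F.map S.f) (F.map S.g) w) hS.shortExact
    have h₂ : F.map (Ban.coneDesc S.f S.g S.zero) =
        (CochainComplex.mappingCone.mapHomologicalComplexIso S.f (Ban.toModuleCat.{u} 𝕜)).hom ≫
          CochainComplex.mappingCone.desc (F.map S.f) 0 (F.map S.g) (by simp [w]) := by
      ext1 n
      exact (mapHomologicalComplexXIso_hom_desc_f (Ban.toModuleCat.{u} 𝕜) S.f S.g _ _ n).symm
    change QuasiIso (F.map _)
    rw [h₂]
    infer_instance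
  obtain ⟨δ, hδ⟩ := DBan.exists_distTriang_mappingCone S.f
  let e := asIso ((DBan.Q 𝕜).map (Ban.coneDesc S.f S.g S.zero))
  refine ⟨e.inv ≫ δ, ?_⟩
  refine isomorphic_distinguished _ hδ _ (Iso.symm (Triangle.isoMk _ _ (Iso.refl _) (Iso.refl _)
    e ?_ ?_ ?_))
  · exact (Category.comp_id _).trans (Category.id_comp _).symm
  · exact ((DBan.Q 𝕜).map_comp _ _).symm.trans
      ((congrArg _ (Ban.inr_coneDesc S.f S.g S.zero)).trans (Category.id_comp _).symm)
  · exact ((congrArg _ (CategoryTheory.Functor.map_id _ _)).trans (Category.comp_id _)).trans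
      (e.hom_inv_id_assoc δ).symm

theorem Ban.DegreewiseExact.isIso_Q_map_g {S : ShortComplex (CochainComplex (Ban.{u} 𝕜) ℤ)}
    (hS : Ban.DegreewiseExact S)
    (h : Ban.acyclic 𝕜 ((HomotopyCategory.quotient _ _).obj S.X₁)) :
    IsIso ((DBan.Q 𝕜).map S.g) := by
  obtain ⟨δ, hδ⟩ := hS.exists_distTriang
  exact (Triangle.isZero₁_iff_isIso₂ _ hδ).1 (DBan.isZero_Q_obj _ h)

theorem Ban.DegreewiseExact.isIso_Q_map_f {S : ShortComplex (CochainComplex (Ban.{u} 𝕜) ℤ)}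
    (hS : Ban.DegreewiseExact S)
    (h : Ban.acyclic 𝕜 ((HomotopyCategory.quotient _ _).obj S.X₃)) :
    IsIso ((DBan.Q 𝕜).map S.f) := by
  obtain ⟨δ, hδ⟩ := hS.exists_distTriang
  exact (Triangle.isZero₃_iff_isIso₁ _ hδ).1 (DBan.isZero_Q_obj _ h)

end DerivedBasics

/-! ### Subcomplexes and quotient complexes -/

namespace Ban

variable {𝕜 : Type} [RCLike 𝕜]

section Subcomplex

variable (K : CochainComplex (Ban.{u} 𝕜) ℤ) (V : ∀ i, Submodule 𝕜 (K.X i))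
  [∀ i, IsClosed (V i : Set (K.X i))]
  (hV : ∀ i j, ∀ x ∈ V i, Ban.hom (K.d i j) x ∈ V j)

/-- The complex given by closed subspaces which are stable under the differential. -/
@[simps]
def subcomplex : CochainComplex (Ban.{u} 𝕜) ℤ where
  X i := of 𝕜 (V i)
  d i j := ofHom (((hom (K.d i j)).comp (V i).subtypeL).codRestrict (V j)
    (fun x => hV i j x x.2))
  shape i j h := by
    ext x
    change hom (K.d i j) x = 0
    rw [K.shape i j h]; rfl
  d_comp_d' i j k _ _ := by
    ext x
    exact congrArg (fun f => hom f (x : K.X i)) (K.d_comp_d i j k)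

/-- The quotient by closed subspaces which are stable under the differential. -/
@[simps]
def quotientComplex : CochainComplex (Ban.{u} 𝕜) ℤ where
  X i := of 𝕜 (K.X i ⧸ V i)
  d i j := ofHom ((V i).liftQL ((V j).mkQL.comp (hom (K.d i j)))
    (fun x hx => by simpa using hV i j x hx))
  shape i j h := by
    ext x
    obtain ⟨x, rfl⟩ := Submodule.Quotient.mk_surjective _ x
    change (V j).mkQL (hom (K.d i j) x) = 0
    rw [K.shape i j h]
    exact map_zero _
  d_comp_d' i j k _ _ := by
    ext x
    obtain ⟨x, rfl⟩ := Submodule.Quotient.mk_surjective _ x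
    change (V k).mkQL (hom (K.d i j ≫ K.d j k) x) = 0
    rw [K.d_comp_d i j k]
    exact map_zero _

/-- The inclusion of a subcomplex followed by the projection to the quotient complex. -/
@[simps]
def subquotient : ShortComplex (CochainComplex (Ban.{u} 𝕜) ℤ) where
  X₁ := subcomplex K V hV
  X₂ := K
  X₃ := quotientComplex K V hV
  f := { f := fun i => ofHom (V i).subtypeL }
  g := { f := fun i => ofHom (V i).mkQL }
  zero := by
    ext i x
    exact (Submodule.Quotient.mk_eq_zero _).2 x.2

theorem subquotient_degreewiseExact : DegreewiseExact (subquotient K V hV) where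
  injective _ := Subtype.val_injective
  exact _ x hx := ⟨⟨x, (Submodule.Quotient.mk_eq_zero _).1 hx⟩, rfl⟩
  surjective n := Submodule.Quotient.mk_surjective (V n)

end Subcomplex

end Ban

/-! ### The right truncation -/

namespace Ban

variable {𝕜 : Type} [RCLike 𝕜]

theorem subsingleton_of_isZero {E : Ban.{u} 𝕜} (h : IsZero E) : Subsingleton E :=
  ⟨fun x y => by
    have : 𝟙 E = 0 := h.eq_of_src _ _
    calc x = hom (𝟙 E) x := rfl
      _ = hom (𝟙 E) y := by rw [this]; rfl
      _ = y := rfl⟩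

theorem closedRange_eq_top_of_epi {E F : Ban.{u} 𝕜} (f : E ⟶ F) [Epi f] : closedRange f = ⊤ := by
  have h : (ofHom (closedRange f).mkQL : F ⟶ coker f) = 0 := by
    rw [← cancel_epi f, comp_zero]
    ext x
    exact (Submodule.Quotient.mk_eq_zero _).2 (apply_mem_closedRange f x)
  refine eq_top_iff.2 fun x _ => (Submodule.Quotient.mk_eq_zero _).1 ?_
  exact congrArg (fun g => hom g x) h

theorem closedRange_zero (E F : Ban.{u} 𝕜) : closedRange (0 : E ⟶ F) = ⊥ := by
  have : LinearMap.range (hom (0 : E ⟶ F)).toLinearMap = ⊥ := LinearMap.range_zero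
  rw [closedRange, this]
  exact (isClosed_singleton (x := (0 : F))).submodule_topologicalClosure_eq

theorem exists_of_acyclic {K : CochainComplex (Ban.{u} 𝕜) ℤ}
    (h : Ban.acyclic 𝕜 ((HomotopyCategory.quotient _ _).obj K)) (i j k : ℤ) (hij : i + 1 = j)
    (hjk : j + 1 = k) (x : K.X j) (hx : hom (K.d j k) x = 0) :
    ∃ y : K.X i, hom (K.d i j) y = x := by
  obtain rfl : i = j - 1 := by lia
  subst hjk
  exact (acyclic_iff 𝕜 K).1 h j x hx

/-! ### Cycles and boundaries under quasi-isomorphisms -/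

section QuasiIsomorphism

variable {K L : CochainComplex (Ban.{u} 𝕜) ℤ} {s : K ⟶ L}

theorem acyclic_mappingCone
    (hs : (Ban.acyclic.{u} 𝕜).trW ((HomotopyCategory.quotient _ _).map s)) :
    Ban.acyclic 𝕜 ((HomotopyCategory.quotient _ _).obj (CochainComplex.mappingCone s)) :=
  ((Ban.acyclic 𝕜).trW_iff_of_distinguished _
    (HomotopyCategory.mappingCone_triangleh_distinguished s)).1 hs

open CochainComplex.mappingCone in
-- Injectivity on cohomology, extracted from the acyclic cone: `(x, -y)` is a cycle of the cone, and
-- minus the `K`-component of a primitive of it is the required `x'`.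
theorem exists_eq_d_of_map_eq_d
    (hs : (Ban.acyclic.{u} 𝕜).trW ((HomotopyCategory.quotient _ _).map s))
    (i j k : ℤ) (hij : i + 1 = j) (hjk : j + 1 = k) (x : K.X j) (hx : hom (K.d j k) x = 0)
    (y : L.X i) (hy : hom (s.f j) x = hom (L.d i j) y) :
    ∃ x' : K.X i, hom (K.d i j) x' = x := by
  let w : (CochainComplex.mappingCone s).X i :=
    hom ((inl s).v j i (by lia)) x - hom ((inr s).f i) y
  have hw : hom ((CochainComplex.mappingCone s).d i j) w = 0 := by
    have h₁ := congrArg (fun f => hom f x) (inl_v_d s j i k (by lia) (by lia))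
    have h₂ := congrArg (fun f => hom f y) (inr_f_d s i j)
    have h₃ : hom ((inl s).v j i (by lia) ≫ (CochainComplex.mappingCone s).d i j) x =
        hom (s.f j ≫ (inr s).f j) x - hom (K.d j k ≫ (inl s).v k j (by lia)) x := h₁
    rw [comp_apply, comp_apply, comp_apply, hx, map_zero, sub_zero, hy] at h₃
    have h₄ : hom ((CochainComplex.mappingCone s).d i j) (hom ((inr s).f i) y) =
        hom ((inr s).f j) (hom (L.d i j) y) := h₂
    rw [map_sub, h₃, h₄, sub_self]
  obtain ⟨w', hw'⟩ := exists_of_acyclic (acyclic_mappingCone hs) (i - 1) i j (by lia) hij w hw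
  refine ⟨-hom ((fst s).1.v (i - 1) i (by lia)) w', ?_⟩
  have h₁ := congrArg (fun f => hom f w') (d_fst_v s (i - 1) i j (by lia) (by lia))
  have h₂ : hom ((fst s).1.v i j (by lia)) (hom ((CochainComplex.mappingCone s).d (i - 1) i) w') =
      -hom (K.d i j) (hom ((fst s).1.v (i - 1) i (by lia)) w') := h₁
  have h₃ : hom ((fst s).1.v i j (by lia)) (hom ((inl s).v j i (by lia)) x) = x :=
    congrArg (fun f => hom f x) (inl_v_fst_v s j i (by lia))
  have h₄ : hom ((fst s).1.v i j (by lia)) (hom ((inr s).f i) y) = 0 :=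
    congrArg (fun f => hom f y) (inr_f_fst_v s i j (by lia))
  rw [map_neg, ← h₂, hw', map_sub, h₃, h₄, sub_zero]

open CochainComplex.mappingCone in
-- Surjectivity on cohomology: `(0, z)` is a cycle of the cone, and the two components of a
-- primitive are `x` and `y`.
theorem exists_eq_map_add_d
    (hs : (Ban.acyclic.{u} 𝕜).trW ((HomotopyCategory.quotient _ _).map s))
    (i j k : ℤ) (hij : i + 1 = j) (hjk : j + 1 = k) (z : L.X j) (hz : hom (L.d j k) z = 0) :
    ∃ (x : K.X j) (y : L.X i), hom (K.d j k) x = 0 ∧ hom (s.f j) x + hom (L.d i j) y = z := by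
  have h₁ : hom ((CochainComplex.mappingCone s).d j k) (hom ((inr s).f j) z) = 0 := by
    have h₂ : hom ((CochainComplex.mappingCone s).d j k) (hom ((inr s).f j) z) =
        hom ((inr s).f k) (hom (L.d j k) z) := congrArg (fun f => hom f z) (inr_f_d s j k)
    rw [h₂, hz, map_zero]
  obtain ⟨w, hw⟩ := exists_of_acyclic (acyclic_mappingCone hs) i j k hij hjk _ h₁
  refine ⟨hom ((fst s).1.v i j (by lia)) w, hom ((snd s).v i i (by lia)) w, ?_, ?_⟩
  · have h₂ : hom ((fst s).1.v j k (by lia)) (hom ((CochainComplex.mappingCone s).d i j) w) =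
        -hom (K.d j k) (hom ((fst s).1.v i j (by lia)) w) :=
      congrArg (fun f => hom f w) (d_fst_v s i j k (by lia) (by lia))
    have h₃ : hom ((fst s).1.v j k (by lia)) (hom ((inr s).f j) z) = 0 :=
      congrArg (fun f => hom f z) (inr_f_fst_v s j k (by lia))
    rw [hw, h₃] at h₂
    exact neg_eq_zero.1 h₂.symm
  · have h₂ : hom ((snd s).v j j (by lia)) (hom ((CochainComplex.mappingCone s).d i j) w) =
        hom (s.f j) (hom ((fst s).1.v i j (by lia)) w) +
          hom (L.d i j) (hom ((snd s).v i i (by lia)) w) :=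
      congrArg (fun f => hom f w) (d_snd_v s i j (by lia))
    have h₃ : hom ((snd s).v j j (by lia)) (hom ((inr s).f j) z) = z :=
      congrArg (fun f => hom f z) (inr_f_snd_v s j)
    rw [← h₂, hw, h₃]

/-- If the differential `L.d i j` has dense range, then the cycles of degree `j` of a complex which
is quasi-isomorphic to `L` are limits of boundaries. -/
theorem mem_closedRange_of_quasiIso
    (hs : (Ban.acyclic.{u} 𝕜).trW ((HomotopyCategory.quotient _ _).map s))
    (i j k : ℤ) (hij : i + 1 = j) (hjk : j + 1 = k) [Epi (L.d i j)]
    (x : K.X j) (hx : hom (K.d j k) x = 0) : x ∈ closedRange (K.d i j) := by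
  -- The next differential vanishes on the dense range of `L.d i j`, so it is zero and every element
  -- of `L.X j` is a cycle.
  have hL : ∀ z : L.X j, hom (L.d j k) z = 0 := fun z => by
    have : L.d j k = 0 := by rw [← cancel_epi (L.d i j), L.d_comp_d, comp_zero]
    rw [this]; rfl
  let Z : Submodule 𝕜 (K.X j) := LinearMap.ker (hom (K.d j k)).toLinearMap
  have hZc : IsClosed (Z : Set (K.X j)) := (hom (K.d j k)).isClosed_ker
  have : CompleteSpace Z := hZc.completeSpace_coe
  -- Every element of `L.X j` is the image of a cycle plus a boundary. The open mapping theorem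
  -- makes this decomposition norm-controlled, with constant `C`.
  let Φ : (Z × L.X i) →L[𝕜] L.X j := ((hom (s.f j)).comp Z.subtypeL).coprod (hom (L.d i j))
  have hΦ : Function.Surjective Φ := fun z => by
    obtain ⟨a, b, ha, hab⟩ := exists_eq_map_add_d hs i j k hij hjk z (hL z)
    exact ⟨(⟨a, ha⟩, b), hab⟩
  obtain ⟨C, hC, h⟩ := Φ.exists_preimage_norm_le hΦ
  rw [← SetLike.mem_coe, Submodule.topologicalClosure_coe, Metric.mem_closure_iff]
  intro ε hε
  have hd : hom (s.f j) x ∈ closedRange (L.d i j) := by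
    rw [closedRange_eq_top_of_epi]; trivial
  rw [← SetLike.mem_coe, Submodule.topologicalClosure_coe, Metric.mem_closure_iff] at hd
  -- Decomposing the error `s x - d y`, which has norm below `ε / C`, yields a cycle `a` of norm
  -- below `ε`. The image of `x - a` is a boundary, hence so is `x - a` itself.
  obtain ⟨_, ⟨y, rfl⟩, hy⟩ := hd (ε / C) (by positivity)
  obtain ⟨⟨a, b⟩, hab, hn⟩ := h (hom (s.f j) x - hom (L.d i j) y)
  obtain ⟨x', hx'⟩ := exists_eq_d_of_map_eq_d hs i j k hij hjk (x - a)
    (by rw [map_sub, hx, show hom (K.d j k) a = 0 from a.2, sub_zero]) (y + b) (by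
      have : hom (s.f j) a + hom (L.d i j) b = hom (s.f j) x - hom (L.d i j) y := hab
      rw [map_sub, map_add, ← sub_eq_zero]
      rw [← sub_eq_zero] at this
      rw [← neg_eq_zero, ← this]
      abel)
  refine ⟨x - a, ⟨x', hx'⟩, ?_⟩
  rw [dist_eq_norm, sub_sub_cancel]
  calc ‖(a : K.X j)‖ ≤ ‖((a, b) : Z × L.X i)‖ := norm_fst_le (a, b)
    _ ≤ C * ‖hom (s.f j) x - hom (L.d i j) y‖ := hn
    _ < C * (ε / C) := by
      refine mul_lt_mul_of_pos_left ?_ hC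
      rw [← dist_eq_norm]; exact hy
    _ = ε := mul_div_cancel₀ _ hC.ne'

end QuasiIsomorphism

section Truncation

variable (K : CochainComplex (Ban.{u} 𝕜) ℤ)

/-- The closed subspaces which define the right truncation in degrees `≤ 0`. -/
def truncSubmodule (i : ℤ) : Submodule 𝕜 (K.X i) :=
  if i ≤ 0 then ⊤ else closedRange (K.d 0 i)

theorem truncSubmodule_of_nonpos {i : ℤ} (hi : i ≤ 0) : truncSubmodule K i = ⊤ := if_pos hi

theorem truncSubmodule_of_pos {i : ℤ} (hi : 0 < i) :
    truncSubmodule K i = closedRange (K.d 0 i) := if_neg (by lia)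

theorem truncSubmodule_of_one_lt {i : ℤ} (hi : 1 < i) : truncSubmodule K i = ⊥ := by
  rw [truncSubmodule_of_pos K (by lia),
    K.shape 0 i (by change ¬ (0 + 1 = i); lia), closedRange_zero]

instance (i : ℤ) : IsClosed (truncSubmodule K i : Set (K.X i)) := by
  dsimp only [truncSubmodule]
  split_ifs
  · exact isClosed_univ
  · infer_instance

theorem d_mem_truncSubmodule (i j : ℤ) (x : K.X i) (hx : x ∈ truncSubmodule K i) :
    hom (K.d i j) x ∈ truncSubmodule K j := by
  by_cases hij : i + 1 = j
  · by_cases hj : j ≤ 0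
    · rw [truncSubmodule_of_nonpos K hj]; trivial
    · by_cases hi : i = 0
      · subst hi
        rw [truncSubmodule_of_pos K (by lia)]
        exact apply_mem_closedRange _ _
      · rw [truncSubmodule_of_pos K (by lia)] at hx
        have := closedRange_le_ker (K.d 0 i) (K.d i j) (K.d_comp_d _ _ _) hx
        have h : hom (K.d i j) x = 0 := this
        rw [h]; exact zero_mem _
  · rw [K.shape i j hij]; exact zero_mem _

/-- The right truncation `τ_r^{≤ 0} K ⟶ K ⟶ τ_r^{≥ 1} K`. -/
abbrev trunc : ShortComplex (CochainComplex (Ban.{u} 𝕜) ℤ) :=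
  subquotient K (truncSubmodule K) (d_mem_truncSubmodule K)

theorem isZero_trunc_X₁ (i : ℤ) (hi : 1 < i) : IsZero ((trunc K).X₁.X i) := by
  have : Subsingleton (truncSubmodule K i) := by
    rw [truncSubmodule_of_one_lt K hi]; infer_instance
  exact isZero_of_subsingleton (of 𝕜 (truncSubmodule K i))

theorem isZero_trunc_X₃ (i : ℤ) (hi : i ≤ 0) : IsZero ((trunc K).X₃.X i) := by
  have : Subsingleton (K.X i ⧸ truncSubmodule K i) := by
    rw [truncSubmodule_of_nonpos K hi]; infer_instance
  exact isZero_of_subsingleton (of 𝕜 (K.X i ⧸ truncSubmodule K i))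

theorem epi_trunc_X₁_d : Epi ((trunc K).X₁.d 0 1) := by
  apply epi_of_denseRange
  rintro ⟨y, hy⟩
  refine closure_subtype.2 ?_
  rw [truncSubmodule_of_pos K (by lia)] at hy
  refine closure_mono ?_ hy
  rintro _ ⟨x, rfl⟩
  have hx : x ∈ truncSubmodule K 0 := by rw [truncSubmodule_of_nonpos K le_rfl]; trivial
  exact ⟨⟨hom (K.d 0 1) x, d_mem_truncSubmodule K 0 1 x hx⟩, ⟨⟨x, hx⟩, rfl⟩, rfl⟩

/-- In degree 1 the quotient is taken by the closure of the boundaries, so approximation suffices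
there. In higher degrees nothing is divided out, and honest exactness is needed. -/
theorem acyclic_trunc_X₃
    (h₁ : ∀ x : K.X 1, hom (K.d 1 2) x = 0 → x ∈ closedRange (K.d 0 1))
    (h₂ : ∀ (i : ℤ), 1 < i → ∀ x : K.X i, hom (K.d i (i + 1)) x = 0 →
      ∃ y : K.X (i - 1), hom (K.d (i - 1) i) y = x) :
    Ban.acyclic 𝕜 ((HomotopyCategory.quotient _ _).obj (trunc K).X₃) := by
  rw [acyclic_iff]
  intro n x hx
  by_cases hn : n ≤ 0
  · have := subsingleton_of_isZero (isZero_trunc_X₃ K n hn)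
    exact ⟨0, Subsingleton.elim _ _⟩
  obtain ⟨x, rfl⟩ := Submodule.Quotient.mk_surjective _ x
  -- Since `n + 1 > 1`, the subspace divided out in degree `n + 1` is zero, so a cycle of the
  -- quotient is represented by a cycle of `K`.
  have hx' : hom (K.d n (n + 1)) x = 0 := by
    have : hom (K.d n (n + 1)) x ∈ truncSubmodule K (n + 1) :=
      (Submodule.Quotient.mk_eq_zero _).1 hx
    rw [truncSubmodule_of_one_lt K (by lia)] at this
    exact (Submodule.mem_bot 𝕜).1 this
  by_cases hn' : n = 1
  · subst hn'
    refine ⟨0, (map_zero _).trans ?_⟩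
    refine ((Submodule.Quotient.mk_eq_zero _).2 ?_).symm
    rw [truncSubmodule_of_pos K (by lia)]
    exact h₁ x hx'
  · obtain ⟨y, rfl⟩ := h₂ n (by lia) x hx'
    exact ⟨Submodule.Quotient.mk y, rfl⟩

end Truncation

end Ban

/-! ### The right t-structure on `D(Ban)` -/

section TStructure

open Pretriangulated

variable {𝕜 : Type} [RCLike 𝕜]

/-- The complex `K` need not have the shape of `L`, but the quasi-isomorphism makes the part of `K`
removed by truncation acyclic. This is what allows the middle of a roof to be truncated. -/
theorem DBan.isIso_Q_map_trunc_f {K L : CochainComplex (Ban.{u} 𝕜) ℤ} (s : K ⟶ L)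
    (hs : (Ban.acyclic.{u} 𝕜).trW ((HomotopyCategory.quotient _ _).map s))
    (h : ∀ i : ℤ, 1 < i → IsZero (L.X i)) [Epi (L.d 0 1)] :
    IsIso ((DBan.Q 𝕜).map (Ban.trunc K).f) := by
  apply (Ban.subquotient_degreewiseExact K _ (Ban.d_mem_truncSubmodule K)).isIso_Q_map_f
  refine Ban.acyclic_trunc_X₃ K (Ban.mem_closedRange_of_quasiIso hs 0 1 2 (by lia) (by lia)) ?_
  intro i hi x hx
  have := Ban.subsingleton_of_isZero (h i hi)
  exact Ban.exists_eq_d_of_map_eq_d hs (i - 1) i (i + 1) (by lia) rfl x hx 0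
    (Subsingleton.elim _ _)

/-- After writing `f` as a roof and truncating its middle term, the two complexes can both be
nonzero only in degree 1. There the incoming differential of the truncation has dense range, and
following it by the chain map factors through `L.X 0 = 0`. -/
theorem DBan.Q_hom_eq_zero {K L : CochainComplex (Ban.{u} 𝕜) ℤ}
    (hK : ∀ i : ℤ, 1 < i → IsZero (K.X i)) [Epi (K.d 0 1)]
    (hL : ∀ i : ℤ, i < 1 → IsZero (L.X i)) (f : (DBan.Q 𝕜).obj K ⟶ (DBan.Q 𝕜).obj L) : f = 0 := by
  obtain ⟨φ, hφ⟩ := Localization.exists_rightFraction (Ban.acyclic.{u} 𝕜).trW.Q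
    (Ban.acyclic.{u} 𝕜).trW
    (X := (HomotopyCategory.quotient _ _).obj K) (Y := (HomotopyCategory.quotient _ _).obj L) f
  obtain ⟨s, hs, g⟩ := φ
  rename_i X
  obtain ⟨K', rfl⟩ := HomotopyCategory.quotient_obj_surjective X
  obtain ⟨s, rfl⟩ := (HomotopyCategory.quotient _ _).map_surjective s
  obtain ⟨g, rfl⟩ := (HomotopyCategory.quotient _ _).map_surjective g
  have h₁ := DBan.isIso_Q_map_trunc_f s hs hK
  have h₂ : (Ban.trunc K').f ≫ g = 0 := by
    ext1 i
    by_cases hi : i < 1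
    · exact (hL i hi).eq_of_tgt _ _
    by_cases hi' : 1 < i
    · exact (Ban.isZero_trunc_X₁ K' i hi').eq_of_src _ _
    obtain rfl : i = 1 := by lia
    have := Ban.epi_trunc_X₁_d K'
    rw [← cancel_epi ((Ban.trunc K').X₁.d 0 1), HomologicalComplex.zero_f, comp_zero,
      ← HomologicalComplex.Hom.comm]
    exact (congrArg (· ≫ _) ((hL 0 (by lia)).eq_of_tgt _ 0)).trans zero_comp
  have h₃ : (DBan.Q 𝕜).map g = 0 := by
    let i : (Ban.trunc K').X₁ ⟶ K' := (Ban.trunc K').f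
    have : IsIso ((DBan.Q 𝕜).map i) := h₁
    have h₄ : i ≫ g = 0 := h₂
    rw [← cancel_epi ((DBan.Q 𝕜).map i), ← Functor.map_comp, h₄, Functor.map_zero, comp_zero]
  rw [hφ]
  dsimp only [MorphismProperty.RightFraction.map]
  exact (congrArg (_ ≫ ·) h₃).trans comp_zero

instance : (DBan.rightLE.{u} 𝕜).IsClosedUnderIsomorphisms where
  of_iso e := by
    rintro ⟨K, h₁, h₂, ⟨e'⟩⟩
    exact ⟨K, h₁, h₂, ⟨e.symm ≪≫ e'⟩⟩

instance : (DBan.rightGE.{u} 𝕜).IsClosedUnderIsomorphisms where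
  of_iso e := by
    rintro ⟨K, h₁, ⟨e'⟩⟩
    exact ⟨K, h₁, ⟨e.symm ≪≫ e'⟩⟩

theorem distTriang_of_iso₂ {C : Type*} [Category* C] [Preadditive C] [HasZeroObject C]
    [HasShift C ℤ] [∀ n : ℤ, (shiftFunctor C n).Additive] [Pretriangulated C] {X Y Y' Z : C}
    (f : X ⟶ Y) (g : Y ⟶ Z) (δ : Z ⟶ X⟦(1 : ℤ)⟧) (h : Triangle.mk f g δ ∈ distTriang C)
    (e : Y ≅ Y') : Triangle.mk (f ≫ e.hom) (e.inv ≫ g) δ ∈ distTriang C :=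
  isomorphic_distinguished _ h _
    (Triangle.isoMk _ _ (Iso.refl _) e.symm (Iso.refl _)
      (by change (f ≫ e.hom) ≫ e.inv = 𝟙 X ≫ f; simp)
      (by change (e.inv ≫ g) ≫ 𝟙 Z = e.inv ≫ g; simp)
      (by change δ ≫ (𝟙 X)⟦(1 : ℤ)⟧' = 𝟙 Z ≫ δ; simp))

/-- The object `(DBan.Q 𝕜).obj K⟦n⟧` is represented by the shifted complex. -/
def DBan.shiftIso (K : CochainComplex (Ban.{u} 𝕜) ℤ) (n : ℤ) :
    ((DBan.Q 𝕜).obj K)⟦n⟧ ≅ (DBan.Q 𝕜).obj (K⟦n⟧) :=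
  (((DBan.Q 𝕜).commShiftIso n).app K).symm

variable (𝕜) in
/-- The right `t`-structure on `D(Ban)`. -/
def DBan.rightTStructure : Triangulated.TStructure (DBan.{u} 𝕜) where
  le n X := DBan.rightLE 𝕜 (X⟦n⟧)
  ge n X := DBan.rightGE 𝕜 (X⟦n⟧)
  le_isClosedUnderIsomorphisms n :=
    ⟨fun e h => (DBan.rightLE 𝕜).prop_of_iso ((shiftFunctor _ n).mapIso e) h⟩
  ge_isClosedUnderIsomorphisms n :=
    ⟨fun e h => (DBan.rightGE 𝕜).prop_of_iso ((shiftFunctor _ n).mapIso e) h⟩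
  le_shift n a n' h X hX :=
    (DBan.rightLE 𝕜).prop_of_iso ((shiftFunctorAdd' (DBan.{u} 𝕜) a n' n h).app X) hX
  ge_shift n a n' h X hX :=
    (DBan.rightGE 𝕜).prop_of_iso ((shiftFunctorAdd' (DBan.{u} 𝕜) a n' n h).app X) hX
  zero' := by
    rintro X Y f ⟨K, hK, hK', ⟨eK⟩⟩ ⟨L, hL, ⟨eL⟩⟩
    let eX : X ≅ (DBan.Q 𝕜).obj K := ((shiftFunctorZero (DBan.{u} 𝕜) ℤ).app X).symm ≪≫ eK
    let eY : Y ≅ (DBan.Q 𝕜).obj (L⟦(-1 : ℤ)⟧) :=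
      (shiftShiftNeg Y (1 : ℤ)).symm ≪≫ (shiftFunctor _ (-1 : ℤ)).mapIso eL ≪≫
        DBan.shiftIso L (-1)
    -- The complex `L` represents `Y⟦1⟧`, so `Y` itself is represented by `L⟦-1⟧`, which vanishes in
    -- degrees below 1.
    have h := DBan.Q_hom_eq_zero hK (fun i hi => hL (i + -1) (by lia)) (eX.inv ≫ f ≫ eY.hom)
    rw [← cancel_epi eX.inv, ← cancel_mono eY.hom, Category.assoc, h, comp_zero, zero_comp]
  le_zero_le := by
    rintro X ⟨K, hK, hK', ⟨eK⟩⟩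
    refine ⟨K⟦(1 : ℤ)⟧, fun i hi => hK (i + 1) (by lia), ?_, ⟨?_⟩⟩
    -- The shifted differential lands in `K.X 2 = 0`.
    · exact ⟨fun _ _ _ => (hK (1 + 1) (by lia)).eq_of_src _ _⟩
    · exact (shiftFunctor _ (1 : ℤ)).mapIso (((shiftFunctorZero (DBan.{u} 𝕜) ℤ).app X).symm ≪≫
        eK) ≪≫ DBan.shiftIso K 1
  ge_one_le := by
    rintro Y ⟨L, hL, ⟨eL⟩⟩
    refine ⟨L⟦(-1 : ℤ)⟧, fun i hi => hL (i + -1) (by lia), ⟨?_⟩⟩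
    exact (shiftFunctorZero (DBan.{u} 𝕜) ℤ).app Y ≪≫ (shiftShiftNeg Y (1 : ℤ)).symm ≪≫
      (shiftFunctor _ (-1 : ℤ)).mapIso eL ≪≫ DBan.shiftIso L (-1)
  exists_triangle_zero_one A := by
    obtain ⟨K, ⟨e⟩⟩ : ∃ K, Nonempty ((DBan.Q 𝕜).obj K ≅ A) := by
      let e := (Localization.essSurj (Ban.acyclic.{u} 𝕜).trW.Q
        (Ban.acyclic.{u} 𝕜).trW).mem_essImage A
      obtain ⟨X, ⟨e⟩⟩ := e
      obtain ⟨K, rfl⟩ := HomotopyCategory.quotient_obj_surjective X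
      exact ⟨K, ⟨e⟩⟩
    -- The truncation triangle comes from a degreewise short exact sequence of complexes, because
    -- the closures of ranges are closed subspaces with Banach quotients.
    obtain ⟨δ, hδ⟩ := (Ban.subquotient_degreewiseExact K _
      (Ban.d_mem_truncSubmodule K)).exists_distTriang
    refine ⟨(DBan.Q 𝕜).obj (Ban.trunc K).X₁, (DBan.Q 𝕜).obj (Ban.trunc K).X₃,
      ⟨(Ban.trunc K).X₁, Ban.isZero_trunc_X₁ K, Ban.epi_trunc_X₁_d K,
        ⟨(shiftFunctorZero (DBan.{u} 𝕜) ℤ).app _⟩⟩,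
      ⟨(Ban.trunc K).X₃⟦(1 : ℤ)⟧, fun i hi => Ban.isZero_trunc_X₃ K (i + 1) (by lia),
        ⟨DBan.shiftIso _ 1⟩⟩,
      (DBan.Q 𝕜).map (Ban.trunc K).f ≫ e.hom, e.inv ≫ (DBan.Q 𝕜).map (Ban.trunc K).g, δ, ?_⟩
    exact distTriang_of_iso₂ _ _ _ hδ e

theorem DBan.rightTStructure_heart :
    (DBan.rightTStructure.{u} 𝕜).heart = DBan.rightLE.{u} 𝕜 ⊓ DBan.rightGE.{u} 𝕜 := by
  ext X
  exact and_congr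
    ((DBan.rightLE 𝕜).prop_iff_of_iso ((shiftFunctorZero (DBan.{u} 𝕜) ℤ).app X))
    ((DBan.rightGE 𝕜).prop_iff_of_iso ((shiftFunctorZero (DBan.{u} 𝕜) ℤ).app X))

end TStructure

/-! ### The right heart is abelian -/

section Heart

open Pretriangulated Triangulated

theorem isLE_shift_of_le {C : Type*} [Category* C] [Preadditive C] [HasZeroObject C]
    [HasShift C ℤ] [∀ n : ℤ, (shiftFunctor C n).Additive] [Pretriangulated C] (t : TStructure C)
    {X : C} {n : ℤ} (h : t.IsLE X n) (a m : ℤ) (hm : n ≤ a + m) : t.IsLE (X⟦a⟧) m := by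
  have := t.isLE_shift X n a (n - a)
  exact t.isLE_of_le _ (n - a) m

theorem isGE_shift_of_ge {C : Type*} [Category* C] [Preadditive C] [HasZeroObject C]
    [HasShift C ℤ] [∀ n : ℤ, (shiftFunctor C n).Additive] [Pretriangulated C] (t : TStructure C)
    {X : C} {n : ℤ} (h : t.IsGE X n) (a m : ℤ) (hm : a + m ≤ n) : t.IsGE (X⟦a⟧) m := by
  have := t.isGE_shift X n a (n - a)
  exact t.isGE_of_ge _ m (n - a)

variable {𝕜 : Type} [RCLike 𝕜]

variable (𝕜) in
/-- The property of the objects of `D(Ban)` which defines the right heart. -/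
abbrev DBan.heart : ObjectProperty (DBan.{u} 𝕜) := DBan.rightLE.{u} 𝕜 ⊓ DBan.rightGE.{u} 𝕜

variable (𝕜) in
/-- The inclusion of the right heart in `D(Ban)`. -/
abbrev RightHeart.incl : RightHeart.{u} 𝕜 ⥤ DBan.{u} 𝕜 := (DBan.heart 𝕜).ι

theorem DBan.heart_iff (X : DBan.{u} 𝕜) : DBan.heart 𝕜 X ↔
    (DBan.rightTStructure.{u} 𝕜).IsLE X 0 ∧ (DBan.rightTStructure.{u} 𝕜).IsGE X 0 := by
  rw [← TStructure.mem_heart_iff, DBan.rightTStructure_heart]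

theorem DBan.heart_of_distTriang {T : Triangle (DBan.{u} 𝕜)} (hT : T ∈ distTriang (DBan.{u} 𝕜))
    (h₁ : DBan.heart 𝕜 T.obj₁) (h₃ : DBan.heart 𝕜 T.obj₃) : DBan.heart 𝕜 T.obj₂ := by
  rw [DBan.heart_iff] at h₁ h₃ ⊢
  exact ⟨TStructure.isLE₂ _ T hT _ h₁.1 h₃.1, TStructure.isGE₂ _ T hT _ h₁.2 h₃.2⟩

instance : (DBan.heart.{u} 𝕜).ContainsZero where
  exists_zero := by
    obtain ⟨Z, hZ⟩ := HasZeroObject.zero (C := DBan.{u} 𝕜)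
    exact ⟨Z, hZ, (DBan.heart_iff Z).2
      ⟨TStructure.isLE_of_isZero _ hZ 0, TStructure.isGE_of_isZero _ hZ 0⟩⟩

/-- A binary product is the middle term of a distinguished triangle on its factors, and the heart is
closed under extensions. -/
instance : (DBan.heart.{u} 𝕜).IsClosedUnderBinaryProducts where
  limitsOfShape_le := by
    rintro X ⟨p⟩
    let e : X ≅ (p.diag.obj ⟨.left⟩) ⨯ (p.diag.obj ⟨.right⟩) :=
      (p.isLimit.conePointsIsoOfNatIso (limit.isLimit _) (diagramIsoPair p.diag))
    refine (DBan.heart 𝕜).prop_of_iso e.symm ?_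
    exact DBan.heart_of_distTriang (binaryProductTriangle_distinguished _ _)
      (p.prop_diag_obj _) (p.prop_diag_obj _)

instance : HasTerminal (RightHeart.{u} 𝕜) :=
  hasLimitsOfShape_of_closedUnderLimits _ (DBan.heart.{u} 𝕜)

instance : HasFiniteProducts (RightHeart.{u} 𝕜) :=
  hasFiniteProducts_of_has_binary_and_terminal

theorem RightHeart.incl_shift_hom_eq_zero ⦃X Y : RightHeart.{u} 𝕜⦄ ⦃n : ℤ⦄
    (f : (RightHeart.incl 𝕜).obj X ⟶ ((RightHeart.incl 𝕜).obj Y)⟦n⟧) (hn : n < 0) : f = 0 := by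
  have hX := ((DBan.heart_iff _).1 X.property).1
  have hY := ((DBan.heart_iff _).1 Y.property).2
  exact (DBan.rightTStructure 𝕜).zero_of_isLE_of_isGE f 0 (-n) (by lia) hX
    (isGE_shift_of_ge _ hY n (-n) (by lia))

/-- The cone of a morphism in the heart lies in degrees `-1` and `0`. Its truncation triangle
displays it as an extension of `Q'` by `K'⟦1⟧` with `K'` and `Q'` in the heart; these are the kernel
and cokernel of the morphism. -/
theorem RightHeart.admissibleMorphism_eq_top :
    AbelianSubcategory.admissibleMorphism (RightHeart.incl.{u} 𝕜) = ⊤ := by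
  ext X₁ X₂ f
  simp only [MorphismProperty.top_apply, iff_true]
  intro X₃ f₂ f₃ hT
  let t := DBan.rightTStructure.{u} 𝕜
  obtain ⟨hX₁, hX₁'⟩ := (DBan.heart_iff _).1 X₁.property
  obtain ⟨hX₂, hX₂'⟩ := (DBan.heart_iff _).1 X₂.property
  have hr := rot_of_distTriang _ hT
  have h₁ : t.IsLE X₃ 0 := t.isLE₂ _ hr 0 hX₂
    (isLE_shift_of_le t hX₁ 1 0 (by lia))
  have h₂ : t.IsGE X₃ (-1) := t.isGE₂ _ hr (-1)
    (@TStructure.isGE_of_ge _ _ _ _ _ _ _ t _ (-1) 0 (by lia) hX₂')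
    (isGE_shift_of_ge t hX₁' 1 (-1) (by lia))
  obtain ⟨K, Q, hK, hQ, α, β, γ, h⟩ := t.exists_triangle X₃ (-1) 0 (by lia)
  replace hK : t.IsLE K (-1) := ⟨hK⟩
  replace hQ : t.IsGE Q 0 := ⟨hQ⟩
  have hQ' : t.IsLE Q 0 := t.isLE₂ _ (rot_of_distTriang _ h) 0 h₁
    (isLE_shift_of_le t hK 1 0 (by lia))
  have hK' : t.IsGE K (-1) := t.isGE₂ _ (inv_rot_of_distTriang _ h) (-1)
    (isGE_shift_of_ge t hQ (-1) (-1) (by lia)) h₂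
  let K' : RightHeart 𝕜 := ⟨K⟦(-1 : ℤ)⟧, (DBan.heart_iff _).2
    ⟨t.isLE_shift _ (-1) (-1) 0, t.isGE_shift _ (-1) (-1) 0⟩⟩
  let Q' : RightHeart 𝕜 := ⟨Q, (DBan.heart_iff _).2 ⟨hQ', hQ⟩⟩
  let e : K'.obj⟦(1 : ℤ)⟧ ≅ K := shiftNegShift K (1 : ℤ)
  exact ⟨K', Q', e.hom ≫ α, β, γ ≫ e.inv⟦(1 : ℤ)⟧', isomorphic_distinguished _ h _
    (Triangle.isoMk _ _ e (Iso.refl _) (Iso.refl _)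
      ((Category.comp_id _).trans rfl)
      ((Category.comp_id _).trans (Category.id_comp _).symm) (by
        change (γ ≫ e.inv⟦(1 : ℤ)⟧') ≫ e.hom⟦(1 : ℤ)⟧' = 𝟙 Q ≫ γ
        rw [Category.assoc, ← Functor.map_comp, e.inv_hom_id, CategoryTheory.Functor.map_id,
          Category.comp_id, Category.id_comp]))⟩

instance RightHeart.abelian : Abelian (RightHeart.{u} 𝕜) :=
  AbelianSubcategory.abelian (RightHeart.incl 𝕜) RightHeart.incl_shift_hom_eq_zero
    RightHeart.admissibleMorphism_eq_top

/-- As negative extensions vanish in the heart, the triangle makes `S.f` a kernel of `S.g` and `S.g`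
a cokernel of `S.f`. Exactness statements in the heart are all derived from triangles in this way.
-/
theorem RightHeart.shortExact_of_distTriang {S : ShortComplex (RightHeart.{u} 𝕜)}
    (δ : (RightHeart.incl 𝕜).obj S.X₃ ⟶ ((RightHeart.incl 𝕜).obj S.X₁)⟦(1 : ℤ)⟧)
    (h : Triangle.mk ((RightHeart.incl 𝕜).map S.f) ((RightHeart.incl 𝕜).map S.g) δ ∈
      distTriang (DBan.{u} 𝕜)) : S.ShortExact := by
  have hK := AbelianSubcategory.isLimitKernelForkOfDistTriang
    RightHeart.incl_shift_hom_eq_zero S.f S.g δ h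
  have hC := AbelianSubcategory.isColimitCokernelCoforkOfDistTriang
    RightHeart.incl_shift_hom_eq_zero S.f S.g δ h
  have : Mono S.f := mono_of_isLimit_fork hK
  have : Epi S.g := epi_of_isColimit_cofork hC
  exact ⟨S.exact_of_f_is_kernel hK⟩

end Heart

/-! ### Exactness properties of the inclusion `Ban ⥤ C_r(Ban)` -/

namespace Ban

variable {𝕜 : Type} [RCLike 𝕜]

@[simp] theorem hom_inv_apply {E F : Ban.{u} 𝕜} (e : E ≅ F) (x : E) :
    hom e.inv (hom e.hom x) = x := congrArg (fun f => hom f x) e.hom_inv_id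

@[simp] theorem inv_hom_apply {E F : Ban.{u} 𝕜} (e : E ≅ F) (x : F) :
    hom e.hom (hom e.inv x) = x := congrArg (fun f => hom f x) e.inv_hom_id

/-- The composable morphisms `f` and `g` are part of an algebraic short exact sequence. -/
structure IsShortExact {E F H : Ban.{u} 𝕜} (f : E ⟶ F) (g : F ⟶ H) : Prop where
  injective : Function.Injective (hom f)
  exact : ∀ x, hom g x = 0 → ∃ y, hom f y = x
  surjective : Function.Surjective (hom g)

theorem IsShortExact.of_iso {E F H E' F' H' : Ban.{u} 𝕜} {f : E ⟶ F} {g : F ⟶ H} {f' : E' ⟶ F'}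
    {g' : F' ⟶ H'} (h : IsShortExact f' g') (e₁ : E ≅ E') (e₂ : F ≅ F') (e₃ : H ≅ H')
    (hf : f ≫ e₂.hom = e₁.hom ≫ f') (hg : g ≫ e₃.hom = e₂.hom ≫ g') : IsShortExact f g := by
  have hf' x : hom e₂.hom (hom f x) = hom f' (hom e₁.hom x) := congrArg (fun k => hom k x) hf
  have hg' x : hom e₃.hom (hom g x) = hom g' (hom e₂.hom x) := congrArg (fun k => hom k x) hg
  refine ⟨fun x y hxy => ?_, fun x hx => ?_, fun z => ?_⟩
  · have := h.injective ((hf' x).symm.trans ((congrArg _ hxy).trans (hf' y)))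
    simpa using congrArg (hom e₁.inv) this
  · obtain ⟨y, hy⟩ := h.exact (hom e₂.hom x) (by rw [← hg', hx, map_zero])
    refine ⟨hom e₁.inv y, ?_⟩
    have := hf' (hom e₁.inv y)
    rw [inv_hom_apply, hy] at this
    simpa using congrArg (hom e₂.inv) this
  · obtain ⟨y, hy⟩ := h.surjective (hom e₃.hom z)
    refine ⟨hom e₂.inv y, ?_⟩
    have := hg' (hom e₂.inv y)
    rw [inv_hom_apply, hy] at this
    simpa using congrArg (hom e₃.inv) this

theorem IsShortExact.of_isZero {E F H : Ban.{u} 𝕜} (f : E ⟶ F) (g : F ⟶ H) (hE : IsZero E)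
    (hF : IsZero F) (hH : IsZero H) : IsShortExact f g := by
  have := subsingleton_of_isZero hE
  have := subsingleton_of_isZero hF
  have := subsingleton_of_isZero hH
  exact ⟨fun _ _ _ => Subsingleton.elim _ _, fun _ _ => ⟨0, Subsingleton.elim _ _⟩,
    fun _ => ⟨0, Subsingleton.elim _ _⟩⟩

theorem IsShortExact.of_isIso_of_isZero {E F H : Ban.{u} 𝕜} (f : E ⟶ F) (g : F ⟶ H) [IsIso f]
    (hH : IsZero H) : IsShortExact f g := by
  have := subsingleton_of_isZero hH
  refine ⟨fun x y hxy => ?_, fun x _ => ⟨hom (inv f) x, ?_⟩, fun _ => ⟨0, Subsingleton.elim _ _⟩⟩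
  · exact (hom_inv_apply (asIso f) x).symm.trans
      ((congrArg (hom (asIso f).inv) hxy).trans (hom_inv_apply (asIso f) y))
  · exact inv_hom_apply (asIso f) x

theorem DegreewiseExact.mk' {S : ShortComplex (CochainComplex (Ban.{u} 𝕜) ℤ)}
    (h : ∀ n, IsShortExact (S.f.f n) (S.g.f n)) : DegreewiseExact S :=
  ⟨fun n => (h n).injective, fun n => (h n).exact, fun n => (h n).surjective⟩

/-- A Banach space as a complex concentrated in degree `0`. -/
abbrev single₀ (𝕜 : Type) [RCLike 𝕜] : Ban.{u} 𝕜 ⥤ CochainComplex (Ban.{u} 𝕜) ℤ :=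
  HomologicalComplex.single (Ban.{u} 𝕜) (ComplexShape.up ℤ) 0

theorem isZero_single₀_X (E : Ban.{u} 𝕜) {n : ℤ} (hn : n ≠ 0) : IsZero (((single₀ 𝕜).obj E).X n) :=
  HomologicalComplex.isZero_single_obj_X _ _ _ _ hn

/-- The identification of the component of degree `0`. -/
abbrev single₀X (E : Ban.{u} 𝕜) : ((single₀ 𝕜).obj E).X 0 ≅ E :=
  HomologicalComplex.singleObjXSelf (ComplexShape.up ℤ) 0 E

/-- The short complex of complexes concentrated in degree `0`. -/
abbrev singleShortComplex {E F H : Ban.{u} 𝕜} (f : E ⟶ F) (g : F ⟶ H) (w : f ≫ g = 0) :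
    ShortComplex (CochainComplex (Ban.{u} 𝕜) ℤ) :=
  ShortComplex.mk ((single₀ 𝕜).map f) ((single₀ 𝕜).map g)
    (by rw [← Functor.map_comp, w, Functor.map_zero])

theorem IsShortExact.degreewiseExact_single {E F H : Ban.{u} 𝕜} {f : E ⟶ F} {g : F ⟶ H}
    (h : IsShortExact f g) (w : f ≫ g = 0) : DegreewiseExact (singleShortComplex f g w) := by
  refine DegreewiseExact.mk' fun n => ?_
  by_cases hn : n = 0
  · subst hn
    refine h.of_iso (single₀X E) (single₀X F) (single₀X H) ?_ ?_
    · dsimp only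
      rw [HomologicalComplex.single_map_f_self, Category.assoc, Category.assoc, Iso.inv_hom_id,
        Category.comp_id]
    · dsimp only
      rw [HomologicalComplex.single_map_f_self, Category.assoc, Category.assoc, Iso.inv_hom_id,
        Category.comp_id]
  · exact IsShortExact.of_isZero _ _ (isZero_single₀_X _ hn) (isZero_single₀_X _ hn)
      (isZero_single₀_X _ hn)

section Double

variable {E F : Ban.{u} 𝕜} (f : E ⟶ F)

/-- The complex `E ⟶ F` with `E` in degree `0`. -/
abbrev dbl : CochainComplex (Ban.{u} 𝕜) ℤ :=
  HomologicalComplex.double f (show (ComplexShape.up ℤ).Rel 0 1 from rfl)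

/-- The identification of the component of degree `0`. -/
abbrev dblX₀ : (dbl f).X 0 ≅ E := HomologicalComplex.doubleXIso₀ _ _

/-- The identification of the component of degree `1`. -/
abbrev dblX₁ : (dbl f).X 1 ≅ F := HomologicalComplex.doubleXIso₁ _ _ (by simp)

theorem isZero_dbl_X {n : ℤ} (h₀ : n ≠ 0) (h₁ : n ≠ 1) : IsZero ((dbl f).X n) :=
  HomologicalComplex.isZero_double_X _ _ _ h₀ h₁

theorem dbl_d : (dbl f).d 0 1 = (dblX₀ f).hom ≫ f ≫ (dblX₁ f).inv :=
  HomologicalComplex.double_d _ _ (by simp)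

/-- The morphism to a complex concentrated in degree `0`. -/
def dblToSingle {H : Ban.{u} 𝕜} (φ : E ⟶ H) : dbl f ⟶ (single₀ 𝕜).obj H :=
  HomologicalComplex.mkHomToSingle ((dblX₀ f).hom ≫ φ) (fun i hi => by
    rw [HomologicalComplex.double_d_eq_zero₁ _ _ _ _ (by simp), zero_comp])

theorem dblToSingle_f {H : Ban.{u} 𝕜} (φ : E ⟶ H) :
    (dblToSingle f φ).f 0 = (dblX₀ f).hom ≫ φ ≫ (single₀X H).inv := by
  rw [dblToSingle, HomologicalComplex.mkHomToSingle_f, Category.assoc]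

theorem dbl_to_single_hom_ext {H : Ban.{u} 𝕜} {φ ψ : dbl f ⟶ (single₀ 𝕜).obj H}
    (h : φ.f 0 = ψ.f 0) : φ = ψ :=
  HomologicalComplex.to_single_hom_ext h

variable {f} in
/-- The morphism of complexes given by a commutative square. -/
def dblMap {E' F' : Ban.{u} 𝕜} {f' : E' ⟶ F'} (a : E ⟶ E') (b : F ⟶ F') (h : a ≫ f' = f ≫ b) :
    dbl f ⟶ dbl f' :=
  HomologicalComplex.mkHomFromDouble _ (by simp) (a ≫ (dblX₀ f').inv) (b ≫ (dblX₁ f').inv)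
    (by
      rw [dbl_d, Category.assoc, Iso.inv_hom_id_assoc, reassoc_of% h])
    (fun k hk => by rw [HomologicalComplex.double_d_eq_zero₀ _ _ _ _ (by simp), comp_zero])

variable {E' F' : Ban.{u} 𝕜} {f' : E' ⟶ F'} (a : E ⟶ E') (b : F ⟶ F') (h : a ≫ f' = f ≫ b)

theorem dblMap_f₀ : (dblMap a b h).f 0 = (dblX₀ f).hom ≫ a ≫ (dblX₀ f').inv :=
  HomologicalComplex.mkHomFromDouble_f₀ _ _ _ _ _ _

theorem dblMap_f₁ : (dblMap a b h).f 1 = (dblX₁ f).hom ≫ b ≫ (dblX₁ f').inv :=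
  HomologicalComplex.mkHomFromDouble_f₁ _ _ _ _ _ _

theorem dblMap_comp_dblToSingle {H : Ban.{u} 𝕜} (φ : E' ⟶ H) :
    dblMap a b h ≫ dblToSingle f' φ = dblToSingle f (a ≫ φ) := by
  apply dbl_to_single_hom_ext
  rw [HomologicalComplex.comp_f, dblMap_f₀, dblToSingle_f, dblToSingle_f]
  simp

theorem dblToSingle_comp_single {H H' : Ban.{u} 𝕜} (φ : E ⟶ H) (ψ : H ⟶ H') :
    dblToSingle f φ ≫ (single₀ 𝕜).map ψ = dblToSingle f (φ ≫ ψ) := by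
  apply dbl_to_single_hom_ext
  rw [HomologicalComplex.comp_f, dblToSingle_f, dblToSingle_f,
    HomologicalComplex.single_map_f_self]
  simp

theorem dblToSingle_zero (H : Ban.{u} 𝕜) : dblToSingle f (0 : E ⟶ H) = 0 := by
  apply dbl_to_single_hom_ext
  rw [dblToSingle_f, zero_comp, comp_zero]
  rfl

/-- The isomorphism `b` cancels degree 1, so the quotient of the two-term complexes is concentrated
in degree 0. -/
theorem degreewiseExact_dbl {H : Ban.{u} 𝕜} (φ : E' ⟶ H) [IsIso b] (h' : IsShortExact a φ)
    (w : dblMap a b h ≫ dblToSingle f' φ = 0) :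
    DegreewiseExact (ShortComplex.mk (dblMap a b h) (dblToSingle f' φ) w) := by
  refine DegreewiseExact.mk' fun n => ?_
  by_cases h₀ : n = 0
  · subst h₀
    refine h'.of_iso (dblX₀ f) (dblX₀ f') (single₀X H) ?_ ?_
    · dsimp only
      rw [dblMap_f₀, Category.assoc, Category.assoc, Iso.inv_hom_id, Category.comp_id]
    · dsimp only
      rw [dblToSingle_f, Category.assoc, Category.assoc, Iso.inv_hom_id, Category.comp_id]
  · by_cases h₁ : n = 1
    · subst h₁
      have : IsIso ((dblMap a b h).f 1) := by rw [dblMap_f₁]; infer_instance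
      exact IsShortExact.of_isIso_of_isZero _ _ (isZero_single₀_X _ h₀)
    · exact IsShortExact.of_isZero _ _ (isZero_dbl_X _ h₀ h₁) (isZero_dbl_X _ h₀ h₁)
        (isZero_single₀_X _ h₀)

theorem acyclic_dbl_id (F : Ban.{u} 𝕜) :
    Ban.acyclic 𝕜 ((HomotopyCategory.quotient _ _).obj (dbl (𝟙 F))) := by
  rw [acyclic_iff]
  intro n x hx
  by_cases h₀ : n = 0
  · subst h₀
    refine ⟨0, (map_zero _).trans ?_⟩
    have : hom ((dbl (𝟙 F)).d 0 1) x = 0 := hx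
    rw [dbl_d, Category.id_comp] at this
    simpa using congrArg (fun y => hom (dblX₀ (𝟙 F)).inv (hom (dblX₁ (𝟙 F)).hom y)) this.symm
  · by_cases h₁ : n = 1
    · subst h₁
      refine ⟨hom (dblX₀ (𝟙 F)).inv (hom (dblX₁ (𝟙 F)).hom x), ?_⟩
      change hom ((dbl (𝟙 F)).d 0 1) _ = x
      rw [dbl_d, Category.id_comp]
      simp
    · have := subsingleton_of_isZero (isZero_dbl_X (𝟙 F) h₀ h₁)
      exact ⟨0, Subsingleton.elim _ _⟩

end Double

end Ban

/-! ### The two-term complex as a homotopy fiber -/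

section

open Pretriangulated

variable {𝕜 : Type} [RCLike 𝕜]

/-- For a morphism `f : E ⟶ F`, the complex `E ⟶ F` is the homotopy fiber of `f`. -/
theorem DBan.exists_distTriang_dbl {E F : Ban.{u} 𝕜} (f : E ⟶ F) :
    ∃ δ, Triangle.mk ((DBan.Q 𝕜).map (Ban.dblToSingle f (𝟙 E)))
      ((DBan.Q 𝕜).map ((Ban.single₀ 𝕜).map f)) δ ∈ distTriang (DBan.{u} 𝕜) := by
  -- A mapping cylinder argument. The complex `q : E × F ⟶ F` is equivalent to `E` in degree 0, and
  -- the graph of `f` embeds `E ⟶ F` into it with quotient `F` in degree 0.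
  let B : Ban.{u} 𝕜 := Ban.of 𝕜 (E × F)
  let inl : E ⟶ B := Ban.ofHom (ContinuousLinearMap.inl 𝕜 E F)
  let inr : F ⟶ B := Ban.ofHom (ContinuousLinearMap.inr 𝕜 E F)
  let p : B ⟶ E := Ban.ofHom (ContinuousLinearMap.fst 𝕜 E F)
  let q : B ⟶ F := Ban.ofHom (ContinuousLinearMap.snd 𝕜 E F)
  let g : E ⟶ B := Ban.ofHom ((ContinuousLinearMap.id 𝕜 E).prod (Ban.hom f))
  -- The graph of `f` is the kernel of `(x, y) ↦ f x - y`, which is surjective even when `f` is not.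
  have h₁ : Ban.IsShortExact g (p ≫ f - q) := by
    refine ⟨fun x y hxy => congrArg Prod.fst hxy, fun x hx => ⟨x.1, Prod.ext rfl ?_⟩,
      fun z => ⟨(0, -z), ?_⟩⟩
    · exact sub_eq_zero.1 hx
    · change Ban.hom f 0 - (-z) = z
      simp
  have h₂ : Ban.IsShortExact inr p :=
    ⟨fun x y hxy => congrArg Prod.snd hxy, fun x hx => ⟨x.2, Prod.ext (Eq.symm hx) rfl⟩,
      fun z => ⟨(z, 0), rfl⟩⟩
  have hg : g ≫ q = f ≫ 𝟙 F := rfl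
  have hgp : g ≫ p = 𝟙 E := rfl
  have hinl : inl ≫ q = 0 := rfl
  have hinlp : inl ≫ p = 𝟙 E := rfl
  have hr : inr ≫ q = 𝟙 F ≫ 𝟙 F := rfl
  have hrp : inr ≫ p = 0 := rfl
  have hgf : g ≫ (p ≫ f - q) = 0 := by
    rw [Preadditive.comp_sub, reassoc_of% hgp, hg, Category.comp_id, sub_self]
  have w₁ : Ban.dblMap g (𝟙 F) hg ≫ Ban.dblToSingle q (p ≫ f - q) = 0 := by
    rw [Ban.dblMap_comp_dblToSingle, hgf, Ban.dblToSingle_zero]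
  have w₂ : Ban.dblMap inr (𝟙 F) hr ≫ Ban.dblToSingle q p = 0 := by
    rw [Ban.dblMap_comp_dblToSingle, hrp, Ban.dblToSingle_zero]
  -- The kernel of this projection is the contractible complex `F = F`.
  have hq : IsIso ((DBan.Q 𝕜).map (Ban.dblToSingle q p)) :=
    (Ban.degreewiseExact_dbl _ _ _ _ _ h₂ w₂).isIso_Q_map_g (Ban.acyclic_dbl_id F)
  -- The first inclusion is a section of the projection, so it represents its inverse in `D(Ban)`.
  -- Composed with the quotient map it gives `f`, which identifies the second arrow of the triangle.
  let s : (Ban.single₀ 𝕜).obj E ⟶ Ban.dbl q :=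
    HomologicalComplex.mkHomFromSingle (inl ≫ (Ban.dblX₀ q).inv) (fun k hk => by
      obtain rfl : 0 + 1 = k := hk
      change (inl ≫ (Ban.dblX₀ q).inv) ≫ (Ban.dbl q).d 0 1 = 0
      rw [Ban.dbl_d, Category.assoc, Iso.inv_hom_id_assoc, reassoc_of% hinl, zero_comp])
  have hs : s ≫ Ban.dblToSingle q p = 𝟙 _ := by
    apply HomologicalComplex.to_single_hom_ext
    rw [HomologicalComplex.comp_f, HomologicalComplex.mkHomFromSingle_f, Ban.dblToSingle_f]
    simp [reassoc_of% hinlp]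
  have hsf : s ≫ Ban.dblToSingle q (p ≫ f - q) = (Ban.single₀ 𝕜).map f := by
    apply HomologicalComplex.to_single_hom_ext
    rw [HomologicalComplex.comp_f, HomologicalComplex.mkHomFromSingle_f, Ban.dblToSingle_f,
      HomologicalComplex.single_map_f_self]
    simp only [Category.assoc, Iso.inv_hom_id_assoc, Preadditive.sub_comp, Preadditive.comp_sub,
      reassoc_of% hinlp, reassoc_of% hinl, zero_comp, comp_zero, sub_zero]
  obtain ⟨δ, hδ⟩ := (Ban.degreewiseExact_dbl _ _ _ _ _ h₁ w₁).exists_distTriang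
  let e := asIso ((DBan.Q 𝕜).map (Ban.dblToSingle q p))
  have he : e.inv = (DBan.Q 𝕜).map s := by
    rw [← cancel_mono e.hom, e.inv_hom_id]
    exact ((DBan.Q 𝕜).map_id _).symm.trans ((congrArg _ hs.symm).trans ((DBan.Q 𝕜).map_comp _ _))
  refine ⟨δ, ?_⟩
  have h₃ := distTriang_of_iso₂ _ _ _ hδ e
  have h₄ : (DBan.Q 𝕜).map (Ban.dblMap g (𝟙 F) hg) ≫ e.hom =
      (DBan.Q 𝕜).map (Ban.dblToSingle f (𝟙 E)) := by
    refine ((DBan.Q 𝕜).map_comp _ _).symm.trans (congrArg _ ?_)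
    rw [Ban.dblMap_comp_dblToSingle, hgp]
  have h₅ : e.inv ≫ (DBan.Q 𝕜).map (Ban.dblToSingle q (p ≫ f - q)) =
      (DBan.Q 𝕜).map ((Ban.single₀ 𝕜).map f) := by
    rw [he]
    exact ((DBan.Q 𝕜).map_comp _ _).symm.trans (congrArg _ hsf)
  dsimp only at h₃
  rw [h₄, h₅] at h₃
  exact h₃

end

/-- A presentation of the homology of a complex in degree `n`: a cokernel `C` of the incoming
differential, a factorization of the outgoing differential through `C` and a subobject `I`,
and the kernel `H` of `C ⟶ I`. -/
structure HomologyPresentation {A : Type*} [Category* A] [Preadditive A]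
    (L : CochainComplex A ℤ) (n : ℤ) where
  H : A
  C : A
  I : A
  π : L.X n ⟶ C
  r : C ⟶ I
  i : I ⟶ L.X (n + 1)
  k : H ⟶ C
  mono_i : Mono i
  fac : π ≫ r ≫ i = L.d n (n + 1)
  d_comp_π : L.d (n - 1) n ≫ π = 0
  k_comp_r : k ≫ r = 0
  isColimit : IsColimit (CokernelCofork.ofπ π d_comp_π)
  isLimit : IsLimit (KernelFork.ofι k k_comp_r)

/-! ### Homology from a cokernel and a factorization through its image -/

namespace HomologyPresentation

variable {A : Type*} [Category* A] [Abelian A] {L L' : CochainComplex A ℤ} {n : ℤ}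
  (p : HomologyPresentation L n) (p' : HomologyPresentation L' n)

/-- The identification of the cokernel of the incoming differential. -/
def opcyclesIso : L.opcycles n ≅ p.C :=
  (L.opcyclesIsCokernel (n - 1) n (by simp)).coconePointUniqueUpToIso p.isColimit

theorem pOpcycles_opcyclesIso : L.pOpcycles n ≫ p.opcyclesIso.hom = p.π :=
  IsColimit.comp_coconePointUniqueUpToIso_hom
    (L.opcyclesIsCokernel (n - 1) n (by simp)) p.isColimit WalkingParallelPair.one

theorem opcyclesIso_hom_comp : p.opcyclesIso.hom ≫ p.r ≫ p.i = L.fromOpcycles n (n + 1) := by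
  rw [← cancel_epi (L.pOpcycles n), HomologicalComplex.p_fromOpcycles, ← Category.assoc,
    pOpcycles_opcyclesIso, p.fac]

theorem exists_hom : ∃ f : p.H ⟶ L.homology n, f ≫ L.homologyι n = p.k ≫ p.opcyclesIso.inv := by
  obtain ⟨f, hf⟩ := KernelFork.IsLimit.lift' (L.homologyIsKernel n (n + 1) (by simp))
    (p.k ≫ p.opcyclesIso.inv) (by
      rw [← p.opcyclesIso_hom_comp, Category.assoc, Iso.inv_hom_id_assoc, ← Category.assoc,
        p.k_comp_r, zero_comp])
  exact ⟨f, hf⟩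

/-- Homology is the kernel of the map from opcycles to the next term. As `p.i` is a monomorphism,
this kernel is already killed by `p.r`. -/
theorem exists_inv : ∃ f : L.homology n ⟶ p.H, f ≫ p.k = L.homologyι n ≫ p.opcyclesIso.hom := by
  obtain ⟨f, hf⟩ := KernelFork.IsLimit.lift' p.isLimit (L.homologyι n ≫ p.opcyclesIso.hom) (by
      have := p.mono_i
      rw [← cancel_mono p.i, zero_comp, Category.assoc, Category.assoc, opcyclesIso_hom_comp,
        HomologicalComplex.homologyι_comp_fromOpcycles])
  exact ⟨f, hf⟩

/-- The homology in degree `n` is isomorphic to `p.H`. -/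
def iso : p.H ≅ L.homology n where
  hom := p.exists_hom.choose
  inv := p.exists_inv.choose
  hom_inv_id := by
    have : Mono p.k := mono_of_isLimit_fork p.isLimit
    rw [← cancel_mono p.k, Category.assoc, p.exists_inv.choose_spec, ← Category.assoc,
      p.exists_hom.choose_spec, Category.assoc, Iso.inv_hom_id, Category.comp_id, Category.id_comp]
  inv_hom_id := by
    rw [← cancel_mono (L.homologyι n), Category.assoc, p.exists_hom.choose_spec, ← Category.assoc,
      p.exists_inv.choose_spec, Category.assoc, Iso.hom_inv_id, Category.comp_id, Category.id_comp]

theorem iso_hom_homologyι : p.iso.hom ≫ L.homologyι n = p.k ≫ p.opcyclesIso.inv :=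
  p.exists_hom.choose_spec

variable (φ : L ⟶ L') (a : p.H ⟶ p'.H) (c : p.C ⟶ p'.C)

theorem iso_naturality (hc : φ.f n ≫ p'.π = p.π ≫ c) (ha : a ≫ p'.k = p.k ≫ c) :
    a ≫ p'.iso.hom = p.iso.hom ≫ HomologicalComplex.homologyMap φ n := by
  have h : p.opcyclesIso.hom ≫ c =
      HomologicalComplex.opcyclesMap φ n ≫ p'.opcyclesIso.hom := by
    rw [← cancel_epi (L.pOpcycles n), HomologicalComplex.p_opcyclesMap_assoc,
      pOpcycles_opcyclesIso, ← Category.assoc, pOpcycles_opcyclesIso, hc]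
  rw [← cancel_mono (L'.homologyι n), Category.assoc, iso_hom_homologyι, Category.assoc,
    HomologicalComplex.homologyι_naturality, ← Category.assoc, ha, ← Category.assoc,
    iso_hom_homologyι, Category.assoc, Category.assoc]
  congr 1
  rw [Iso.comp_inv_eq, Category.assoc, ← h, Iso.inv_hom_id_assoc]

end HomologyPresentation

/-! ### Right cohomology as homology in the heart -/

namespace RightHeart

open Pretriangulated

variable {𝕜 : Type} [RCLike 𝕜]

instance : (RightHeart.ι.{u} 𝕜).Additive where
  map_add {E F f g} := by
    apply (RightHeart.incl 𝕜).map_injective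
    exact (congrArg (DBan.Q 𝕜).map ((Ban.single₀ 𝕜).map_add (f := f) (g := g))).trans
      ((DBan.Q 𝕜).map_add (f := (Ban.single₀ 𝕜).map f) (g := (Ban.single₀ 𝕜).map g))

theorem ι_shortExact {E F H : Ban.{u} 𝕜} {f : E ⟶ F} {g : F ⟶ H} (h : Ban.IsShortExact f g)
    (w : f ≫ g = 0) : ((ShortComplex.mk f g w).map (RightHeart.ι 𝕜)).ShortExact := by
  obtain ⟨δ, hδ⟩ := (h.degreewiseExact_single w).exists_distTriang
  exact shortExact_of_distTriang (S := (ShortComplex.mk f g w).map (RightHeart.ι 𝕜)) δ hδ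

section Double

variable {E F : Ban.{u} 𝕜} (f : E ⟶ F)

/-- The object `E ⟶ F` of the right heart attached to an epimorphism in `Ban`. -/
def dbl [Epi f] : RightHeart.{u} 𝕜 :=
  ⟨(DBan.Q 𝕜).obj (Ban.dbl f),
    ⟨_, fun _ _ => Ban.isZero_dbl_X f (by lia) (by lia), Ban.epi_double_d f inferInstance,
      ⟨Iso.refl _⟩⟩,
    ⟨_, fun _ _ => Ban.isZero_dbl_X f (by lia) (by lia), ⟨Iso.refl _⟩⟩⟩

/-- The canonical monomorphism `(E ⟶ F) ⟶ (E ⟶ 0)`. -/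
def dblι [Epi f] : dbl f ⟶ (RightHeart.ι 𝕜).obj E :=
  ObjectProperty.homMk ((DBan.Q 𝕜).map (Ban.dblToSingle f (𝟙 E)))

theorem dblι_comp [Epi f] : dblι f ≫ (RightHeart.ι 𝕜).map f = 0 := by
  obtain ⟨δ, hδ⟩ := DBan.exists_distTriang_dbl f
  apply (RightHeart.incl 𝕜).map_injective
  exact comp_distTriang_mor_zero₁₂ _ hδ

/-- An epimorphism of Banach spaces only has dense range. In the right heart it nevertheless becomes
an epimorphism, with the two-term complex as its kernel. -/
theorem dbl_shortExact [Epi f] :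
    (ShortComplex.mk (dblι f) ((RightHeart.ι 𝕜).map f) (dblι_comp f)).ShortExact := by
  obtain ⟨δ, hδ⟩ := DBan.exists_distTriang_dbl f
  exact shortExact_of_distTriang
    (S := ShortComplex.mk (dblι f) ((RightHeart.ι 𝕜).map f) (dblι_comp f)) δ hδ

instance [Epi f] : Epi ((RightHeart.ι 𝕜).map f) := (dbl_shortExact f).epi_g

end Double

section Cokernel

variable {E F : Ban.{u} 𝕜} (f : E ⟶ F)

/-- The projection to the cokernel. -/
def _root_.Ban.cokerπ : F ⟶ Ban.coker f := Ban.ofHom (Ban.closedRange f).mkQL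

/-- The inclusion of the image. -/
def _root_.Ban.imι : Ban.im f ⟶ F := Ban.ofHom (Ban.closedRange f).subtypeL

/-- The projection to the image. -/
def _root_.Ban.toIm : E ⟶ Ban.im f :=
  Ban.ofHom ((Ban.hom f).codRestrict (Ban.closedRange f) (Ban.apply_mem_closedRange f))

theorem _root_.Ban.isShortExact_im_coker : Ban.IsShortExact (Ban.imι f) (Ban.cokerπ f) :=
  ⟨Subtype.val_injective, fun x hx => ⟨⟨x, (Submodule.Quotient.mk_eq_zero _).1 hx⟩, rfl⟩,
    Submodule.Quotient.mk_surjective _⟩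

theorem _root_.Ban.imι_cokerπ : Ban.imι f ≫ Ban.cokerπ f = 0 := by
  ext x
  exact (Submodule.Quotient.mk_eq_zero _).2 x.2

theorem _root_.Ban.toIm_imι : Ban.toIm f ≫ Ban.imι f = f := rfl

theorem _root_.Ban.comp_cokerπ : f ≫ Ban.cokerπ f = 0 := by
  exact (congrArg (Ban.toIm f ≫ ·) (Ban.imι_cokerπ f)).trans comp_zero

instance _root_.Ban.epi_toIm : Epi (Ban.toIm f) := by
  apply Ban.epi_of_denseRange
  rintro ⟨y, hy⟩
  refine closure_subtype.2 (closure_mono ?_ hy)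
  rintro _ ⟨x, rfl⟩
  exact ⟨⟨Ban.hom f x, Ban.apply_mem_closedRange f x⟩, ⟨x, rfl⟩, rfl⟩

instance mono_ι_map_imι : Mono ((RightHeart.ι 𝕜).map (Ban.imι f)) :=
  (ι_shortExact (Ban.isShortExact_im_coker f) (Ban.imι_cokerπ f)).mono_f

instance : Epi ((RightHeart.ι 𝕜).map (Ban.cokerπ f)) :=
  (ι_shortExact (Ban.isShortExact_im_coker f) (Ban.imι_cokerπ f)).epi_g

variable {f} in
-- The map `f` is a dense-range map into its closed range followed by the inclusion. The first
-- factor becomes an epimorphism in the heart and the second is a kernel of `g`, so exactness up to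
-- closure suffices.
theorem ι_exact {H : Ban.{u} 𝕜} {g : F ⟶ H} (w : f ≫ g = 0) (hg : Function.Surjective (Ban.hom g))
    (h : ∀ x, Ban.hom g x = 0 → x ∈ Ban.closedRange f) :
    ((ShortComplex.mk f g w).map (RightHeart.ι 𝕜)).Exact := by
  have w' : Ban.imι f ≫ g = 0 := by
    ext x
    exact Ban.closedRange_le_ker f g w x.2
  have hs : Ban.IsShortExact (Ban.imι f) g :=
    ⟨Subtype.val_injective, fun x hx => ⟨⟨x, h x hx⟩, rfl⟩, hg⟩
  let φ : (ShortComplex.mk f g w).map (RightHeart.ι 𝕜) ⟶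
      (ShortComplex.mk (Ban.imι f) g w').map (RightHeart.ι 𝕜) :=
    { τ₁ := (RightHeart.ι 𝕜).map (Ban.toIm f)
      τ₂ := 𝟙 _
      τ₃ := 𝟙 _
      comm₁₂ := by
        refine ((RightHeart.ι 𝕜).map_comp _ _).symm.trans ?_
        rw [Ban.toIm_imι]
        exact (Category.comp_id _).symm
      comm₂₃ := (Category.id_comp _).trans (Category.comp_id _).symm }
  have h₁ : Epi φ.τ₁ := inferInstanceAs (Epi ((RightHeart.ι 𝕜).map (Ban.toIm f)))
  have h₂ : IsIso φ.τ₂ := inferInstanceAs (IsIso (𝟙 _))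
  have h₃ : Mono φ.τ₃ := inferInstanceAs (Mono (𝟙 _))
  exact (ShortComplex.exact_iff_of_epi_of_isIso_of_mono φ).2 (ι_shortExact hs w').exact

theorem ι_coker_exact :
    ((ShortComplex.mk f (Ban.cokerπ f) (Ban.comp_cokerπ f)).map (RightHeart.ι 𝕜)).Exact :=
  ι_exact (Ban.comp_cokerπ f) (Submodule.Quotient.mk_surjective _)
    fun _ hx => (Submodule.Quotient.mk_eq_zero _).1 hx

end Cokernel

section Cohomology

variable (K : CochainComplex (Ban.{u} 𝕜) ℤ) (n : ℤ)

/-- The morphism `coker d ⟶ im d` whose kernel is the right cohomology. -/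
abbrev cokerToIm : Ban.coker (K.d (n - 1) n) ⟶ Ban.im (K.d n (n + 1)) :=
  Ban.cokerToIm (K.d (n - 1) n) (K.d n (n + 1)) (K.d_comp_d _ _ _)

instance : Epi (cokerToIm K n) := Ban.epi_cokerToIm _ _ _

/-- The monomorphism from the right cohomology to the cokernel of the differential. -/
def cohomologyι :
    (RightHeart.cohomology 𝕜 n).obj K ⟶ (RightHeart.ι 𝕜).obj (Ban.coker (K.d (n - 1) n)) :=
  dblι (cokerToIm K n)

theorem cohomologyι_comp : cohomologyι K n ≫ (RightHeart.ι 𝕜).map (cokerToIm K n) = 0 :=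
  dblι_comp _

/-- The map from the cokernel to the image has dense range, so the two-term complex defining the
right cohomology is its kernel in the heart. -/
theorem cohomology_shortExact : (ShortComplex.mk (cohomologyι K n)
    ((RightHeart.ι 𝕜).map (cokerToIm K n)) (cohomologyι_comp K n)).ShortExact :=
  dbl_shortExact (cokerToIm K n)

variable {K} in
/-- The map induced on the cokernels of the differentials. -/
abbrev cokerMap {L : CochainComplex (Ban.{u} 𝕜) ℤ} (φ : K ⟶ L) :
    Ban.coker (K.d (n - 1) n) ⟶ Ban.coker (L.d (n - 1) n) :=
  Ban.cokerMap (K.d (n - 1) n) (L.d (n - 1) n) (φ.f (n - 1)) (φ.f n) (φ.comm _ _)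

variable {K} in
theorem cohomologyι_naturality {L : CochainComplex (Ban.{u} 𝕜) ℤ} (φ : K ⟶ L) :
    (RightHeart.cohomology 𝕜 n).map φ ≫ cohomologyι L n =
      cohomologyι K n ≫ (RightHeart.ι 𝕜).map (cokerMap n φ) := by
  apply (RightHeart.incl 𝕜).map_injective
  refine ((DBan.Q 𝕜).map_comp _ _).symm.trans
    (Eq.trans (congrArg _ ?_) ((DBan.Q 𝕜).map_comp _ _))
  refine (Ban.dblMap_comp_dblToSingle _ (cokerMap n φ) _
    (Ban.cokerMap_comp_cokerToIm _ _ (K.d_comp_d _ _ _) _ _ (L.d_comp_d _ _ _) _ _ _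
      (φ.comm _ _) (φ.comm _ _)) (𝟙 _)).trans ?_
  refine Eq.trans ?_ (Ban.dblToSingle_comp_single _ _ _).symm
  rw [Category.id_comp, Category.comp_id]

/-- The complex in the abelian category `C_r(Ban)` attached to a complex of Banach spaces. -/
abbrev ιComplex : CochainComplex (Ban.{u} 𝕜) ℤ ⥤ CochainComplex (RightHeart.{u} 𝕜) ℤ :=
  (RightHeart.ι 𝕜).mapHomologicalComplex (ComplexShape.up ℤ)

/-- The right cohomology is presented by the maps between cokernels and images. -/
def homologyPresentation : HomologyPresentation ((ιComplex (𝕜 := 𝕜)).obj K) n where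
  H := (RightHeart.cohomology 𝕜 n).obj K
  C := (RightHeart.ι 𝕜).obj (Ban.coker (K.d (n - 1) n))
  I := (RightHeart.ι 𝕜).obj (Ban.im (K.d n (n + 1)))
  π := (RightHeart.ι 𝕜).map (Ban.cokerπ (K.d (n - 1) n))
  r := (RightHeart.ι 𝕜).map (cokerToIm K n)
  i := (RightHeart.ι 𝕜).map (Ban.imι (K.d n (n + 1)))
  k := cohomologyι K n
  mono_i := mono_ι_map_imι (K.d n (n + 1))
  fac := (congrArg ((RightHeart.ι 𝕜).map _ ≫ ·) ((RightHeart.ι 𝕜).map_comp _ _).symm).trans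
    ((RightHeart.ι 𝕜).map_comp _ _).symm
  d_comp_π := ((ShortComplex.mk _ _ (Ban.comp_cokerπ (K.d (n - 1) n))).map (RightHeart.ι 𝕜)).zero
  k_comp_r := cohomologyι_comp K n
  isColimit := by
    have : Epi ((ShortComplex.mk _ _ (Ban.comp_cokerπ (K.d (n - 1) n))).map (RightHeart.ι 𝕜)).g :=
      inferInstanceAs (Epi ((RightHeart.ι 𝕜).map (Ban.cokerπ (K.d (n - 1) n))))
    exact (ι_coker_exact (K.d (n - 1) n)).gIsCokernel
  isLimit := (cohomology_shortExact K n).fIsKernel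

/-- The right cohomology is the homology computed in the right heart. -/
def cohomologyIso : (RightHeart.cohomology 𝕜 n).obj K ≅
    ((ιComplex (𝕜 := 𝕜)).obj K).homology n :=
  (homologyPresentation K n).iso

variable {K} in
theorem cohomologyIso_naturality {L : CochainComplex (Ban.{u} 𝕜) ℤ} (φ : K ⟶ L) :
    (RightHeart.cohomology 𝕜 n).map φ ≫ (cohomologyIso L n).hom =
      (cohomologyIso K n).hom ≫ HomologicalComplex.homologyMap ((ιComplex (𝕜 := 𝕜)).map φ) n := by
  refine HomologyPresentation.iso_naturality (homologyPresentation K n) (homologyPresentation L n)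
    ((ιComplex (𝕜 := 𝕜)).map φ) ((RightHeart.cohomology 𝕜 n).map φ)
    ((RightHeart.ι 𝕜).map (cokerMap n φ)) ?_ (cohomologyι_naturality n φ)
  exact ((RightHeart.ι 𝕜).map_comp _ _).symm.trans
    ((RightHeart.ι 𝕜).map_comp (Ban.cokerπ (K.d (n - 1) n)) (cokerMap n φ))

end Cohomology

end RightHeart

/-! ### Banach `G`-modules: kernels, products, free modules -/

/-- The Banach space `ℓ¹(I)`. -/
abbrev EllOne (𝕜 : Type) [RCLike 𝕜] (I : Type u) : Type u := lp (fun _ : I => 𝕜) 1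

namespace EllOne

variable {𝕜 : Type} [RCLike 𝕜] {I : Type u} {E : Type u} [NormedAddCommGroup E] [NormedSpace 𝕜 E]

/-- The standard basis vectors. -/
def basis (𝕜 : Type) [RCLike 𝕜] {I : Type u} (i : I) : EllOne 𝕜 I :=
  letI := Classical.decEq I
  lp.single 1 i (1 : 𝕜)

theorem norm_basis (i : I) : ‖basis 𝕜 i‖ = 1 :=
  let _ := Classical.decEq I
  (lp.norm_single (E := fun _ : I => 𝕜) (p := 1) zero_lt_one i 1).trans norm_one

theorem hom_ext {f g : EllOne 𝕜 I →L[𝕜] E} (h : ∀ i, f (basis 𝕜 i) = g (basis 𝕜 i)) : f = g := by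
  let _ := Classical.decEq I
  refine lp.ext_continuousLinearMap (by simp) fun i => ContinuousLinearMap.ext_ring ?_
  exact h i

theorem hasSum_norm (x : EllOne 𝕜 I) : HasSum (fun i => ‖x i‖) ‖x‖ := by
  simpa using lp.hasSum_norm (p := 1) (by simp) x

variable [CompleteSpace E]

/-- The continuous linear map on `ℓ¹(I)` with prescribed bounded values on the basis. -/
def lift (v : I → E) (C : ℝ) (hC : ∀ i, ‖v i‖ ≤ C) : EllOne 𝕜 I →L[𝕜] E :=
  have hb (x : EllOne 𝕜 I) (i : I) : ‖x i • v i‖ ≤ ‖x i‖ * C :=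
    (norm_smul _ _).trans_le (mul_le_mul_of_nonneg_left (hC i) (norm_nonneg _))
  have hs (x : EllOne 𝕜 I) : Summable fun i => x i • v i :=
    Summable.of_norm_bounded ((hasSum_norm x).summable.mul_right C) (hb x)
  LinearMap.mkContinuous
    { toFun x := ∑' i, x i • v i
      map_add' x y := by
        rw [← (hs x).tsum_add (hs y)]
        exact tsum_congr fun i => add_smul _ _ _
      map_smul' c x := by
        rw [RingHom.id_apply, ← (hs x).tsum_const_smul c]
        exact tsum_congr fun i => mul_smul _ _ _ }
    C fun x => (tsum_of_norm_bounded ((hasSum_norm x).mul_right C) (hb x)).trans_eq (mul_comm _ _)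

variable (v : I → E) (C : ℝ) (hC : ∀ i, ‖v i‖ ≤ C)

@[simp]
theorem lift_basis (i : I) : lift (𝕜 := 𝕜) v C hC (basis 𝕜 i) = v i := by
  let _ := Classical.decEq I
  change ∑' j, (lp.single 1 i (1 : 𝕜) : EllOne 𝕜 I) j • v j = v i
  rw [tsum_eq_single i fun j hj => by rw [lp.single_apply_ne _ _ _ hj, zero_smul],
    lp.single_apply_self, one_smul]

theorem norm_lift_le (hC₀ : 0 ≤ C) (x : EllOne 𝕜 I) : ‖lift (𝕜 := 𝕜) v C hC x‖ ≤ C * ‖x‖ :=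
  ContinuousLinearMap.le_of_opNorm_le (lift (𝕜 := 𝕜) v C hC)
    (by unfold lift; exact LinearMap.mkContinuous_norm_le _ hC₀ _) x

end EllOne

namespace GBan

variable {𝕜 : Type} [RCLike 𝕜] {G : Type u} [Group G]

theorem congr_hom {M N : GBan 𝕜 G} {f g : M ⟶ N} (h : f = g) (x : M) : hom f x = hom g x :=
  congrArg (fun k => hom k x) h

/-- The morphism given by an equivariant continuous linear map. -/
abbrev ofHom {M N : GBan 𝕜 G} (f : M →L[𝕜] N) (h : ∀ (g : G) (x : M), f (M.ρ g x) = N.ρ g (f x)) :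
    M ⟶ N := ⟨Ban.ofHom f, h⟩

/-- A Banach `G`-module from an action by contractions. -/
def ofAction (E : Ban.{u} 𝕜) (a : G → E →ₗ[𝕜] E) (h₁ : ∀ x, a 1 x = x)
    (hm : ∀ g h x, a (g * h) x = a g (a h x)) (hn : ∀ g x, ‖a g x‖ ≤ ‖x‖) : GBan 𝕜 G where
  space := E
  ρ := MonoidHom.mk' (fun g =>
    { toLinearEquiv := LinearEquiv.ofLinearMap (a g) (a g⁻¹)
        (LinearMap.ext fun x => by
          rw [LinearMap.comp_apply, ← hm, mul_inv_cancel, h₁, LinearMap.id_apply])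
        (LinearMap.ext fun x => by
          rw [LinearMap.comp_apply, ← hm, inv_mul_cancel, h₁, LinearMap.id_apply])
      -- A contraction whose inverse is also a contraction is an isometry.
      norm_map' := fun x => le_antisymm (hn g x) (by
        have := hn g⁻¹ (a g x)
        rwa [← hm, inv_mul_cancel, h₁] at this) })
    (fun g h => LinearIsometryEquiv.ext fun x => hm g h x)

theorem norm_ρ (M : GBan 𝕜 G) (g : G) (x : M) : ‖M.ρ g x‖ = ‖x‖ := (M.ρ g).norm_map x

theorem ρ_one (M : GBan 𝕜 G) (x : M) : M.ρ 1 x = x := by rw [map_one]; rfl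

theorem ρ_mul (M : GBan 𝕜 G) (g h : G) (x : M) : M.ρ (g * h) x = M.ρ g (M.ρ h x) := by
  rw [map_mul]; rfl

theorem isZero_of_subsingleton (M : GBan 𝕜 G) [Subsingleton M] : IsZero M := by
  rw [IsZero.iff_id_eq_zero]
  ext x
  exact Subsingleton.elim _ _

/-- The zero module. -/
def zero (𝕜 : Type) [RCLike 𝕜] (G : Type u) [Group G] : GBan 𝕜 G where
  space := Ban.of 𝕜 PUnit.{u + 1}
  ρ := 1

instance : Subsingleton (zero 𝕜 G) := inferInstanceAs (Subsingleton PUnit)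

section Kernel

variable {M N : GBan 𝕜 G} (f : M ⟶ N)

/-- The kernel of a morphism of Banach `G`-modules. -/
def ker : GBan 𝕜 G :=
  have : CompleteSpace (LinearMap.ker (hom f).toLinearMap) :=
    (hom f).isClosed_ker.completeSpace_coe
  ofAction (Ban.of 𝕜 (LinearMap.ker (hom f).toLinearMap))
    (fun g => (M.ρ g).toLinearEquiv.toLinearMap.restrict fun x (hx : hom f x = 0) => by
      change hom f (M.ρ g x) = 0
      rw [hom_equivariant, hx, map_zero])
    (fun x => Subtype.ext (M.ρ_one _)) (fun g h x => Subtype.ext (M.ρ_mul g h _))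
    (fun g x => (M.norm_ρ g x.1).le)

/-- The inclusion of the kernel. -/
def kerι : ker f ⟶ M :=
  ofHom (LinearMap.ker (hom f).toLinearMap).subtypeL fun _ _ => rfl

theorem kerι_injective : Function.Injective (hom (kerι f)) := Subtype.val_injective

theorem kerι_comp : kerι f ≫ f = 0 := by
  ext x
  exact x.2

theorem exists_kerι_eq (x : M) (hx : hom f x = 0) : ∃ y, hom (kerι f) y = x := ⟨⟨x, hx⟩, rfl⟩

instance : Mono (kerι f) where
  right_cancellation a b h := by
    ext x
    exact kerι_injective f (congr_hom h x)

/-- The lift of a morphism to the kernel. -/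
def kerLift {P : GBan 𝕜 G} (a : P ⟶ M) (h : a ≫ f = 0) : P ⟶ ker f :=
  ofHom ((hom a).codRestrict (LinearMap.ker (hom f).toLinearMap) (congr_hom h)) fun g x =>
    Subtype.ext (hom_equivariant a g x)

@[simp]
theorem kerLift_kerι {P : GBan 𝕜 G} (a : P ⟶ M) (h : a ≫ f = 0) : kerLift f a h ≫ kerι f = a :=
  rfl

end Kernel

section Prod

variable (M N : GBan 𝕜 G)

/-- The product of Banach `G`-modules. -/
def prod : GBan 𝕜 G :=
  ofAction (Ban.of 𝕜 (M × N))
    (fun g => (M.ρ g).toLinearEquiv.toLinearMap.prodMap (N.ρ g).toLinearEquiv.toLinearMap)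
    (fun _ => Prod.ext (M.ρ_one _) (N.ρ_one _))
    (fun g h _ => Prod.ext (M.ρ_mul g h _) (N.ρ_mul g h _))
    (fun g x => max_le_max (M.norm_ρ g x.1).le (N.norm_ρ g x.2).le)

/-- The first projection. -/
def fst : prod M N ⟶ M := ofHom (ContinuousLinearMap.fst 𝕜 M N) fun _ _ => rfl

/-- The second projection. -/
def snd : prod M N ⟶ N := ofHom (ContinuousLinearMap.snd 𝕜 M N) fun _ _ => rfl

/-- The first inclusion. -/
def inl : M ⟶ prod M N := ofHom (ContinuousLinearMap.inl 𝕜 M N) fun g _ =>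
  Prod.ext rfl (map_zero (N.ρ g)).symm

/-- The second inclusion. -/
def inr : N ⟶ prod M N := ofHom (ContinuousLinearMap.inr 𝕜 M N) fun g _ =>
  Prod.ext (map_zero (M.ρ g)).symm rfl

theorem inl_fst : inl M N ≫ fst M N = 𝟙 M := rfl
theorem inl_snd : inl M N ≫ snd M N = 0 := rfl
theorem inr_snd : inr M N ≫ snd M N = 𝟙 N := rfl

theorem prod_total : fst M N ≫ inl M N + snd M N ≫ inr M N = 𝟙 (prod M N) := by
  ext x
  exact Prod.ext (add_zero x.1) (zero_add x.2)

end Prod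

theorem IsProjective.prod {M N : GBan 𝕜 G} (hM : IsProjective M) (hN : IsProjective N) :
    IsProjective (prod M N) := by
  intro A B p hp f
  obtain ⟨a, ha⟩ := hM p hp (inl M N ≫ f)
  obtain ⟨b, hb⟩ := hN p hp (inr M N ≫ f)
  refine ⟨fst M N ≫ a + snd M N ≫ b, ?_⟩
  rw [Preadditive.add_comp, Category.assoc, Category.assoc, ha, hb, ← Category.assoc,
    ← Category.assoc, ← Preadditive.add_comp, prod_total, Category.id_comp]

/-! ### Free modules and enough projectives -/

section Free

/-- The action on the free module. -/
def freeAction (𝕜 : Type) [RCLike 𝕜] (X : Type u) (g : G) :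
    EllOne 𝕜 (G × X) →L[𝕜] EllOne 𝕜 (G × X) :=
  EllOne.lift (fun i => EllOne.basis 𝕜 (g * i.1, i.2)) 1 fun _ => (EllOne.norm_basis _).le

theorem freeAction_basis (X : Type u) (g : G) (i : G × X) :
    freeAction 𝕜 X g (EllOne.basis 𝕜 i) = EllOne.basis 𝕜 (g * i.1, i.2) :=
  EllOne.lift_basis _ _ _ _

variable (𝕜 G) in
/-- The free Banach `G`-module `ℓ¹(G × X)`. -/
def free (X : Type u) : GBan 𝕜 G :=
  ofAction (Ban.of.{u} 𝕜 (EllOne 𝕜 (G × X)))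
    (fun g => (freeAction 𝕜 X g).toLinearMap)
    (DFunLike.congr_fun (f := freeAction 𝕜 X 1) (g := ContinuousLinearMap.id 𝕜 _)
      (EllOne.hom_ext fun i => by
        rw [freeAction_basis, one_mul, ContinuousLinearMap.id_apply]))
    (fun g h => DFunLike.congr_fun (f := freeAction 𝕜 X (g * h))
      (g := (freeAction 𝕜 X g).comp (freeAction 𝕜 X h)) (EllOne.hom_ext fun i => by
        rw [ContinuousLinearMap.comp_apply, freeAction_basis, freeAction_basis, freeAction_basis,
          mul_assoc]))
    (fun _ x => (EllOne.norm_lift_le _ _ _ zero_le_one x).trans_eq (one_mul _))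

variable {X : Type u}

variable (𝕜) in
/-- The basis vectors of the free module. -/
def freeBasis (g : G) (x : X) : free 𝕜 G X := EllOne.basis 𝕜 (g, x)

theorem norm_freeBasis (g : G) (x : X) : ‖freeBasis 𝕜 g x‖ = 1 := EllOne.norm_basis _

theorem ρ_freeBasis (g h : G) (x : X) :
    (free 𝕜 G X).ρ g (freeBasis 𝕜 h x) = freeBasis 𝕜 (g * h) x :=
  freeAction_basis X g (h, x)

/-- Equivariance determines the values on all basis vectors `(g, x)` from those at `(1, x)`. -/
theorem free_hom_ext {M : GBan 𝕜 G} {a b : free 𝕜 G X ⟶ M}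
    (h : ∀ x, hom a (freeBasis 𝕜 1 x) = hom b (freeBasis 𝕜 1 x)) : a = b := by
  refine Hom.ext (Ban.Hom.ext (EllOne.hom_ext fun ⟨g, x⟩ => ?_))
  have key (c : free 𝕜 G X ⟶ M) : hom c (freeBasis 𝕜 g x) = M.ρ g (hom c (freeBasis 𝕜 1 x)) := by
    rw [← hom_equivariant, ρ_freeBasis, mul_one]
  exact (key a).trans ((congrArg _ (h x)).trans (key b).symm)

theorem exists_freeLift {M : GBan 𝕜 G} (v : X → M) (C : ℝ) (hv : ∀ x, ‖v x‖ ≤ C) :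
    ∃ a : free 𝕜 G X ⟶ M, ∀ x, hom a (freeBasis 𝕜 1 x) = v x := by
  let a : free 𝕜 G X →L[𝕜] M := EllOne.lift (fun i => M.ρ i.1 (v i.2)) C
    fun i => (M.norm_ρ _ _).trans_le (hv _)
  have ha (g : G) (x : X) : a (freeBasis 𝕜 g x) = M.ρ g (v x) := EllOne.lift_basis _ _ _ _
  refine ⟨ofHom a fun g x => ?_, fun x => (ha 1 x).trans (M.ρ_one _)⟩
  refine DFunLike.congr_fun
    (f := a.comp ((free 𝕜 G X).ρ g).toLinearIsometry.toContinuousLinearMap)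
    (g := (M.ρ g).toLinearIsometry.toContinuousLinearMap.comp a)
    (EllOne.hom_ext fun ⟨h, y⟩ => ?_) x
  change a ((free 𝕜 G X).ρ g (freeBasis 𝕜 h y)) = M.ρ g (a (freeBasis 𝕜 h y))
  rw [ρ_freeBasis, ha, ha, ρ_mul]

/-- A map out of `ℓ¹` needs uniformly bounded values on the basis. The open mapping theorem provides
such preimages of the vectors `f (1, x)`, with bound `C * ‖f‖`. -/
theorem isProjective_free : IsProjective (free 𝕜 G X) := by
  intro M N p hp f
  obtain ⟨C, hC, h⟩ := ContinuousLinearMap.exists_preimage_norm_le (hom p) hp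
  choose v hv hn using fun x : X => h (hom f (freeBasis 𝕜 1 x))
  obtain ⟨a, ha⟩ := exists_freeLift (𝕜 := 𝕜) (G := G) v (C * ‖hom f‖) fun x =>
    (hn x).trans (mul_le_mul_of_nonneg_left
      (((hom f).le_opNorm _).trans_eq (by rw [norm_freeBasis, mul_one])) hC.le)
  exact ⟨a, free_hom_ext fun x => by rw [comp_apply, ha, hv]⟩

variable (M : GBan 𝕜 G)

/-- A projective module with an admissible epic onto `M`. -/
def cover : GBan 𝕜 G := free 𝕜 G {m : M // ‖m‖ ≤ 1}

/-- Indexing by the closed unit ball bounds the values on the basis by 1 and loses nothing, since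
every nonzero vector is a multiple of a unit vector. -/
theorem exists_coverπ : ∃ π : cover M ⟶ M, Function.Surjective (hom π) := by
  obtain ⟨a, ha⟩ := exists_freeLift (𝕜 := 𝕜) (G := G) (X := {m : M // ‖m‖ ≤ 1})
    Subtype.val 1 Subtype.prop
  refine ⟨a, fun m => ?_⟩
  by_cases hm : m = 0
  · exact ⟨0, by rw [map_zero, hm]⟩
  · have h₀ : (‖m‖ : 𝕜) ≠ 0 := by simpa using hm
    have h₁ : ‖(‖m‖ : 𝕜)⁻¹ • m‖ ≤ 1 := by
      rw [norm_smul, norm_inv, RCLike.norm_ofReal, abs_norm,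
        inv_mul_cancel₀ (norm_ne_zero_iff.2 hm)]
    refine ⟨(‖m‖ : 𝕜) • freeBasis 𝕜 1 ⟨_, h₁⟩, ?_⟩
    exact (map_smul (hom a) _ _).trans ((congrArg _ (ha _)).trans (smul_inv_smul₀ h₀ m))

/-- The projection from the cover. -/
def coverπ : cover M ⟶ M := (exists_coverπ M).choose

theorem coverπ_surjective : Function.Surjective (hom (coverπ M)) := (exists_coverπ M).choose_spec

theorem isProjective_cover : IsProjective (cover M) := isProjective_free

end Free

end GBan

/-! ### Resolutions built from coverings -/

/-- A class of objects of `C`, each of which is covered by an object of `C` with a kernel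
in the class. -/
structure CoveringClass (C : Type*) [Category* C] [HasZeroMorphisms C] (X : Type*) where
  obj : X → C
  cov : X → C
  syz : X → X
  π : ∀ x, cov x ⟶ obj x
  i : ∀ x, obj (syz x) ⟶ cov x
  i_π : ∀ x, i x ≫ π x = 0

namespace CoveringClass

variable {C : Type*} [Category* C] [HasZeroMorphisms C] {X : Type*} (D : CoveringClass C X) (x : X)

/-- The iterated syzygies. -/
def syzygy : ℕ → X
  | 0 => x
  | n + 1 => D.syz (syzygy n)

/-- The projections to the iterated syzygies. -/
def syzygyπ (n : ℕ) : D.cov (D.syzygy x n) ⟶ D.obj (D.syzygy x n) := D.π _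

/-- The inclusions of the iterated syzygies. -/
def syzygyι (n : ℕ) : D.obj (D.syzygy x (n + 1)) ⟶ D.cov (D.syzygy x n) := D.i _

theorem syzygyι_π (n : ℕ) : D.syzygyι x n ≫ D.syzygyπ x n = 0 := D.i_π _

/-- The complex obtained by splicing the coverings of the syzygies. -/
def complex : ChainComplex C ℕ :=
  ChainComplex.of (fun n => D.cov (D.syzygy x n))
    (fun n => D.syzygyπ x (n + 1) ≫ D.syzygyι x n)
    (fun n => by
      rw [Category.assoc, ← Category.assoc (D.syzygyι x (n + 1)), syzygyι_π, zero_comp, comp_zero])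

theorem complex_d (n : ℕ) : (D.complex x).d (n + 1) n = D.syzygyπ x (n + 1) ≫ D.syzygyι x n :=
  ChainComplex.of_d (fun n => D.cov (D.syzygy x n)) (fun n => D.syzygyπ x (n + 1) ≫ D.syzygyι x n) n

theorem complex_d_comp : (D.complex x).d 1 0 ≫ D.syzygyπ x 0 = 0 := by
  rw [complex_d]
  exact (Category.assoc _ _ _).trans ((congrArg _ (D.syzygyι_π x 0)).trans comp_zero)

end CoveringClass

/-! ### Lifting chain maps and homotopies -/

namespace ChainComplex

/-- The comparison theorem, with the required liftings as hypotheses instead of projectivity and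
exactness. It thus applies both to modules and to short complexes of modules. -/
theorem exists_hom_of_lifting {C : Type*} [Category* C] [HasZeroMorphisms C]
    {P Q : ChainComplex C ℕ} {X Y : C} (ε : P.X 0 ⟶ X) (η : Q.X 0 ⟶ Y) (hε : P.d 1 0 ≫ ε = 0)
    (f : X ⟶ Y) (h₀ : ∀ a : P.X 0 ⟶ Y, ∃ b, b ≫ η = a)
    (h₁ : ∀ a : P.X 1 ⟶ Q.X 0, a ≫ η = 0 → ∃ b, b ≫ Q.d 1 0 = a)
    (h : ∀ (n : ℕ) (a : P.X (n + 2) ⟶ Q.X (n + 1)), a ≫ Q.d (n + 1) n = 0 →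
      ∃ b, b ≫ Q.d (n + 2) (n + 1) = a) :
    ∃ φ : P ⟶ Q, φ.f 0 ≫ η = ε ≫ f := by
  obtain ⟨b₀, hb₀⟩ := h₀ (ε ≫ f)
  have e₁ := h₁ (P.d 1 0 ≫ b₀) (by rw [Category.assoc, hb₀, reassoc_of% hε, zero_comp])
  refine ⟨mkHom P Q b₀ e₁.choose e₁.choose_spec fun n p => ?_, hb₀⟩
  have e := h n (P.d (n + 2) (n + 1) ≫ p.2.1) (by
    rw [Category.assoc, p.2.2, HomologicalComplex.d_comp_d_assoc, zero_comp])
  exact ⟨e.choose, e.choose_spec⟩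

theorem nonempty_homotopy_zero_of_lifting {C : Type*} [Category* C] [Preadditive C]
    {P Q : ChainComplex C ℕ} {Y : C} (η : Q.X 0 ⟶ Y) (φ : P ⟶ Q) (hφ : φ.f 0 ≫ η = 0)
    (h₀ : ∀ a : P.X 0 ⟶ Q.X 0, a ≫ η = 0 → ∃ b, b ≫ Q.d 1 0 = a)
    (h : ∀ (n : ℕ) (a : P.X (n + 1) ⟶ Q.X (n + 1)), a ≫ Q.d (n + 1) n = 0 →
      ∃ b, b ≫ Q.d (n + 2) (n + 1) = a) :
    Nonempty (Homotopy φ 0) := by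
  have e₀ := h₀ (φ.f 0) hφ
  have e₁ := h 0 (φ.f 1 - P.d 1 0 ≫ e₀.choose) (by
    rw [Preadditive.sub_comp, Category.assoc, e₀.choose_spec, φ.comm, sub_self])
  refine ⟨Homotopy.mkInductive φ e₀.choose e₀.choose_spec.symm e₁.choose
    (by rw [e₁.choose_spec, add_sub_cancel]) fun n p => ?_⟩
  have e := h (n + 1) (φ.f (n + 2) - P.d (n + 2) (n + 1) ≫ p.2.1) (by
    have hp : p.2.1 ≫ Q.d (n + 2) (n + 1) = φ.f (n + 1) - P.d (n + 1) n ≫ p.1 :=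
      eq_sub_of_add_eq' p.2.2.symm
    rw [Preadditive.sub_comp, Category.assoc, hp, Preadditive.comp_sub,
      HomologicalComplex.d_comp_d_assoc, zero_comp, sub_zero, φ.comm, sub_self])
  exact ⟨e.choose, by rw [e.choose_spec, add_sub_cancel]⟩

end ChainComplex

/-! ### Projective resolutions of Banach `G`-modules -/

namespace GBan

variable {𝕜 : Type} [RCLike 𝕜] {G : Type u} [Group G]

/-- Algebraic exactness at the middle term: the kernel of `g` is contained in the range of `f`. -/
def ExactAt {A B C : GBan 𝕜 G} (f : A ⟶ B) (g : B ⟶ C) : Prop :=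
  ∀ x, hom g x = 0 → ∃ y, hom f y = x

/-- Exactness says that `f` corestricts to a surjection onto the closed submodule `ker g`, which is
an admissible epic. -/
theorem IsProjective.exists_lift {P A B C : GBan 𝕜 G} (hP : IsProjective P) {f : A ⟶ B}
    {g : B ⟶ C} (w : f ≫ g = 0) (h : ExactAt f g) (a : P ⟶ B) (ha : a ≫ g = 0) :
    ∃ b, b ≫ f = a := by
  obtain ⟨b, hb⟩ := hP (kerLift g f w) (fun x => by
    obtain ⟨y, hy⟩ := h (hom (kerι g) x) (congr_hom (kerι_comp g) x)
    exact ⟨y, kerι_injective g hy⟩) (kerLift g a ha)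
  refine ⟨b, ?_⟩
  rw [← kerLift_kerι g f w, ← Category.assoc, hb, kerLift_kerι]

theorem ExactAt.of_surjective {A B C : GBan 𝕜 G} {f : A ⟶ B} (hf : Function.Surjective (hom f))
    (g : B ⟶ C) : ExactAt f g :=
  fun x _ => hf x

/-- Splicing at a term of a resolution. -/
theorem ExactAt.of_covering {P K Q M : GBan 𝕜 G} {π : P ⟶ K} (hπ : Function.Surjective (hom π))
    {i : K ⟶ Q} {g : Q ⟶ M} (h : ExactAt i g) : ExactAt (π ≫ i) g := by
  intro x hx
  obtain ⟨y, hy⟩ := h x hx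
  obtain ⟨z, hz⟩ := hπ y
  exact ⟨z, by rw [comp_apply, hz, hy]⟩

theorem ExactAt.comp_injective {A B C D : GBan 𝕜 G} {f : A ⟶ B} {g : B ⟶ C} (h : ExactAt f g)
    {j : C ⟶ D} (hj : Function.Injective (hom j)) : ExactAt f (g ≫ j) :=
  fun x hx => h x (hj (hx.trans (map_zero _).symm))

theorem exactAt_kerι {M N : GBan 𝕜 G} (f : M ⟶ N) : ExactAt (kerι f) f := exists_kerι_eq f

namespace ProjectiveResolution

variable {M N : GBan 𝕜 G} (R : ProjectiveResolution M) (R' : ProjectiveResolution N)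

theorem exists_lift (f : M ⟶ N) : ∃ φ : R.P ⟶ R'.P, φ.f 0 ≫ R'.ε = R.ε ≫ f :=
  ChainComplex.exists_hom_of_lifting R.ε R'.ε R.d_comp_ε f
    (R.projective 0 R'.ε R'.surjective)
    ((R.projective 1).exists_lift R'.d_comp_ε R'.exact_zero)
    (fun n => (R.projective (n + 2)).exists_lift (R'.P.d_comp_d _ _ _) (R'.exact_succ n))

variable {R R'} in
theorem nonempty_homotopy {f : M ⟶ N} {φ ψ : R.P ⟶ R'.P} (hφ : φ.f 0 ≫ R'.ε = R.ε ≫ f)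
    (hψ : ψ.f 0 ≫ R'.ε = R.ε ≫ f) : Nonempty (Homotopy φ ψ) := by
  obtain ⟨h⟩ := ChainComplex.nonempty_homotopy_zero_of_lifting R'.ε (φ - ψ)
    (by rw [HomologicalComplex.sub_f_apply, Preadditive.sub_comp, hφ, hψ, sub_self])
    ((R.projective 0).exists_lift R'.d_comp_ε R'.exact_zero)
    (fun n => (R.projective (n + 1)).exists_lift (R'.P.d_comp_d _ _ _) (R'.exact_succ n))
  exact ⟨(Homotopy.equivSubZero).symm h⟩

end ProjectiveResolution

/-- The coverings of Banach `G`-modules by free modules. -/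
def coverings (𝕜 : Type) [RCLike 𝕜] (G : Type u) [Group G] :
    CoveringClass (GBan 𝕜 G) (GBan 𝕜 G) where
  obj := id
  cov := cover
  syz M := ker (coverπ M)
  π M := coverπ M
  i M := kerι (coverπ M)
  i_π _ := kerι_comp _

theorem coverings_surjective (M : GBan 𝕜 G) (n : ℕ) :
    Function.Surjective (hom ((coverings 𝕜 G).syzygyπ M n)) :=
  coverπ_surjective _

theorem coverings_injective (M : GBan 𝕜 G) (n : ℕ) :
    Function.Injective (hom ((coverings 𝕜 G).syzygyι M n)) :=
  kerι_injective _

theorem coverings_exactAt (M : GBan 𝕜 G) (n : ℕ) :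
    ExactAt ((coverings 𝕜 G).syzygyι M n) ((coverings 𝕜 G).syzygyπ M n) :=
  exactAt_kerι _

/-- The resolution of a Banach `G`-module by iterated free coverings. -/
def resolution (M : GBan 𝕜 G) : ProjectiveResolution M where
  P := (coverings 𝕜 G).complex M
  projective _ := isProjective_cover _
  ε := coverπ M
  d_comp_ε := (coverings 𝕜 G).complex_d_comp M
  surjective := coverπ_surjective M
  exact_zero := by
    rw [CoveringClass.complex_d]
    exact (coverings_exactAt M 0).of_covering (coverings_surjective M _)
  exact_succ n := by
    rw [CoveringClass.complex_d, CoveringClass.complex_d]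
    exact ((coverings_exactAt M _).comp_injective (coverings_injective M _)).of_covering
      (coverings_surjective M _)

/-! ### Resolutions of short exact sequences -/

section Cover

variable {S : ShortComplex (GBan 𝕜 G)}

/-- The direct sum short exact sequence of the covers of the outer terms. -/
abbrev coverShortComplex (S : ShortComplex (GBan 𝕜 G)) : ShortComplex (GBan 𝕜 G) :=
  ShortComplex.mk (inl (cover S.X₁) (cover S.X₃)) (snd (cover S.X₁) (cover S.X₃)) (inl_snd _ _)

/-- The splitting of the cover. -/
def coverSplitting (S : ShortComplex (GBan 𝕜 G)) : (coverShortComplex S).Splitting where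
  r := fst _ _
  s := inr _ _
  f_r := inl_fst _ _
  s_g := inr_snd _ _
  id := prod_total _ _

/-- The horseshoe construction: the cover of `S.X₃` is lifted to `S.X₂` by projectivity and added to
the cover of `S.X₁`. -/
theorem exists_coverShortComplexπ (hS : ShortExact S) : ∃ π : coverShortComplex S ⟶ S,
    Function.Surjective (hom π.τ₁) ∧ Function.Surjective (hom π.τ₂) ∧
      Function.Surjective (hom π.τ₃) := by
  obtain ⟨h, hh⟩ := isProjective_cover S.X₃ S.g hS.surjective (coverπ S.X₃)
  refine ⟨{
    τ₁ := coverπ S.X₁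
    τ₂ := fst _ _ ≫ coverπ S.X₁ ≫ S.f + snd _ _ ≫ h
    τ₃ := coverπ S.X₃
    comm₁₂ := ?_
    comm₂₃ := ?_ }, coverπ_surjective _, fun x => ?_, coverπ_surjective _⟩
  · dsimp only
    rw [Preadditive.comp_add, ← Category.assoc (inl _ _), ← Category.assoc (inl _ _), inl_fst,
      inl_snd, zero_comp, add_zero, Category.id_comp]
  · dsimp only
    rw [Preadditive.add_comp, Category.assoc, Category.assoc, Category.assoc, S.zero, hh,
      comp_zero, comp_zero, zero_add]
  · obtain ⟨z, hz⟩ := coverπ_surjective S.X₃ (hom S.g x)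
    obtain ⟨y, hy⟩ := hS.exact (x - hom h z) (by
      rw [map_sub, ← hz, sub_eq_zero]
      exact (congr_hom hh z).symm)
    obtain ⟨t, ht⟩ := coverπ_surjective S.X₁ y
    refine ⟨(t, z), ?_⟩
    change hom S.f (hom (coverπ S.X₁) t) + hom h z = x
    rw [ht, hy, sub_add_cancel]

/-- The kernel of a morphism of short complexes. -/
def kerShortComplex {S T : ShortComplex (GBan 𝕜 G)} (π : S ⟶ T) : ShortComplex (GBan 𝕜 G) :=
  ShortComplex.mk
    (kerLift π.τ₂ (kerι π.τ₁ ≫ S.f) (by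
      rw [Category.assoc, ← π.comm₁₂, ← Category.assoc, kerι_comp, zero_comp]))
    (kerLift π.τ₃ (kerι π.τ₂ ≫ S.g) (by
      rw [Category.assoc, ← π.comm₂₃, ← Category.assoc, kerι_comp, zero_comp]))
    (by
      rw [← cancel_mono (kerι _), Category.assoc, kerLift_kerι, ← Category.assoc, kerLift_kerι,
        Category.assoc, S.zero, comp_zero, zero_comp])

/-- The inclusion of the kernel of a morphism of short complexes. -/
def kerShortComplexι {S T : ShortComplex (GBan 𝕜 G)} (π : S ⟶ T) : kerShortComplex π ⟶ S where
  τ₁ := kerι π.τ₁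
  τ₂ := kerι π.τ₂
  τ₃ := kerι π.τ₃
  comm₁₂ := rfl
  comm₂₃ := rfl

theorem kerShortComplexι_comp {S T : ShortComplex (GBan 𝕜 G)} (π : S ⟶ T) :
    kerShortComplexι π ≫ π = 0 :=
  ShortComplex.hom_ext _ _ (kerι_comp π.τ₁) (kerι_comp π.τ₂) (kerι_comp π.τ₃)

theorem shortExact_coverShortComplex (S : ShortComplex (GBan 𝕜 G)) :
    ShortExact (coverShortComplex S) where
  injective _ _ h := congrArg Prod.fst h
  exact x hx := ⟨x.1, Prod.ext rfl hx.symm⟩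
  surjective z := ⟨(0, z), rfl⟩

/-- Needed to iterate the covering. Surjectivity onto the third kernel is the snake lemma: the
obstruction lies in the cokernel of `π.τ₁`, which vanishes. -/
theorem ShortExact.ker {S T : ShortComplex (GBan 𝕜 G)} (hS : ShortExact S) (hT : ShortExact T)
    (π : S ⟶ T) (hπ : Function.Surjective (hom π.τ₁)) : ShortExact (kerShortComplex π) where
  injective x y h := Subtype.ext (hS.injective (congrArg Subtype.val h))
  exact x hx := by
    obtain ⟨y, hy⟩ := hS.exact x.1 (congrArg Subtype.val hx)
    refine ⟨⟨y, hT.injective ?_⟩, Subtype.ext hy⟩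
    exact ((congr_hom π.comm₁₂ y).trans ((congrArg (hom π.τ₂) hy).trans x.2)).trans
      (map_zero _).symm
  surjective z := by
    obtain ⟨x, hx⟩ := hS.surjective z.1
    obtain ⟨t, ht⟩ := hT.exact (hom π.τ₂ x)
      ((congr_hom π.comm₂₃ x).trans ((congrArg (hom π.τ₃) hx).trans z.2))
    obtain ⟨y, hy⟩ := hπ t
    -- A preimage `x` of `z` is corrected by an element of `S.X₁` so that `π.τ₂` kills it; its image
    -- under `S.g` is unchanged.
    refine ⟨⟨x - hom S.f y, ?_⟩, Subtype.ext ?_⟩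
    · change hom π.τ₂ (x - hom S.f y) = 0
      rw [map_sub, sub_eq_zero, ← ht, ← hy]
      exact congr_hom π.comm₁₂ y
    · change hom S.g (x - hom S.f y) = z.1
      rw [map_sub, hx]
      exact (congrArg (z.1 - ·) (congr_hom S.zero y)).trans (sub_zero _)

end Cover

/-- The projection from the cover of a short exact sequence. -/
def coverShortComplexπ {S : ShortComplex (GBan 𝕜 G)} (hS : ShortExact S) :
    coverShortComplex S ⟶ S := (exists_coverShortComplexπ hS).choose

/-- The coverings of short exact sequences. -/
def shortExactCoverings (𝕜 : Type) [RCLike 𝕜] (G : Type u) [Group G] :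
    CoveringClass (ShortComplex (GBan 𝕜 G)) {S : ShortComplex (GBan 𝕜 G) // ShortExact S} where
  obj S := S.1
  cov S := coverShortComplex S.1
  syz S := ⟨kerShortComplex (coverShortComplexπ S.2),
    (shortExact_coverShortComplex S.1).ker S.2 _ (exists_coverShortComplexπ S.2).choose_spec.1⟩
  π S := coverShortComplexπ S.2
  i _ := kerShortComplexι _
  i_π _ := kerShortComplexι_comp _

section

variable (x : {S : ShortComplex (GBan 𝕜 G) // ShortExact S})

theorem shortExactCoverings_surjective₁ (n : ℕ) :
    Function.Surjective (hom ((shortExactCoverings 𝕜 G).syzygyπ x n).τ₁) :=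
  (exists_coverShortComplexπ ((shortExactCoverings 𝕜 G).syzygy x n).2).choose_spec.1

theorem shortExactCoverings_injective₁ (n : ℕ) :
    Function.Injective (hom ((shortExactCoverings 𝕜 G).syzygyι x n).τ₁) :=
  kerι_injective (coverShortComplexπ ((shortExactCoverings 𝕜 G).syzygy x n).2).τ₁

theorem shortExactCoverings_exactAt₁ (n : ℕ) :
    ExactAt ((shortExactCoverings 𝕜 G).syzygyι x n).τ₁
      ((shortExactCoverings 𝕜 G).syzygyπ x n).τ₁ :=
  exactAt_kerι (coverShortComplexπ ((shortExactCoverings 𝕜 G).syzygy x n).2).τ₁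

theorem shortExactCoverings_surjective₂ (n : ℕ) :
    Function.Surjective (hom ((shortExactCoverings 𝕜 G).syzygyπ x n).τ₂) :=
  (exists_coverShortComplexπ ((shortExactCoverings 𝕜 G).syzygy x n).2).choose_spec.2.1

theorem shortExactCoverings_injective₂ (n : ℕ) :
    Function.Injective (hom ((shortExactCoverings 𝕜 G).syzygyι x n).τ₂) :=
  kerι_injective (coverShortComplexπ ((shortExactCoverings 𝕜 G).syzygy x n).2).τ₂

theorem shortExactCoverings_exactAt₂ (n : ℕ) :
    ExactAt ((shortExactCoverings 𝕜 G).syzygyι x n).τ₂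
      ((shortExactCoverings 𝕜 G).syzygyπ x n).τ₂ :=
  exactAt_kerι (coverShortComplexπ ((shortExactCoverings 𝕜 G).syzygy x n).2).τ₂

theorem shortExactCoverings_surjective₃ (n : ℕ) :
    Function.Surjective (hom ((shortExactCoverings 𝕜 G).syzygyπ x n).τ₃) :=
  (exists_coverShortComplexπ ((shortExactCoverings 𝕜 G).syzygy x n).2).choose_spec.2.2

theorem shortExactCoverings_injective₃ (n : ℕ) :
    Function.Injective (hom ((shortExactCoverings 𝕜 G).syzygyι x n).τ₃) :=
  kerι_injective (coverShortComplexπ ((shortExactCoverings 𝕜 G).syzygy x n).2).τ₃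

theorem shortExactCoverings_exactAt₃ (n : ℕ) :
    ExactAt ((shortExactCoverings 𝕜 G).syzygyι x n).τ₃
      ((shortExactCoverings 𝕜 G).syzygyπ x n).τ₃ :=
  exactAt_kerι (coverShortComplexπ ((shortExactCoverings 𝕜 G).syzygy x n).2).τ₃

end

/-- A resolution of a short complex by split short exact sequences of projective modules. -/
structure ShortResolution (S : ShortComplex (GBan 𝕜 G)) where
  P : ChainComplex (ShortComplex (GBan 𝕜 G)) ℕ
  ε : P.X 0 ⟶ S
  d_comp_ε : P.d 1 0 ≫ ε = 0
  splitting : ∀ n, (P.X n).Splitting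
  projective₁ : ∀ n, IsProjective (P.X n).X₁
  projective₂ : ∀ n, IsProjective (P.X n).X₂
  projective₃ : ∀ n, IsProjective (P.X n).X₃
  surjective₁ : Function.Surjective (hom ε.τ₁)
  surjective₂ : Function.Surjective (hom ε.τ₂)
  surjective₃ : Function.Surjective (hom ε.τ₃)
  exact_zero₁ : ExactAt (P.d 1 0).τ₁ ε.τ₁
  exact_zero₂ : ExactAt (P.d 1 0).τ₂ ε.τ₂
  exact_zero₃ : ExactAt (P.d 1 0).τ₃ ε.τ₃
  exact_succ₁ : ∀ n, ExactAt (P.d (n + 2) (n + 1)).τ₁ (P.d (n + 1) n).τ₁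
  exact_succ₂ : ∀ n, ExactAt (P.d (n + 2) (n + 1)).τ₂ (P.d (n + 1) n).τ₂
  exact_succ₃ : ∀ n, ExactAt (P.d (n + 2) (n + 1)).τ₃ (P.d (n + 1) n).τ₃

/-- The resolution of a short exact sequence by iterated coverings. -/
def shortResolution {S : ShortComplex (GBan 𝕜 G)} (hS : ShortExact S) : ShortResolution S where
  P := (shortExactCoverings 𝕜 G).complex ⟨S, hS⟩
  ε := coverShortComplexπ hS
  d_comp_ε := (shortExactCoverings 𝕜 G).complex_d_comp ⟨S, hS⟩
  splitting _ := coverSplitting _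
  projective₁ _ := isProjective_cover _
  projective₂ _ := (isProjective_cover _).prod (isProjective_cover _)
  projective₃ _ := isProjective_cover _
  surjective₁ := shortExactCoverings_surjective₁ ⟨S, hS⟩ 0
  surjective₂ := shortExactCoverings_surjective₂ ⟨S, hS⟩ 0
  surjective₃ := shortExactCoverings_surjective₃ ⟨S, hS⟩ 0
  exact_zero₁ := by
    rw [CoveringClass.complex_d]
    exact (shortExactCoverings_exactAt₁ ⟨S, hS⟩ 0).of_covering
      (shortExactCoverings_surjective₁ _ _)
  exact_zero₂ := by
    rw [CoveringClass.complex_d]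
    exact (shortExactCoverings_exactAt₂ ⟨S, hS⟩ 0).of_covering
      (shortExactCoverings_surjective₂ _ _)
  exact_zero₃ := by
    rw [CoveringClass.complex_d]
    exact (shortExactCoverings_exactAt₃ ⟨S, hS⟩ 0).of_covering
      (shortExactCoverings_surjective₃ _ _)
  exact_succ₁ n := by
    rw [CoveringClass.complex_d, CoveringClass.complex_d]
    exact ((shortExactCoverings_exactAt₁ _ _).comp_injective
      (shortExactCoverings_injective₁ _ _)).of_covering (shortExactCoverings_surjective₁ _ _)
  exact_succ₂ n := by
    rw [CoveringClass.complex_d, CoveringClass.complex_d]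
    exact ((shortExactCoverings_exactAt₂ _ _).comp_injective
      (shortExactCoverings_injective₂ _ _)).of_covering (shortExactCoverings_surjective₂ _ _)
  exact_succ₃ n := by
    rw [CoveringClass.complex_d, CoveringClass.complex_d]
    exact ((shortExactCoverings_exactAt₃ _ _).comp_injective
      (shortExactCoverings_injective₃ _ _)).of_covering (shortExactCoverings_surjective₃ _ _)

/-- A morphism out of a split sequence is determined by its restrictions to `P.X₁` and, along the
section, to `P.X₃`. These lift independently, and the third component is then forced, so no
exactness in the third column is required. -/
theorem exists_lift_of_splitting {P A B C : ShortComplex (GBan 𝕜 G)} (s : P.Splitting)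
    (h₁ : IsProjective P.X₁) (h₃ : IsProjective P.X₃) {f : A ⟶ B} {g : B ⟶ C} (w : f ≫ g = 0)
    (hf₁ : ExactAt f.τ₁ g.τ₁) (hf₂ : ExactAt f.τ₂ g.τ₂) (a : P ⟶ B) (ha : a ≫ g = 0) :
    ∃ b, b ≫ f = a := by
  have ha₁ : a.τ₁ ≫ g.τ₁ = 0 := congrArg ShortComplex.Hom.τ₁ ha
  have ha₂ : a.τ₂ ≫ g.τ₂ = 0 := congrArg ShortComplex.Hom.τ₂ ha
  obtain ⟨b₁, hb₁⟩ := h₁.exists_lift (congrArg ShortComplex.Hom.τ₁ w) hf₁ a.τ₁ ha₁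
  obtain ⟨c, hc⟩ := h₃.exists_lift (congrArg ShortComplex.Hom.τ₂ w) hf₂ (s.s ≫ a.τ₂)
    (by rw [Category.assoc, ha₂, comp_zero])
  refine ⟨{ τ₁ := b₁, τ₂ := s.r ≫ b₁ ≫ A.f + P.g ≫ c, τ₃ := c ≫ A.g,
            comm₁₂ := ?_, comm₂₃ := ?_ }, ?_⟩
  · rw [Preadditive.comp_add, s.f_r_assoc, P.zero_assoc, zero_comp, add_zero]
  · rw [Preadditive.add_comp, Category.assoc, Category.assoc, Category.assoc, A.zero, comp_zero,
      comp_zero, zero_add]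
  · ext1
    · exact hb₁
    · change (s.r ≫ b₁ ≫ A.f + P.g ≫ c) ≫ f.τ₂ = a.τ₂
      rw [Preadditive.add_comp, Category.assoc, Category.assoc, Category.assoc, hc, ← f.comm₁₂,
        reassoc_of% hb₁, a.comm₁₂, ← Category.assoc, ← Category.assoc, ← Preadditive.add_comp,
        s.id, Category.id_comp]
    · change (c ≫ A.g) ≫ f.τ₃ = a.τ₃
      rw [Category.assoc, ← f.comm₂₃, reassoc_of% hc, a.comm₂₃, s.s_g_assoc]

namespace ShortResolution

variable {S T : ShortComplex (GBan 𝕜 G)} (R : ShortResolution S) (R' : ShortResolution T)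

theorem exists_lift (f : S ⟶ T) : ∃ φ : R.P ⟶ R'.P, φ.f 0 ≫ R'.ε = R.ε ≫ f :=
  ChainComplex.exists_hom_of_lifting R.ε R'.ε R.d_comp_ε f
    -- Lifting through the augmentation is the case in which the map after it is zero: surjectivity
    -- is exactness before a zero map.
    (fun a => exists_lift_of_splitting (R.splitting 0) (R.projective₁ 0) (R.projective₃ 0)
      (g := (0 : T ⟶ T)) comp_zero (.of_surjective R'.surjective₁ _)
      (.of_surjective R'.surjective₂ _) a comp_zero)
    (exists_lift_of_splitting (R.splitting 1) (R.projective₁ 1) (R.projective₃ 1)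
      R'.d_comp_ε R'.exact_zero₁ R'.exact_zero₂)
    (fun n => exists_lift_of_splitting (R.splitting _) (R.projective₁ _) (R.projective₃ _)
      (R'.P.d_comp_d _ _ _) (R'.exact_succ₁ n) (R'.exact_succ₂ n))

/-- The resolution of the first term. -/
def res₁ : ProjectiveResolution S.X₁ where
  P := (ShortComplex.π₁.mapHomologicalComplex _).obj R.P
  projective := R.projective₁
  ε := R.ε.τ₁
  d_comp_ε := congrArg ShortComplex.Hom.τ₁ R.d_comp_ε
  surjective := R.surjective₁
  exact_zero := R.exact_zero₁
  exact_succ := R.exact_succ₁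

/-- The resolution of the second term. -/
def res₂ : ProjectiveResolution S.X₂ where
  P := (ShortComplex.π₂.mapHomologicalComplex _).obj R.P
  projective := R.projective₂
  ε := R.ε.τ₂
  d_comp_ε := congrArg ShortComplex.Hom.τ₂ R.d_comp_ε
  surjective := R.surjective₂
  exact_zero := R.exact_zero₂
  exact_succ := R.exact_succ₂

/-- The resolution of the third term. -/
def res₃ : ProjectiveResolution S.X₃ where
  P := (ShortComplex.π₃.mapHomologicalComplex _).obj R.P
  projective := R.projective₃
  ε := R.ε.τ₃
  d_comp_ε := congrArg ShortComplex.Hom.τ₃ R.d_comp_ε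
  surjective := R.surjective₃
  exact_zero := R.exact_zero₃
  exact_succ := R.exact_succ₃

/-- The short complex of resolutions. -/
abbrev shortComplex : ShortComplex (ChainComplex (GBan 𝕜 G) ℕ) :=
  ShortComplex.mk (X₁ := R.res₁.P) (X₂ := R.res₂.P) (X₃ := R.res₃.P)
    ((NatTrans.mapHomologicalComplex ShortComplex.π₁Toπ₂ _).app R.P)
    ((NatTrans.mapHomologicalComplex ShortComplex.π₂Toπ₃ _).app R.P)
    (HomologicalComplex.hom_ext _ _ fun n => (R.P.X n).zero)

variable {R R'} in
/-- Functoriality of the short complex of resolutions. -/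
abbrev shortComplexMap (φ : R.P ⟶ R'.P) : R.shortComplex ⟶ R'.shortComplex where
  τ₁ := (ShortComplex.π₁.mapHomologicalComplex _).map φ
  τ₂ := (ShortComplex.π₂.mapHomologicalComplex _).map φ
  τ₃ := (ShortComplex.π₃.mapHomologicalComplex _).map φ
  comm₁₂ := HomologicalComplex.hom_ext _ _ fun n => (φ.f n).comm₁₂
  comm₂₃ := HomologicalComplex.hom_ext _ _ fun n => (φ.f n).comm₂₃

end ShortResolution

end GBan

/-! ### Coinvariants of resolutions -/

theorem CategoryTheory.ShortComplex.Splitting.isShortExact {𝕜 : Type} [RCLike 𝕜]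
    {S : ShortComplex (Ban.{u} 𝕜)} (s : S.Splitting) : Ban.IsShortExact S.f S.g where
  injective x y h := by
    have (z : S.X₁) : Ban.hom s.r (Ban.hom S.f z) = z := congrArg (fun k => Ban.hom k z) s.f_r
    rw [← this x, h, this]
  exact x hx := by
    refine ⟨Ban.hom s.r x, ?_⟩
    have : Ban.hom S.f (Ban.hom s.r x) + Ban.hom s.s (Ban.hom S.g x) = x :=
      congrArg (fun k => Ban.hom k x) s.id
    rwa [hx, map_zero, add_zero] at this
  surjective x := ⟨Ban.hom s.s x, congrArg (fun k => Ban.hom k x) s.s_g⟩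

theorem CategoryTheory.ShortComplex.exists_exact_of_iso {C : Type*} [Category* C]
    [HasZeroMorphisms C] {X₁ X₂ X₃ Y₁ Y₂ Y₃ : C} {f : X₁ ⟶ X₂} {g : X₂ ⟶ X₃} {f' : Y₁ ⟶ Y₂}
    {g' : Y₂ ⟶ Y₃} (h : ∃ w, (ShortComplex.mk f' g' w).Exact) (e₁ : X₁ ≅ Y₁) (e₂ : X₂ ≅ Y₂)
    (e₃ : X₃ ≅ Y₃) (hf : f ≫ e₂.hom = e₁.hom ≫ f') (hg : g ≫ e₃.hom = e₂.hom ≫ g') :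
    ∃ w, (ShortComplex.mk f g w).Exact := by
  obtain ⟨w', h⟩ := h
  have w : f ≫ g = 0 := by
    rw [← cancel_mono e₃.hom, Category.assoc, hg, reassoc_of% hf, w', comp_zero, zero_comp]
  exact ⟨w, (ShortComplex.exact_iff_of_iso (ShortComplex.isoMk e₁ e₂ e₃ hf.symm hg.symm :
    ShortComplex.mk f g w ≅ ShortComplex.mk f' g' w')).2 h⟩

namespace GBan

variable {𝕜 : Type} [RCLike 𝕜] {G : Type u} [Group G]

/-- The projection to the coinvariants. -/
def coinvariantsπ (M : GBan 𝕜 G) : M.space ⟶ (coinvariants 𝕜 G).obj M :=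
  Ban.ofHom (augmentation M).mkQL

theorem coinvariantsπ_eq_zero {M : GBan 𝕜 G} {x : M} :
    Ban.hom (coinvariantsπ M) x = 0 ↔ x ∈ augmentation M :=
  Submodule.Quotient.mk_eq_zero _

theorem coinvariantsπ_surjective (M : GBan 𝕜 G) :
    Function.Surjective (Ban.hom (coinvariantsπ M)) :=
  Submodule.Quotient.mk_surjective _

/-- Right exactness up to closure. The preimage `W` in `P₀` of the closed range contains the kernel
of `ε`, so its image in `M` is closed. That image contains all `m - g m`, hence the whole
augmentation submodule. -/
theorem coinvariants_exact {P₁ P₀ M : GBan 𝕜 G} {d : P₁ ⟶ P₀} {ε : P₀ ⟶ M}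
    (hε : Function.Surjective (hom ε)) (h : ExactAt d ε) (x : (coinvariants 𝕜 G).obj P₀)
    (hx : Ban.hom ((coinvariants 𝕜 G).map ε) x = 0) :
    x ∈ Ban.closedRange ((coinvariants 𝕜 G).map d) := by
  obtain ⟨x, rfl⟩ := coinvariantsπ_surjective _ x
  let W : Submodule 𝕜 P₀ :=
    (Ban.closedRange ((coinvariants 𝕜 G).map d)).comap
      (Ban.hom (coinvariantsπ P₀)).toLinearMap
  have hW : IsClosed (W : Set P₀) :=
    (Submodule.isClosed_topologicalClosure _).preimage (Ban.hom (coinvariantsπ P₀)).continuous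
  have hker (y : P₀) (hy : hom ε y = 0) : y ∈ W := by
    obtain ⟨z, rfl⟩ := h y hy
    exact Ban.apply_mem_closedRange ((coinvariants 𝕜 G).map d)
      (Ban.hom (coinvariantsπ P₁) z)
  have hpre : hom ε ⁻¹' (hom ε '' W) = W := by
    refine Set.Subset.antisymm ?_ (Set.subset_preimage_image _ _)
    rintro y ⟨z, hz, hzy⟩
    have := W.add_mem hz (hker (y - z) (by rw [map_sub, hzy, sub_self]))
    rwa [add_sub_cancel] at this
  -- A surjection of Banach spaces is a topological quotient map, so a subset of `M` is closed once
  -- its preimage, here `W`, is closed.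
  have hcl : IsClosed ((W.map (hom ε).toLinearMap : Submodule 𝕜 M) : Set M) := by
    have hq := ((hom ε).isOpenMap hε).isQuotientMap (hom ε).continuous hε
    refine hq.isClosed_preimage.1 ?_
    have : hom ε ⁻¹' ((W.map (hom ε).toLinearMap : Submodule 𝕜 M) : Set M) = W := hpre
    rwa [this]
  have haug : augmentation M ≤ W.map (hom ε).toLinearMap := by
    refine Submodule.topologicalClosure_minimal _ (Submodule.span_le.2 ?_) hcl
    rintro _ ⟨m, g, rfl⟩
    obtain ⟨p, rfl⟩ := hε m
    refine ⟨p - P₀.ρ g p, ?_, ?_⟩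
    · have h₀ : Ban.hom (coinvariantsπ P₀) (p - P₀.ρ g p) = 0 :=
        coinvariantsπ_eq_zero.2
          (Submodule.le_topologicalClosure _ (Submodule.subset_span ⟨p, g, rfl⟩))
      change Ban.hom (coinvariantsπ P₀) (p - P₀.ρ g p) ∈ Ban.closedRange _
      rw [h₀]
      exact Submodule.zero_mem _
    · change hom ε (p - P₀.ρ g p) = _
      rw [map_sub, hom_equivariant]
  have hxM : hom ε x ∈ augmentation M := coinvariantsπ_eq_zero.1 hx
  have : x ∈ hom ε ⁻¹' (hom ε '' W) := haug hxM
  rwa [hpre] at this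

theorem coinvariants_surjective {M N : GBan 𝕜 G} {ε : M ⟶ N} (hε : Function.Surjective (hom ε)) :
    Function.Surjective (Ban.hom ((coinvariants 𝕜 G).map ε)) := by
  intro y
  obtain ⟨y, rfl⟩ := coinvariantsπ_surjective _ y
  obtain ⟨x, rfl⟩ := hε y
  exact ⟨Ban.hom (coinvariantsπ M) x, rfl⟩

variable (𝕜 G) in
/-- The functor which sends a complex of Banach `G`-modules to the complex of its coinvariants,
regarded as a complex in the right heart. -/
def heartComplex : ChainComplex (GBan 𝕜 G) ℕ ⥤ CochainComplex (RightHeart.{u} 𝕜) ℤ :=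
  coinvariantsComplex 𝕜 G ⋙ RightHeart.ιComplex

variable (𝕜 G) in
/-- The homology of the coinvariants, computed in the right heart. -/
def heartHomology (n : ℤ) : ChainComplex (GBan 𝕜 G) ℕ ⥤ RightHeart.{u} 𝕜 :=
  heartComplex 𝕜 G ⋙ HomologicalComplex.homologyFunctor _ _ (-n)

theorem heartHomology_map_eq (n : ℤ) {P Q : ChainComplex (GBan 𝕜 G) ℕ} {φ ψ : P ⟶ Q}
    (h : Homotopy φ ψ) : (heartHomology 𝕜 G n).map φ = (heartHomology 𝕜 G n).map ψ :=
  ((RightHeart.ι 𝕜).mapHomotopy (((coinvariants 𝕜 G).mapHomotopy h).extend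
    ComplexShape.embeddingDownNat)).homologyMap_eq (-n)

/-- The components of `coinvariantsComplex`. -/
def coinvariantsComplexXIso (P : ChainComplex (GBan 𝕜 G) ℕ) {j : ℕ} {n : ℤ} (h : -(j : ℤ) = n) :
    ((coinvariantsComplex 𝕜 G).obj P).X n ≅ (coinvariants 𝕜 G).obj (P.X j) :=
  (((coinvariants 𝕜 G).mapHomologicalComplex _).obj P).extendXIso ComplexShape.embeddingDownNat h

theorem coinvariantsComplex_map_f {P Q : ChainComplex (GBan 𝕜 G) ℕ} (φ : P ⟶ Q) {j : ℕ} {n : ℤ}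
    (h : -(j : ℤ) = n) : ((coinvariantsComplex 𝕜 G).map φ).f n ≫ (coinvariantsComplexXIso Q h).hom =
      (coinvariantsComplexXIso P h).hom ≫ (coinvariants 𝕜 G).map (φ.f j) := by
  refine (congrArg (· ≫ _) (HomologicalComplex.extendMap_f
    (((coinvariants 𝕜 G).mapHomologicalComplex _).map φ) ComplexShape.embeddingDownNat h)).trans ?_
  refine (Category.assoc _ _ _).trans (congrArg (_ ≫ ·) ?_)
  exact (Category.assoc _ _ _).trans
    ((congrArg (_ ≫ ·) (Iso.inv_hom_id _)).trans (Category.comp_id _))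

theorem coinvariantsComplex_d (P : ChainComplex (GBan 𝕜 G) ℕ) {i j : ℕ} {m n : ℤ}
    (hi : -(i : ℤ) = m) (hj : -(j : ℤ) = n) :
    ((coinvariantsComplex 𝕜 G).obj P).d m n ≫ (coinvariantsComplexXIso P hj).hom =
      (coinvariantsComplexXIso P hi).hom ≫ (coinvariants 𝕜 G).map (P.d i j) := by
  refine (congrArg (· ≫ _) (HomologicalComplex.extend_d_eq
    (((coinvariants 𝕜 G).mapHomologicalComplex _).obj P) ComplexShape.embeddingDownNat hi hj)).trans
    ?_
  refine (Category.assoc _ _ _).trans (congrArg (_ ≫ ·) ?_)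
  exact (Category.assoc _ _ _).trans
    ((congrArg (_ ≫ ·) (Iso.inv_hom_id _)).trans (Category.comp_id _))

theorem isZero_coinvariantsComplex_X (P : ChainComplex (GBan 𝕜 G) ℕ) (n : ℤ)
    (h : ∀ j : ℕ, -(j : ℤ) = n → IsZero (P.X j)) :
    IsZero (((coinvariantsComplex 𝕜 G).obj P).X n) := by
  by_cases hn : ∃ j : ℕ, -(j : ℤ) = n
  · obtain ⟨j, hj⟩ := hn
    exact ((coinvariants 𝕜 G).map_isZero (h j hj)).of_iso (coinvariantsComplexXIso P hj)
  · exact HomologicalComplex.isZero_extend_X _ ComplexShape.embeddingDownNat _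
      fun j hj => hn ⟨j, hj⟩

theorem isZero_heartHomology (P : ChainComplex (GBan 𝕜 G) ℕ) (n : ℤ)
    (h : ∀ j : ℕ, (j : ℤ) = n → IsZero (P.X j)) : IsZero ((heartHomology 𝕜 G n).obj P) := by
  have hz : IsZero (((heartComplex 𝕜 G).obj P).X (-n)) :=
    (RightHeart.ι 𝕜).map_isZero (isZero_coinvariantsComplex_X P (-n) fun j hj => h j (by lia))
  exact (HomologicalComplex.exactAt_iff_isZero_homology _ _).1
    (ShortComplex.exact_of_isZero_X₂ _ hz)

/-! ### Independence of the resolution, degree zero, and vanishing on projectives -/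

namespace ProjectiveResolution

variable {M N L : GBan 𝕜 G}

/-- A chain map lifting a morphism to projective resolutions. -/
def lift (R : ProjectiveResolution M) (R' : ProjectiveResolution N) (f : M ⟶ N) : R.P ⟶ R'.P :=
  (R.exists_lift R' f).choose

theorem lift_ε (R : ProjectiveResolution M) (R' : ProjectiveResolution N) (f : M ⟶ N) :
    (lift R R' f).f 0 ≫ R'.ε = R.ε ≫ f :=
  (R.exists_lift R' f).choose_spec

/-- The map induced on the homology of coinvariants. -/
def homologyMap (n : ℤ) (R : ProjectiveResolution M) (R' : ProjectiveResolution N) (f : M ⟶ N) :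
    (heartHomology 𝕜 G n).obj R.P ⟶ (heartHomology 𝕜 G n).obj R'.P :=
  (heartHomology 𝕜 G n).map (lift R R' f)

variable {R : ProjectiveResolution M} {R' : ProjectiveResolution N}

/-- Any two lifts of `f` are homotopic, so the chosen lift may be replaced by any other. -/
theorem map_eq_homologyMap (n : ℤ) {f : M ⟶ N} {φ : R.P ⟶ R'.P}
    (h : φ.f 0 ≫ R'.ε = R.ε ≫ f) : (heartHomology 𝕜 G n).map φ = homologyMap n R R' f := by
  obtain ⟨H⟩ := nonempty_homotopy h (lift_ε R R' f)
  exact heartHomology_map_eq n H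

variable (R) in
theorem homologyMap_id (n : ℤ) : homologyMap n R R (𝟙 M) = 𝟙 _ :=
  (map_eq_homologyMap n (φ := 𝟙 R.P) ((Category.id_comp _).trans (Category.comp_id _).symm)).symm.trans
    ((heartHomology 𝕜 G n).map_id _)

variable (R R') in
theorem homologyMap_comp (R'' : ProjectiveResolution L) (n : ℤ) (f : M ⟶ N) (g : N ⟶ L) :
    homologyMap n R R' f ≫ homologyMap n R' R'' g = homologyMap n R R'' (f ≫ g) := by
  refine ((heartHomology 𝕜 G n).map_comp _ _).symm.trans (map_eq_homologyMap n ?_)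
  rw [HomologicalComplex.comp_f, Category.assoc, lift_ε, ← Category.assoc, lift_ε, Category.assoc]

/-- Comparison of two resolutions. -/
def comparison (n : ℤ) (R R' : ProjectiveResolution M) :
    (heartHomology 𝕜 G n).obj R.P ≅ (heartHomology 𝕜 G n).obj R'.P where
  hom := homologyMap n R R' (𝟙 M)
  inv := homologyMap n R' R (𝟙 M)
  hom_inv_id := by rw [homologyMap_comp, Category.comp_id, homologyMap_id]
  inv_hom_id := by rw [homologyMap_comp, Category.comp_id, homologyMap_id]

theorem homologyMap_comparison (n : ℤ) (R : ProjectiveResolution M) (R' R'' : ProjectiveResolution N)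
    (f : M ⟶ N) : homologyMap n R R' f ≫ (comparison n R' R'').hom = homologyMap n R R'' f :=
  (homologyMap_comp _ _ _ _ _ _).trans (by rw [Category.comp_id])

theorem comparison_homologyMap (n : ℤ) (R R' : ProjectiveResolution M) (R'' : ProjectiveResolution N)
    (f : M ⟶ N) : (comparison n R R').hom ≫ homologyMap n R' R'' f = homologyMap n R R'' f :=
  (homologyMap_comp _ _ _ _ _ _).trans (by rw [Category.id_comp])

theorem augmentation_exact (R : ProjectiveResolution M) :
    ∃ w, (ShortComplex.mk ((RightHeart.ι 𝕜).map ((coinvariants 𝕜 G).map (R.P.d 1 0)))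
      ((RightHeart.ι 𝕜).map ((coinvariants 𝕜 G).map R.ε)) w).Exact := by
  have w : (coinvariants 𝕜 G).map (R.P.d 1 0) ≫ (coinvariants 𝕜 G).map R.ε = 0 := by
    rw [← Functor.map_comp, R.d_comp_ε, Functor.map_zero]
  exact ⟨_, RightHeart.ι_exact w (coinvariants_surjective R.surjective)
    (coinvariants_exact R.surjective R.exact_zero)⟩

/-- The projection to the coinvariants of the resolved module. -/
def toCoinvariants (R : ProjectiveResolution M) : ((heartComplex 𝕜 G).obj R.P).X (-0) ⟶
    (RightHeart.ι 𝕜).obj ((coinvariants 𝕜 G).obj M) :=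
  (RightHeart.ι 𝕜).map ((coinvariantsComplexXIso R.P (j := 0) (n := -0) rfl).hom ≫
    (coinvariants 𝕜 G).map R.ε)

instance (R : ProjectiveResolution M) : Epi (toCoinvariants R) := by
  have : Epi ((coinvariants 𝕜 G).map R.ε) :=
    Ban.epi_of_denseRange _ (coinvariants_surjective R.surjective).denseRange
  exact inferInstanceAs (Epi ((RightHeart.ι 𝕜).map _))

theorem toCoinvariants_exact (R : ProjectiveResolution M) :
    ∃ w : ((heartComplex 𝕜 G).obj R.P).d (-0 - 1) (-0) ≫ toCoinvariants R = 0,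
      (ShortComplex.mk _ _ w).Exact := by
  refine ShortComplex.exists_exact_of_iso R.augmentation_exact
    ((RightHeart.ι 𝕜).mapIso (coinvariantsComplexXIso R.P (j := 1) (by simp)))
    ((RightHeart.ι 𝕜).mapIso (coinvariantsComplexXIso R.P (j := 0) (by simp))) (Iso.refl _) ?_ ?_
  · exact ((RightHeart.ι 𝕜).map_comp _ _).symm.trans
      ((congrArg (RightHeart.ι 𝕜).map (coinvariantsComplex_d R.P _ _)).trans
        ((RightHeart.ι 𝕜).map_comp _ _))
  · exact (Category.comp_id _).trans ((RightHeart.ι 𝕜).map_comp _ _)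

/-- The presentation of the homology in degree `0` by the coinvariants. -/
def presentation (R : ProjectiveResolution M) :
    HomologyPresentation ((heartComplex 𝕜 G).obj R.P) (-0) where
  H := (RightHeart.ι 𝕜).obj ((coinvariants 𝕜 G).obj M)
  C := (RightHeart.ι 𝕜).obj ((coinvariants 𝕜 G).obj M)
  I := ((heartComplex 𝕜 G).obj R.P).X (-0 + 1)
  π := toCoinvariants R
  -- The complex vanishes in degree 1, so the outgoing differential is zero and the homology is the
  -- whole cokernel.
  r := 0
  i := 𝟙 _
  k := 𝟙 _
  mono_i := inferInstance
  fac := by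
    have hz : IsZero (((heartComplex 𝕜 G).obj R.P).X (-0 + 1)) :=
      (RightHeart.ι 𝕜).map_isZero
        (isZero_coinvariantsComplex_X R.P _ fun j hj => by lia)
    exact hz.eq_of_tgt _ _
  d_comp_π := (toCoinvariants_exact R).choose
  k_comp_r := comp_zero
  isColimit := by
    have : Epi (ShortComplex.mk _ _ (toCoinvariants_exact R).choose).g :=
      inferInstanceAs (Epi (toCoinvariants R))
    exact (toCoinvariants_exact R).choose_spec.gIsCokernel
  isLimit := KernelFork.IsLimit.ofId _ rfl

/-- The homology in degree `0` is given by the coinvariants. -/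
def homologyZeroIso (R : ProjectiveResolution M) :
    (heartHomology 𝕜 G 0).obj R.P ≅ (RightHeart.ι 𝕜).obj ((coinvariants 𝕜 G).obj M) :=
  (presentation R).iso.symm

theorem homologyZeroIso_naturality (R : ProjectiveResolution M) (R' : ProjectiveResolution N)
    (f : M ⟶ N) : homologyMap 0 R R' f ≫ (homologyZeroIso R').hom =
      (homologyZeroIso R).hom ≫ (RightHeart.ι 𝕜).map ((coinvariants 𝕜 G).map f) := by
  have h := HomologyPresentation.iso_naturality (presentation R) (presentation R')
    ((heartComplex 𝕜 G).map (lift R R' f)) ((RightHeart.ι 𝕜).map ((coinvariants 𝕜 G).map f))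
    ((RightHeart.ι 𝕜).map ((coinvariants 𝕜 G).map f)) (by
      refine ((RightHeart.ι 𝕜).map_comp _ _).symm.trans
        ((congrArg (RightHeart.ι 𝕜).map ?_).trans ((RightHeart.ι 𝕜).map_comp _ _))
      rw [← Category.assoc, coinvariantsComplex_map_f, Category.assoc, Category.assoc,
        ← Functor.map_comp, lift_ε, Functor.map_comp])
    ((Category.comp_id _).trans (Category.id_comp _).symm)
  exact (CommSq.vert_inv ⟨h⟩).w

/-- The resolution of a projective module by itself. -/
def ofIsProjective (hM : IsProjective M) : ProjectiveResolution M where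
  P :=
    { X := fun n => Nat.casesOn n M fun _ => zero 𝕜 G
      d := fun _ _ => 0
      shape := fun _ _ _ => rfl
      d_comp_d' := fun _ _ _ _ _ => zero_comp }
  projective n := by
    cases n with
    | zero => exact hM
    | succ n => exact fun _ _ p _ f => ⟨0, (isZero_of_subsingleton (zero 𝕜 G)).eq_of_src _ _⟩
  ε := 𝟙 M
  d_comp_ε := zero_comp
  surjective x := ⟨x, rfl⟩
  exact_zero x hx := ⟨0, (map_zero _).trans hx.symm⟩
  exact_succ _ _ _ := ⟨0, Subsingleton.elim (α := zero 𝕜 G) _ _⟩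

/-- The given resolution is compared with the one of length zero. -/
theorem isZero_homology_of_isProjective {n : ℤ} (hn : 0 < n) (hM : IsProjective M)
    (R : ProjectiveResolution M) : IsZero ((heartHomology 𝕜 G n).obj R.P) := by
  refine IsZero.of_iso (isZero_heartHomology _ n fun j hj => ?_)
    (comparison n R (ofIsProjective hM))
  obtain ⟨j, rfl⟩ := Nat.exists_eq_succ_of_ne_zero (n := j) (by lia)
  exact isZero_of_subsingleton (zero 𝕜 G)

end ProjectiveResolution

/-! ### The long exact sequence of a resolved short exact sequence -/

namespace ShortResolution

variable {S T : ShortComplex (GBan 𝕜 G)} (R : ShortResolution S) (R' : ShortResolution T)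

/-- Only the degreewise splittings make this work: an additive functor preserves them, whereas
coinvariants need not preserve short exact sequences. -/
theorem isShortExact_coinvariants (n : ℤ) :
    Ban.IsShortExact (((coinvariantsComplex 𝕜 G).map R.shortComplex.f).f n)
      (((coinvariantsComplex 𝕜 G).map R.shortComplex.g).f n) := by
  by_cases hn : ∃ j : ℕ, -(j : ℤ) = n
  · obtain ⟨j, hj⟩ := hn
    exact ((R.splitting j).map (coinvariants 𝕜 G)).isShortExact.of_iso
      (coinvariantsComplexXIso _ hj) (coinvariantsComplexXIso _ hj) (coinvariantsComplexXIso _ hj)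
      (coinvariantsComplex_map_f _ hj) (coinvariantsComplex_map_f _ hj)
  · have h (P : ChainComplex (GBan 𝕜 G) ℕ) : IsZero (((coinvariantsComplex 𝕜 G).obj P).X n) :=
      isZero_coinvariantsComplex_X P n fun j hj => (hn ⟨j, hj⟩).elim
    exact .of_isZero _ _ (h _) (h _) (h _)

instance : (coinvariantsComplex 𝕜 G).PreservesZeroMorphisms :=
  inferInstanceAs (((coinvariants 𝕜 G).mapHomologicalComplex (ComplexShape.down ℕ) ⋙
    ComplexShape.embeddingDownNat.extendFunctor (Ban.{u} 𝕜)).PreservesZeroMorphisms)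

instance : (heartComplex 𝕜 G).PreservesZeroMorphisms :=
  inferInstanceAs ((coinvariantsComplex 𝕜 G ⋙ RightHeart.ιComplex).PreservesZeroMorphisms)

/-- The short complex of complexes in the right heart given by the coinvariants of a resolution. -/
abbrev heartShortComplex : ShortComplex (CochainComplex (RightHeart.{u} 𝕜) ℤ) :=
  R.shortComplex.map (heartComplex 𝕜 G)

theorem heartShortComplex_shortExact : R.heartShortComplex.ShortExact :=
  HomologicalComplex.shortExact_of_degreewise_shortExact _ fun n =>
    RightHeart.ι_shortExact (R.isShortExact_coinvariants n) (by
      rw [← HomologicalComplex.comp_f, ← Functor.map_comp, R.shortComplex.zero, Functor.map_zero,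
        HomologicalComplex.zero_f])

/-- The connecting morphism. -/
def δ (n : ℤ) : (heartHomology 𝕜 G (n + 1)).obj R.res₃.P ⟶ (heartHomology 𝕜 G n).obj R.res₁.P :=
  R.heartShortComplex_shortExact.δ (-(n + 1)) (-n) (by simp)

theorem exact₁ (n : ℤ) : ∃ w : R.δ n ≫ (heartHomology 𝕜 G n).map R.shortComplex.f = 0,
    (ShortComplex.mk _ _ w).Exact :=
  ⟨_, R.heartShortComplex_shortExact.homology_exact₁ (-(n + 1)) (-n) (by simp)⟩

theorem exact₂ (n : ℤ) : ∃ w : (heartHomology 𝕜 G n).map R.shortComplex.f ≫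
    (heartHomology 𝕜 G n).map R.shortComplex.g = 0, (ShortComplex.mk _ _ w).Exact :=
  ⟨_, R.heartShortComplex_shortExact.homology_exact₂ (-n)⟩

theorem exact₃ (n : ℤ) : ∃ w : (heartHomology 𝕜 G (n + 1)).map R.shortComplex.g ≫ R.δ n = 0,
    (ShortComplex.mk _ _ w).Exact :=
  ⟨_, R.heartShortComplex_shortExact.homology_exact₃ (-(n + 1)) (-n) (by simp)⟩

variable {R R'} in
theorem δ_naturality (φ : R.P ⟶ R'.P) (n : ℤ) :
    R.δ n ≫ (heartHomology 𝕜 G n).map (shortComplexMap φ).τ₁ =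
      (heartHomology 𝕜 G (n + 1)).map (shortComplexMap φ).τ₃ ≫ R'.δ n :=
  HomologicalComplex.HomologySequence.δ_naturality
    ((heartComplex 𝕜 G).mapShortComplex.map (shortComplexMap φ))
    R.heartShortComplex_shortExact R'.heartShortComplex_shortExact (-(n + 1)) (-n) (by simp)

open ProjectiveResolution

theorem map_f_eq (n : ℤ) :
    (heartHomology 𝕜 G n).map R.shortComplex.f = homologyMap n R.res₁ R.res₂ S.f :=
  map_eq_homologyMap n R.ε.comm₁₂.symm

theorem map_g_eq (n : ℤ) :
    (heartHomology 𝕜 G n).map R.shortComplex.g = homologyMap n R.res₂ R.res₃ S.g :=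
  map_eq_homologyMap n R.ε.comm₂₃.symm

theorem exists_map_eq (f : S ⟶ T) : ∃ φ : R.P ⟶ R'.P, ∀ n : ℤ,
    (heartHomology 𝕜 G n).map (shortComplexMap φ).τ₁ = homologyMap n R.res₁ R'.res₁ f.τ₁ ∧
    (heartHomology 𝕜 G n).map (shortComplexMap φ).τ₃ = homologyMap n R.res₃ R'.res₃ f.τ₃ := by
  obtain ⟨φ, hφ⟩ := R.exists_lift R' f
  exact ⟨φ, fun n => ⟨map_eq_homologyMap n (congrArg ShortComplex.Hom.τ₁ hφ),
    map_eq_homologyMap n (congrArg ShortComplex.Hom.τ₃ hφ)⟩⟩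

end ShortResolution

end GBan

/-! ### `ℓ¹`-homology -/

namespace DeltaFunctor

open GBan GBan.ProjectiveResolution

variable (𝕜 : Type) [RCLike 𝕜] (G : Type u) [Group G]

/-- The homology functors, computed with the chosen resolutions. -/
def l1H (n : ℤ) : GBan 𝕜 G ⥤ RightHeart.{u} 𝕜 where
  obj M := (heartHomology 𝕜 G n).obj (resolution M).P
  map f := homologyMap n (resolution _) (resolution _) f
  map_id M := homologyMap_id (resolution M) n
  map_comp f g := (homologyMap_comp _ _ _ n f g).symm

/-- `ℓ¹`-homology as a `δ`-functor. -/
def l1Homology : DeltaFunctor 𝕜 G where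
  H := l1H 𝕜 G
  δ S hS n := (comparison (n + 1) (resolution S.X₃) (shortResolution hS).res₃).hom ≫
    (shortResolution hS).δ n ≫ (comparison n (shortResolution hS).res₁ (resolution S.X₁)).hom
  δ_naturality {S T} hS hT φ n := by
    -- The morphism of sequences lifts to the simultaneous resolutions. The naturality square then
    -- splits into three: the middle one for the connecting maps and two for the comparisons.
    obtain ⟨ψ, hψ⟩ := (shortResolution hS).exists_map_eq (shortResolution hT) φ
    have h := ShortResolution.δ_naturality ψ n
    rw [(hψ n).1, (hψ (n + 1)).2] at h
    have h₁ : (comparison n (shortResolution hS).res₁ (resolution S.X₁)).hom ≫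
        (l1H 𝕜 G n).map φ.τ₁ = homologyMap n _ (shortResolution hT).res₁ φ.τ₁ ≫
          (comparison n (shortResolution hT).res₁ (resolution T.X₁)).hom :=
      (comparison_homologyMap _ _ _ _ _).trans (homologyMap_comparison _ _ _ _ _).symm
    have h₃ : (l1H 𝕜 G (n + 1)).map φ.τ₃ ≫
        (comparison (n + 1) (resolution T.X₃) (shortResolution hT).res₃).hom =
        (comparison (n + 1) (resolution S.X₃) (shortResolution hS).res₃).hom ≫
          homologyMap (n + 1) _ (shortResolution hT).res₃ φ.τ₃ :=
      (homologyMap_comparison _ _ _ _ _).trans (comparison_homologyMap _ _ _ _ _).symm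
    exact ((CommSq.mk h₃.symm).horiz_comp ((CommSq.mk h).horiz_comp (CommSq.mk h₁))).w
  exact₁ S hS n := by
    refine ShortComplex.exists_exact_of_iso ((shortResolution hS).exact₁ n)
      (comparison (n + 1) (resolution S.X₃) (shortResolution hS).res₃)
      (comparison n (shortResolution hS).res₁ (resolution S.X₁)).symm
      (comparison n (resolution S.X₂) (shortResolution hS).res₂) ?_ ?_
    · exact (Category.assoc _ _ _).trans (congrArg (_ ≫ ·)
        ((Category.assoc _ _ _).trans ((congrArg (_ ≫ ·) (Iso.hom_inv_id _)).trans
          (Category.comp_id _))))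
    · rw [ShortResolution.map_f_eq]
      exact (homologyMap_comparison _ _ _ _ _).trans (comparison_homologyMap _ _ _ _ _).symm
  exact₂ S hS n := by
    refine ShortComplex.exists_exact_of_iso ((shortResolution hS).exact₂ n)
      (comparison n (resolution S.X₁) (shortResolution hS).res₁)
      (comparison n (resolution S.X₂) (shortResolution hS).res₂)
      (comparison n (resolution S.X₃) (shortResolution hS).res₃) ?_ ?_
    · rw [ShortResolution.map_f_eq]
      exact (homologyMap_comparison _ _ _ _ _).trans (comparison_homologyMap _ _ _ _ _).symm
    · rw [ShortResolution.map_g_eq]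
      exact (homologyMap_comparison _ _ _ _ _).trans (comparison_homologyMap _ _ _ _ _).symm
  exact₃ S hS n := by
    refine ShortComplex.exists_exact_of_iso ((shortResolution hS).exact₃ n)
      (comparison (n + 1) (resolution S.X₂) (shortResolution hS).res₂)
      (comparison (n + 1) (resolution S.X₃) (shortResolution hS).res₃)
      (comparison n (shortResolution hS).res₁ (resolution S.X₁)).symm ?_ ?_
    · rw [ShortResolution.map_g_eq]
      exact (homologyMap_comparison _ _ _ _ _).trans (comparison_homologyMap _ _ _ _ _).symm
    · exact (Category.assoc _ _ _).trans (congrArg (_ ≫ ·)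
        ((Category.assoc _ _ _).trans ((congrArg (_ ≫ ·) (Iso.hom_inv_id _)).trans
          (Category.comp_id _))))

theorem isL1Homology_l1Homology : (l1Homology 𝕜 G).IsL1Homology := by
  refine ⟨fun M => ⟨resolution M⟩, fun n M R => comparison n (resolution M) R ≪≫
    (RightHeart.cohomologyIso ((coinvariantsComplex 𝕜 G).obj R.P) (-n)).symm, ?_⟩
  intro n M M' f R R' φ hφ
  have h : (heartHomology 𝕜 G n).map φ ≫
      (RightHeart.cohomologyIso ((coinvariantsComplex 𝕜 G).obj R'.P) (-n)).inv =
      (RightHeart.cohomologyIso ((coinvariantsComplex 𝕜 G).obj R.P) (-n)).inv ≫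
        (RightHeart.cohomology 𝕜 (-n)).map ((coinvariantsComplex 𝕜 G).map φ) :=
    (CommSq.vert_inv ⟨RightHeart.cohomologyIso_naturality (-n) _⟩).w
  rw [map_eq_homologyMap n hφ] at h
  refine (Category.assoc _ _ _).symm.trans
    (Eq.trans ?_ (Category.assoc _ _ _).symm)
  refine Eq.trans ?_ (congrArg (_ ≫ ·) h)
  refine Eq.trans (congrArg (· ≫ _) ?_) (Category.assoc _ _ _)
  exact (homologyMap_comparison _ _ _ _ _).trans (comparison_homologyMap _ _ _ _ _).symm

/-- `ℓ¹`-homology as a normalized `δ`-functor. -/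
def normalizedL1Homology : NormalizedDeltaFunctor 𝕜 G where
  toDeltaFunctor := l1Homology 𝕜 G
  isZero_of_neg n hn M := isZero_heartHomology _ n fun j hj => by lia
  normalization := NatIso.ofComponents (fun M => homologyZeroIso (resolution M))
    (fun f => homologyZeroIso_naturality _ _ f)
  isZero_of_projective _ hn _ hP := isZero_homology_of_isProjective hn hP _

end DeltaFunctor

/-! ### Dimension shifting -/

namespace GBan

variable {𝕜 : Type} [RCLike 𝕜] {G : Type u} [Group G]

/-- The algebraic definition of exactness makes `S.f` a categorical kernel: its corestriction to
`ker S.g` is a continuous bijection, whose inverse is continuous by the open mapping theorem. -/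
theorem ShortExact.exists_lift {S : ShortComplex (GBan 𝕜 G)} (hS : ShortExact S) {M : GBan 𝕜 G}
    (a : M ⟶ S.X₂) (ha : a ≫ S.g = 0) : ∃ b, b ≫ S.f = a := by
  let k := kerLift S.g S.f S.zero
  have hk : k ≫ kerι S.g = S.f := kerLift_kerι _ _ _
  have hinj : Function.Injective (hom k) := fun x y h => hS.injective (by
    rw [← hk, comp_apply, comp_apply, h])
  have hsurj : Function.Surjective (hom k) := fun x => by
    obtain ⟨y, hy⟩ := hS.exact (hom (kerι S.g) x) (congr_hom (kerι_comp S.g) x)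
    exact ⟨y, kerι_injective _ ((congr_hom hk y).trans hy)⟩
  let e := ContinuousLinearEquiv.ofBijective (hom k) (LinearMap.ker_eq_bot.2 hinj)
    (LinearMap.range_eq_top.2 hsurj)
  have he (x) : hom k (e.symm x) = x := e.apply_symm_apply x
  let b : M ⟶ S.X₁ := ofHom ((e.symm : (GBan.ker S.g) →L[𝕜] S.X₁).comp (hom (kerLift S.g a ha)))
    fun g x => hinj (by
      rw [hom_equivariant]
      exact (he _).trans ((hom_equivariant (kerLift S.g a ha) g x).trans
        (congrArg _ (he _).symm)))
  have hb : b ≫ k = kerLift S.g a ha := by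
    ext x
    exact he (hom (kerLift S.g a ha) x)
  exact ⟨b, by rw [← hk, ← Category.assoc, hb, kerLift_kerι]⟩

/-- The short exact sequence given by the cover of `M` and its kernel. -/
abbrev coverSequence (M : GBan 𝕜 G) : ShortComplex (GBan 𝕜 G) :=
  ShortComplex.mk (kerι (coverπ M)) (coverπ M) (kerι_comp _)

theorem shortExact_coverSequence (M : GBan 𝕜 G) : ShortExact (coverSequence M) :=
  ⟨kerι_injective _, exists_kerι_eq _, coverπ_surjective M⟩

/-- Projectivity of the cover lets every connecting morphism be compared with that of a cover
sequence. -/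
theorem exists_coverSequence_hom {M : GBan 𝕜 G} {S : ShortComplex (GBan 𝕜 G)} (hS : ShortExact S)
    (g : M ⟶ S.X₃) : ∃ ψ : coverSequence M ⟶ S, ψ.τ₃ = g := by
  obtain ⟨h, hh⟩ := isProjective_cover M S.g hS.surjective (coverπ M ≫ g)
  obtain ⟨b, hb⟩ := hS.exists_lift (kerι (coverπ M) ≫ h) (by
    rw [Category.assoc, hh, ← Category.assoc, kerι_comp, zero_comp])
  exact ⟨⟨b, h, g, hb, hh⟩, rfl⟩

end GBan

/-! ### Universality -/

namespace DeltaFunctor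

open GBan

variable {𝕜 : Type} [RCLike 𝕜] {G : Type u} [Group G]

/-- The map `b` is chosen before `T` and `n`, so the same one serves two δ-functors at once. -/
theorem exists_δ_coverSequence {M : GBan 𝕜 G} {S : ShortComplex (GBan 𝕜 G)} (hS : ShortExact S)
    (g : M ⟶ S.X₃) : ∃ b : ker (coverπ M) ⟶ S.X₁, ∀ (T : DeltaFunctor 𝕜 G) (n : ℤ),
      T.δ _ (shortExact_coverSequence M) n ≫ (T.H n).map b =
        (T.H (n + 1)).map g ≫ T.δ S hS n := by
  obtain ⟨ψ, rfl⟩ := exists_coverSequence_hom hS g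
  exact ⟨ψ.τ₁, fun T n => T.δ_naturality _ hS ψ n⟩

end DeltaFunctor

namespace NormalizedDeltaFunctor

open GBan DeltaFunctor

variable {𝕜 : Type} [RCLike 𝕜] {G : Type u} [Group G] (T : NormalizedDeltaFunctor 𝕜 G)

/-- The preceding term of the exact sequence is the value of `T` on a projective in degree `n + 1 >
0`, which is zero. -/
theorem mono_δ {n : ℤ} (hn : 0 ≤ n) (M : GBan 𝕜 G) :
    Mono (T.δ _ (shortExact_coverSequence M) n) := by
  obtain ⟨w, h⟩ := T.exact₃ _ (shortExact_coverSequence M) n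
  exact h.mono_g ((T.isZero_of_projective (n + 1) (by lia) _
    (isProjective_cover M)).eq_of_src _ _)

variable {T} in
theorem eq_of_comm {T' : DeltaFunctor 𝕜 G} {n : ℤ} (hn : 0 ≤ n) {f : T'.H n ⟶ T.H n}
    {f₁ f₂ : T'.H (n + 1) ⟶ T.H (n + 1)}
    (h₁ : ∀ S (hS : ShortExact S), T'.δ S hS n ≫ f.app S.X₁ = f₁.app S.X₃ ≫ T.δ S hS n)
    (h₂ : ∀ S (hS : ShortExact S), T'.δ S hS n ≫ f.app S.X₁ = f₂.app S.X₃ ≫ T.δ S hS n) :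
    f₁ = f₂ := by
  ext M : 2
  have := T.mono_δ hn M
  exact (cancel_mono (T.δ _ (shortExact_coverSequence M) n)).1
    ((h₁ _ (shortExact_coverSequence M)).symm.trans (h₂ _ (shortExact_coverSequence M)))

/-- On a cover sequence, the connecting map of `T'` followed by `f` dies in the value of `T.H n` on
the cover. It therefore factors uniquely through the monomorphic connecting map of `T`, and this
factorization is the component at `M`. -/
theorem exists_succ {T' : DeltaFunctor 𝕜 G} {n : ℤ} (hn : 0 ≤ n) (f : T'.H n ⟶ T.H n) :
    ∃ f₁ : T'.H (n + 1) ⟶ T.H (n + 1), ∀ S (hS : ShortExact S),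
      T'.δ S hS n ≫ f.app S.X₁ = f₁.app S.X₃ ≫ T.δ S hS n := by
  have hlift (M : GBan 𝕜 G) : ∃ a : (T'.H (n + 1)).obj M ⟶ (T.H (n + 1)).obj M,
      T'.δ _ (shortExact_coverSequence M) n ≫ f.app (ker (coverπ M)) =
        a ≫ T.δ _ (shortExact_coverSequence M) n := by
    obtain ⟨w, h⟩ := T.exact₁ _ (shortExact_coverSequence M) n
    obtain ⟨w', _⟩ := T'.exact₁ _ (shortExact_coverSequence M) n
    have := T.mono_δ hn M
    have hz : (T'.δ _ (shortExact_coverSequence M) n ≫ f.app (ker (coverπ M))) ≫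
        (T.H n).map (kerι (coverπ M)) = 0 := by
      rw [Category.assoc, ← f.naturality, ← Category.assoc]
      exact (congrArg (· ≫ _) w').trans zero_comp
    exact ⟨_, (h.lift_f _ hz).symm⟩
  choose a ha using hlift
  -- One identity gives both remaining claims: naturality when `S` is a cover sequence, and
  -- compatibility with the connecting maps when `g` is the identity.
  have key {M : GBan 𝕜 G} {S : ShortComplex (GBan 𝕜 G)} (hS : ShortExact S) (g : M ⟶ S.X₃) :
      a M ≫ (T.H (n + 1)).map g ≫ T.δ S hS n =
        (T'.H (n + 1)).map g ≫ T'.δ S hS n ≫ f.app S.X₁ := by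
    obtain ⟨b, hb⟩ := exists_δ_coverSequence hS g
    rw [← hb, ← Category.assoc, ← ha, Category.assoc, ← f.naturality, ← Category.assoc, hb,
      Category.assoc]
  refine ⟨{ app := a, naturality := fun M N g => ?_ }, fun S hS => ?_⟩
  · have := T.mono_δ hn N
    rw [← cancel_mono (T.δ _ (shortExact_coverSequence N) n), Category.assoc, Category.assoc, ← ha]
    exact (key (shortExact_coverSequence N) g).symm
  · have := key hS (𝟙 S.X₃)
    rw [CategoryTheory.Functor.map_id, CategoryTheory.Functor.map_id, Category.id_comp, Category.id_comp] at this
    exact this.symm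

/-- The extension of a natural transformation in degree `0` to the nonnegative degrees. -/
def extension {T' : DeltaFunctor 𝕜 G} (φ : T'.H 0 ⟶ T.H 0) :
    ∀ n : ℕ, T'.H (Int.ofNat n) ⟶ T.H (Int.ofNat n)
  | 0 => φ
  | n + 1 => (T.exists_succ (Int.natCast_nonneg n) (extension φ n)).choose

/-- The extension of a natural transformation in degree `0` to a morphism of `δ`-functors. -/
def extend {T' : DeltaFunctor 𝕜 G} (φ : T'.H 0 ⟶ T.H 0) : T' ⟶ T.toDeltaFunctor where
  app n := match n with
    | Int.ofNat n => T.extension φ n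
    | Int.negSucc _ => 0
  comm S hS n := by
    match n with
    | Int.ofNat n =>
      exact (T.exists_succ (Int.natCast_nonneg n) (T.extension φ n)).choose_spec S hS
    -- For `n = -1` the component in degree `n + 1` is `φ` rather than zero, but the square still
    -- commutes because its target is zero.
    | Int.negSucc n => exact (T.isZero_of_neg _ (Int.negSucc_lt_zero n) _).eq_of_tgt _ _

theorem hom_ext {T' : DeltaFunctor 𝕜 G} {f g : T' ⟶ T.toDeltaFunctor} (h : app f 0 = app g 0) :
    f = g := by
  have hnat (n : ℕ) : app f (Int.ofNat n) = app g (Int.ofNat n) := by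
    induction n with
    | zero => exact h
    | succ n ih =>
      refine eq_of_comm (n := Int.ofNat n) (Int.natCast_nonneg n) (f := app f (Int.ofNat n))
        (fun S hS => f.comm S hS _) (fun S hS => ?_)
      rw [ih]
      exact g.comm S hS _
  refine DeltaFunctor.Hom.ext (funext fun n => ?_)
  match n with
  | Int.ofNat n => exact hnat n
  | Int.negSucc n =>
    ext M : 2
    exact (T.isZero_of_neg _ (Int.negSucc_lt_zero n) M).eq_of_tgt _ _

theorem isUniversal : T.toDeltaFunctor.IsUniversal := fun _ φ =>
  ⟨T.extend φ, rfl, fun _ h => T.hom_ext h⟩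

/-- The normalizations give mutually inverse transformations in degree 0. Their extensions are
mutually inverse because a morphism into a normalized δ-functor is determined in degree 0. -/
theorem existsUnique_iso (T' : NormalizedDeltaFunctor 𝕜 G) :
    ∃! e : T.toDeltaFunctor ≅ T'.toDeltaFunctor,
      app e.hom 0 ≫ T'.normalization.hom = T.normalization.hom := by
  have h₁ : T.normalization.hom ≫ T'.normalization.inv ≫
      T'.normalization.hom ≫ T.normalization.inv = 𝟙 _ := by simp
  have h₂ : T'.normalization.hom ≫ T.normalization.inv ≫
      T.normalization.hom ≫ T'.normalization.inv = 𝟙 _ := by simp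
  refine ⟨⟨T'.extend (T.normalization.hom ≫ T'.normalization.inv),
    T.extend (T'.normalization.hom ≫ T.normalization.inv),
    T.hom_ext ((Category.assoc _ _ _).trans h₁), T'.hom_ext ((Category.assoc _ _ _).trans h₂)⟩,
    ?_, fun e he => ?_⟩
  · exact (Category.assoc _ _ _).trans ((congrArg (_ ≫ ·) (Iso.inv_hom_id _)).trans
      (Category.comp_id _))
  · refine Iso.ext (T'.hom_ext ((Iso.eq_comp_inv _).2 he))

end NormalizedDeltaFunctor

end

theorem mainTheorem2 (𝕜 : Type) [RCLike 𝕜] (G : Type u) [Group G] :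
    (∃ T : NormalizedDeltaFunctor 𝕜 G, T.toDeltaFunctor.IsL1Homology) ∧
    (∀ T T' : NormalizedDeltaFunctor 𝕜 G, ∃! e : T.toDeltaFunctor ≅ T'.toDeltaFunctor,
      DeltaFunctor.app e.hom 0 ≫ T'.normalization.hom = T.normalization.hom) ∧
    (∀ T : NormalizedDeltaFunctor 𝕜 G, T.toDeltaFunctor.IsUniversal) :=
  ⟨⟨DeltaFunctor.normalizedL1Homology 𝕜 G, DeltaFunctor.isL1Homology_l1Homology 𝕜 G⟩,
    fun T T' => T.existsUnique_iso T', fun T => T.isUniversal⟩
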